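/- Let $K$ be a totally real number field of degree $n$ with class number $1$, ring of integers $\mathcal{O}_K$ and real embeddings $\sigma_1,\dots,\sigma_n$. \emph{Group and measure.} Let $\widehat{\Gamma}_K$ be the extended Hilbert modular group, i.e. the group of matrices in $GL_2(\mathcal{O}_K)$ with totally positive determinant, modulo the scalar matrices $\varepsilon I_2$ with $\varepsilon\in\mathcal{O}_K^{\times}$. It acts on $\mathbb{H}^n$ by homographies through $\sigma_1,\dots,\sigma_n$. Let $\mathrm{d}\mu(\tau)=\prod_{j=1}^n \frac{\mathrm{d}x_j\,\mathrm{d}y_j}{y_j^2}$ on $\mathbb{H}^n$; volumes and integrals over $\widehat{\Gamma}_K\backslash\mathbb{H}^n$ are taken over a fundamental domain with respect to this measure. \emph{Distance to cusps.} For $c=[\alpha:\beta]\in\mathbb{P}^1(K)$ with $\alpha,\beta\in\mathcal{O}_K$ and $\tau\in\mathbb{H}^n$, put $$\mu(\tau,c)=\frac{\#\big(\mathcal{O}_K/(\alpha\mathcal{O}_K+\beta\mathcal{O}_K)\big)^2\,\prod_j \operatorname{Im}\tau_j}{\prod_j|-\sigma_j(\beta)\tau_j+\sigma_j(\alpha)|^2},\qquad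 \mu_1(\tau)=\max_{c\in\mathbb{P}^1(K)}\mu(\tau,c).$$ \emph{Hermite constant.} For a place $v$ of $K$ let $|\cdot|_v$ be the absolute value extending the usual one of $\mathbb{Q}$, and $n_v$ the local degree. A rigid adelic space $E$ of dimension $2$ is a $2$-dimensional $K$-vector space $E$ with norms $\|x\|_{E,v}=\|A_v\varphi(x)\|_v$ for all places $v$, where $\varphi:E\to K^2$ is a $K$-linear isomorphism, extended to $E\otimes_K K_v\to K_v^2$, where $(A_v)_v\in GL_2(\mathbb{A}_K)$, and where $\|\cdot\|_v$ on $K_v^2$ is the maximum norm for finite $v$ and the Euclidean norm for infinite $v$. Put $H(E)=\prod_v|\det A_v|_v^{n_v/n}$, $H_E(x)=\prod_v\|x\|_{E,v}^{n_v/n}$ for $x\ne0$, $\Lambda_1(E)=\inf_{x\neq0}H_E(x)$, $\Lambda_2(E)=\inf\{\max(H_E(x),H_E(y)) : \operatorname{span}_K(x,y)=E\}$, and $$c=c_{II}^{\Lambda}(2,K)=\sup_{E}\sqrt{\frac{\Lambda_1(E)\Lambda_2(E)}{H(E)}},$$ the supremum being over all $2$-dimensional rigid adelic spaces $E$ over $K$.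 \emph{Theorem.} The constant $c$ is finite, the maximum defining $\mu_1(\tau)$ is attained for every $\tau\in\mathbb{H}^n$, the action of $\widehat{\Gamma}_K$ on $\mathbb{H}^n$ has a fundamental domain, and $0<\mathrm{vol}(\widehat{\Gamma}_K\backslash\mathbb{H}^n)<\infty$. For every real $0\le t<1$, the function $\mu_1^t$ is integrable over $\widehat{\Gamma}_K\backslash\mathbb{H}^n$ and $$\frac{1}{c^{2nt}}+\frac{t}{1-t}\cdot\frac{1}{c^{2n}}\;\le\;\frac{1}{\mathrm{vol}(\widehat{\Gamma}_K\backslash\mathbb{H}^n)}\int_{\widehat{\Gamma}_K\backslash\mathbb{H}^n}\mu_1(\tau)^t\,\mathrm{d}\mu(\tau)\;\le\;\frac{1}{1-t}.$$ In particular the upper bound is uniform over all totally real number fields $K$ of class number one. -/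

import Mathlib

open NumberField IsDedekindDomain MeasureTheory UpperHalfPlane Matrix
open scoped LinearAlgebra.Projectivization

noncomputable section

namespace HilbertModular

universe u

/-! ### Rigid adelic spaces of dimension two -/

/-- A rigid adelic space of dimension `2` over `K`: a `K`-vector space `E` with an isomorphism
`φ : E ≃ K²` and an element `A = (A_v)_v` of `GL₂(𝔸_K)`, that is, `A_v ∈ GL₂(K_v)` for every place
`v`, with `A_v ∈ GL₂(𝓞_v)` for almost all finite `v`. The norm on `E ⊗ K_v` is
`x ↦ ‖A_v φ_v(x)‖_v`, with `φ_v : E ⊗ K_v ≃ K_v²` the extension of scalars of `φ`. -/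
structure RigidAdelicSpace (K : Type u) [Field K] [NumberField K] : Type (u + 1) where
  carrier : Type u
  [addCommGroup : AddCommGroup carrier]
  [module : Module K carrier]
  φ : carrier ≃ₗ[K] (Fin 2 → K)
  Ainf : ∀ v : InfinitePlace K, GL (Fin 2) v.Completion
  Afin : ∀ v : HeightOneSpectrum (𝓞 K), GL (Fin 2) (v.adicCompletion K)
  almost_all_integral : ∀ᶠ v in Filter.cofinite,
    Afin v ∈ (GeneralLinearGroup.map (n := Fin 2) (v.adicCompletionIntegers K).subtype).range

attribute [instance] RigidAdelicSpace.addCommGroup RigidAdelicSpace.module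

namespace RigidAdelicSpace

variable {K : Type u} [Field K] [NumberField K] (E : RigidAdelicSpace K)

/-- The norm of `x ∈ E` at an infinite place: the Euclidean norm of `A_v φ(x)`. -/
def normInf (v : InfinitePlace K) (x : E.carrier) : ℝ :=
  let z := (E.Ainf v).val *ᵥ fun i => algebraMap K v.Completion (E.φ x i)
  √(‖z 0‖ ^ 2 + ‖z 1‖ ^ 2)

/-- The norm of `x ∈ E` at a finite place `v`, raised to the power `n_v = [K_v : ℚ_p]`: the maximum
norm of `A_v φ(x)`. The norm of Mathlib on `K_v` is the one in which a uniformizer has norm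
`1 / #(𝓞_K / v)`, which is `|·|_v ^ n_v` for the absolute value `|·|_v` extending the `p`-adic one. -/
def normFin (v : HeightOneSpectrum (𝓞 K)) (x : E.carrier) : ℝ :=
  let z := (E.Afin v).val *ᵥ fun i => algebraMap K (v.adicCompletion K) (E.φ x i)
  max ‖z 0‖ ‖z 1‖

/-- The height `H_E(x) = ∏_v ‖x‖_{E,v}^{n_v/n}` of a nonzero vector; for totally real `K`
one has `n_v = 1` at the infinite places. -/
def heightVec (x : E.carrier) : ℝ :=
  ((∏ v : InfinitePlace K, E.normInf v x ^ v.mult) *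
    ∏ᶠ v : HeightOneSpectrum (𝓞 K), E.normFin v x) ^ (1 / (Module.finrank ℚ K : ℝ))

/-- The height `H(E) = ∏_v |det A_v|_v^{n_v/n}` of the space. -/
def height : ℝ :=
  ((∏ v : InfinitePlace K, ‖(E.Ainf v).val.det‖ ^ v.mult) *
    ∏ᶠ v : HeightOneSpectrum (𝓞 K), ‖(E.Afin v).val.det‖) ^ (1 / (Module.finrank ℚ K : ℝ))

/-- The first Roy–Thunder minimum. -/
def Lambda1 : ℝ := sInf {h | ∃ x : E.carrier, x ≠ 0 ∧ h = E.heightVec x}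

/-- The second Roy–Thunder minimum. -/
def Lambda2 : ℝ :=
  sInf {h | ∃ x y : E.carrier, Submodule.span K {x, y} = ⊤ ∧
    h = max (E.heightVec x) (E.heightVec y)}

/-- The quantity whose supremum over all `E` is the Hermite constant. -/
def hermiteRatio : ℝ := √(E.Lambda1 * E.Lambda2 / E.height)

end RigidAdelicSpace

/-- The Hermite constant `c_II^Λ(2, K)`. -/
def hermiteConstant (K : Type u) [Field K] [NumberField K] : ℝ :=
  sSup (Set.range (RigidAdelicSpace.hermiteRatio (K := K)))

/-! ### The extended Hilbert modular group and its action on `ℍⁿ` -/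

/-- `ℍⁿ`, its factors being indexed by the infinite places of `K`, which for a totally real `K`
correspond to the real embeddings. Its measure `volume` is the product of the measures
`dx dy / y²`. -/
abbrev Hn (K : Type u) [Field K] : Type u := InfinitePlace K → ℍ

section

variable (K : Type u) [Field K] [NumberField K] [IsTotallyReal K]

variable {K} in
/-- The real embedding associated with an infinite place, restricted to `𝓞 K`. -/
def sigma (v : InfinitePlace K) : 𝓞 K →+* ℝ :=
  (InfinitePlace.embedding_of_isReal (IsTotallyReal.isReal v)).comp (algebraMap (𝓞 K) K)

/-- The matrices in `GL₂(𝓞_K)` with totally positive determinant. -/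
def totPosGL : Subgroup (GL (Fin 2) (𝓞 K)) where
  carrier := {g | ∀ v : InfinitePlace K, 0 < sigma v g.val.det}
  mul_mem' {a b} ha hb v := by
    rw [Units.val_mul, Matrix.det_mul, map_mul]
    exact mul_pos (ha v) (hb v)
  one_mem' v := by simp
  inv_mem' {a} ha v := by
    have h : sigma v a.val.det * sigma v (a⁻¹).val.det = 1 := by
      rw [← map_mul, ← Matrix.det_mul, ← Units.val_mul]
      simp
    exact pos_of_mul_pos_right (h ▸ one_pos) (ha v).le

/-- The scalar matrices `ε I₂`, with `ε` a unit of `𝓞_K`. -/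
def scalars : Subgroup (totPosGL K) :=
  (GeneralLinearGroup.scalar (Fin 2) (R := 𝓞 K)).range.subgroupOf (totPosGL K)

instance : (scalars K).Normal := by
  refine Subgroup.Normal.subgroupOf ⟨?_⟩ _
  rintro _ ⟨ε, rfl⟩ g
  refine ⟨ε, ?_⟩
  rw [← GeneralLinearGroup.scalar_commute, mul_inv_cancel_right]

/-- The extended Hilbert modular group. -/
def ExtHilbertGroup : Type u := totPosGL K ⧸ scalars K

instance : Group (ExtHilbertGroup K) := inferInstanceAs (Group (totPosGL K ⧸ scalars K))

/-- Matrices in `GL₂(𝓞_K)` with totally positive determinant act on `ℍⁿ` by homographies, through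
the real embeddings. -/
def matrixAction : totPosGL K →* Equiv.Perm (Hn K) where
  toFun g :=
    { toFun := fun τ v => GeneralLinearGroup.map (sigma v) g.1 • τ v
      invFun := fun τ v => (GeneralLinearGroup.map (sigma v) g.1)⁻¹ • τ v
      left_inv := fun τ => by ext v : 1; simp
      right_inv := fun τ => by ext v : 1; simp }
  map_one' := by ext τ : 1; ext v : 1; simp
  map_mul' g h := by ext τ : 1; ext v : 1; simp [mul_smul]

theorem scalars_le_ker : scalars K ≤ (matrixAction K).ker := by
  rintro g ⟨ε, hε⟩
  rw [MonoidHom.mem_ker]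
  ext τ : 1
  ext v : 1
  have h : g.1 = GeneralLinearGroup.scalar (Fin 2) ε := hε.symm
  change GeneralLinearGroup.map (sigma v) g.1 • τ v = τ v
  rw [h, GeneralLinearGroup.map_scalar, UpperHalfPlane.glScalar_smul]

/-- The action of the extended Hilbert modular group on `ℍⁿ`. -/
instance : MulAction (ExtHilbertGroup K) (Hn K) :=
  MulAction.compHom (Hn K) (QuotientGroup.lift (scalars K) (matrixAction K) (scalars_le_ker K))

end

/-! ### Distance to the cusps -/

section

variable {K : Type u} [Field K] [NumberField K] [IsTotallyReal K]

/-- `N(α, β)² N(Im τ) / |N(-β τ + α)|²` for `α, β ∈ 𝓞_K`. -/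
def muPair (τ : Hn K) (α β : 𝓞 K) : ℝ :=
  (Ideal.absNorm (Ideal.span {α, β}) : ℝ) ^ 2 * (∏ v : InfinitePlace K, (τ v).im) /
    ‖∏ v : InfinitePlace K, (-(sigma v β : ℂ) * (τ v : ℂ) + (sigma v α : ℂ))‖ ^ 2

/-- `[α : β]` is a pair of homogeneous coordinates in `𝓞_K` of the point `c` of `ℙ¹(K)`. -/
def IsIntegralRep (c : ℙ K (Fin 2 → K)) (α β : 𝓞 K) : Prop :=
  ∃ h : (![(α : K), (β : K)] : Fin 2 → K) ≠ 0, Projectivization.mk K _ h = c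

theorem exists_isIntegralRep (c : ℙ K (Fin 2 → K)) :
    ∃ p : 𝓞 K × 𝓞 K, IsIntegralRep c p.1 p.2 := by
  induction c using Projectivization.ind with
  | h w hw =>
    obtain ⟨b, hb⟩ := IsLocalization.exist_integer_multiples_of_finite (nonZeroDivisors (𝓞 K)) w
    obtain ⟨α, hα⟩ := hb 0
    obtain ⟨β, hβ⟩ := hb 1
    have hb0 : ((b : 𝓞 K) : K) ≠ 0 := by
      simp
    have key : (![(α : K), (β : K)] : Fin 2 → K) = ((b : 𝓞 K) : K) • w := by
      ext i
      fin_cases i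
      · simpa [Algebra.smul_def] using hα
      · simpa [Algebra.smul_def] using hβ
    have hne : (![(α : K), (β : K)] : Fin 2 → K) ≠ 0 := by
      rw [key]
      exact smul_ne_zero hb0 hw
    refine ⟨(α, β), hne, ?_⟩
    rw [Projectivization.mk_eq_mk_iff']
    exact ⟨_, key.symm⟩

/-- The function `μ(τ, c)` of a point `τ` of `ℍⁿ` and a cusp `c ∈ ℙ¹(K)`, computed from integral
homogeneous coordinates `[α : β]` of `c`. -/
def mu (τ : Hn K) (c : ℙ K (Fin 2 → K)) : ℝ :=
  muPair τ (exists_isIntegralRep c).choose.1 (exists_isIntegralRep c).choose.2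

theorem muPair_mul (τ : Hn K) {l : 𝓞 K} (hl : l ≠ 0) (α β : 𝓞 K) :
    muPair τ (l * α) (l * β) = muPair τ α β := by
  have h1 : Ideal.span {l * α, l * β} = Ideal.span {l} * Ideal.span {α, β} := by
    rw [Ideal.span_mul_span']
    congr 1
    simp [Set.singleton_mul, Set.image_pair]
  have h2 : ‖∏ v : InfinitePlace K, (sigma v l : ℂ)‖ = Ideal.absNorm (Ideal.span {l}) := by
    have h := InfinitePlace.prod_eq_abs_norm (l : K)
    rw [Ideal.absNorm_span_singleton, norm_prod]
    have h3 : ∀ v : InfinitePlace K, ‖(sigma v l : ℂ)‖ = v (l : K) ^ v.mult := by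
      intro v
      rw [InfinitePlace.mult_isReal ⟨v, IsTotallyReal.isReal v⟩, pow_one, Complex.norm_real]
      exact InfinitePlace.norm_embedding_of_isReal (IsTotallyReal.isReal v) (l : K)
    rw [Finset.prod_congr rfl fun v _ => h3 v, h, ← Algebra.coe_norm_int]
    simp [Nat.cast_natAbs]
  have h4 : (Ideal.absNorm (Ideal.span {l}) : ℝ) ≠ 0 := by
    rw [Nat.cast_ne_zero, Ne, Ideal.absNorm_eq_zero_iff, Ideal.span_singleton_eq_bot]
    exact hl
  have h5 : (∏ v : InfinitePlace K, (-(sigma v (l * β) : ℂ) * (τ v : ℂ) + (sigma v (l * α) : ℂ)))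
      = (∏ v : InfinitePlace K, (sigma v l : ℂ)) *
        ∏ v : InfinitePlace K, (-(sigma v β : ℂ) * (τ v : ℂ) + (sigma v α : ℂ)) := by
    rw [← Finset.prod_mul_distrib]
    refine Finset.prod_congr rfl fun v _ => ?_
    push_cast [map_mul]
    ring
  unfold muPair
  rw [h1, h5, norm_mul, h2, map_mul]
  push_cast
  rw [mul_pow, mul_pow, mul_assoc, mul_div_mul_left _ _ (pow_ne_zero 2 h4)]

/-- `μ(τ, c)` does not depend on the integral homogeneous coordinates of `c`. -/
theorem mu_eq (τ : Hn K) (c : ℙ K (Fin 2 → K)) (α β : 𝓞 K) (h : IsIntegralRep c α β) :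
    mu τ c = muPair τ α β := by
  unfold mu
  obtain ⟨h0, h0'⟩ := (exists_isIntegralRep c).choose_spec
  obtain ⟨h1, h1'⟩ := h
  generalize (exists_isIntegralRep c).choose = p at *
  rw [← h1', Projectivization.mk_eq_mk_iff'] at h0'
  obtain ⟨a, ha⟩ := h0'
  obtain ⟨x, y, hy, rfl⟩ := IsFractionRing.div_surjective (A := 𝓞 K) a
  have hy0 : y ≠ 0 := nonZeroDivisors.ne_zero hy
  have hyK : (algebraMap (𝓞 K) K y) ≠ 0 := by simpa using hy0
  have hx0 : x ≠ 0 := by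
    rintro rfl
    apply h0
    rw [← ha]
    simp
  have e0 : x * α = y * p.1 := by
    have := congrFun ha 0
    simp only [Pi.smul_apply, Matrix.cons_val_zero, smul_eq_mul] at this
    field_simp at this
    exact_mod_cast this
  have e1 : x * β = y * p.2 := by
    have := congrFun ha 1
    simp only [Pi.smul_apply, Matrix.cons_val_one, Matrix.cons_val_fin_one,
      smul_eq_mul] at this
    field_simp at this
    exact_mod_cast this
  rw [← muPair_mul τ hy0, ← e0, ← e1, muPair_mul τ hx0]

/-- `μ₁(τ)`, the maximum of `μ(τ, c)` over all cusps `c`. -/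
def mu1 (τ : Hn K) : ℝ := sSup (Set.range (mu τ))

end

end HilbertModular

end

noncomputable section

namespace HilbertModular

universe u

set_option linter.unusedSectionVars false

/-! ### Units and integers under the real embeddings -/

/-! Class number one leaves a single cusp, so `μ(τ, ·)` takes exactly the values `N(Im γτ)`, with
`γ` in the group, and `μ₁(τ)` is their maximum (`range_mu`, `mu1_isGreatest`). Everything reduces to
the volumes of the superlevel sets of `μ₁` in the quotient, found by unfolding to the horoball
`{N(Im τ) > s}` modulo the stabilizer of infinity.

Let `V` be the covolume and `C(s)` the volume of this horoball modulo `cuspGroup`. Stretching all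
imaginary parts by `s^(1/n)` commutes with the stabilizer and gives `C(s) = C(1)/s`
(`volume_inter_horoball_one`). Every point with `μ₁ > s` can be moved into the horoball, so `vol{μ₁
> s} ≤ C(s)` for all `s` (`volume_inter_lt_mu1_le`). For `s ≥ 1` this is an equality, because `N(Im
τ) N(Im γτ) > 1` forces `γ` to fix infinity (`bottom_left_eq_zero_of_one_lt`,
`volume_inter_horoball_le`).

The layer-cake formula then gives the moments (`moment_bounds`). Put `C = C(1)`. The range `s > 1`
contributes `tC/(1-t)`; the range `s ≤ 1` contributes at most `V` and, if `μ₁ ≥ m`, at least `V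
m^t`. The upper bound follows from `C ≤ V`, the lower one from `C ≥ mV`, which results from `V =
vol{μ₁ > s} ≤ C/s` as `s` increases to `m`.

The value `m = c^(-2n)` comes from the space attached to `τ` (`pointSpace`): it has height 1, and
all its nonzero vectors have height at least `μ₁(τ)^(-1/(2n))`, so `c` is at least this number
(`le_hermiteConstant`). This requires the supremum `c` to be finite (`bddAbove_hermiteRatio`): a
descent on the determinant produces a basis that is unimodular at all finite places
(`exists_unimodular_basis`), the norms at infinity then define a point of `ℍⁿ`, and moving this
point into a Siegel set (`exists_smul_mem_siegel`) yields a basis whose product of heights is at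
most a constant times `H(E)`. The same Siegel set bounds the covolume. It is obtained from
Dirichlet's unit theorem and from the fact that `𝓞_K` is a lattice in `ℝⁿ`. -/

theorem exists_norm_sub_le_of_isZLattice {E : Type*} [NormedAddCommGroup E] [NormedSpace ℝ E]
    [FiniteDimensional ℝ E] (L : Submodule ℤ E) [DiscreteTopology L] [IsZLattice ℝ L] :
    ∃ R : ℝ, 0 ≤ R ∧ ∀ x : E, ∃ l ∈ L, ‖x - l‖ ≤ R := by
  classical
  let b := (Module.Free.chooseBasis ℤ L).ofZLatticeBasis ℝ L
  refine ⟨∑ i, ‖b i‖, Finset.sum_nonneg fun _ _ => norm_nonneg _, fun x => ⟨ZSpan.floor b x, ?_, ?_⟩⟩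
  · exact ((Module.Free.chooseBasis ℤ L).ofZLatticeBasis_span ℝ).le (ZSpan.floor b x).2
  · rw [← ZSpan.fract_apply]
    exact ZSpan.norm_fract_le b x

section

variable {K : Type u} [Field K] [NumberField K] [IsTotallyReal K]

theorem abs_sigma (v : InfinitePlace K) (a : 𝓞 K) : |sigma v a| = v (a : K) :=
  InfinitePlace.norm_embedding_of_isReal (IsTotallyReal.isReal v) (a : K)

theorem sigma_injective (v : InfinitePlace K) : Function.Injective (sigma v) := by
  intro a b h
  exact RingOfIntegers.ext
    ((InfinitePlace.embedding_of_isReal (IsTotallyReal.isReal v)).injective h)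

theorem sigma_ne_zero (v : InfinitePlace K) {a : 𝓞 K} (ha : a ≠ 0) : sigma v a ≠ 0 :=
  (map_ne_zero_iff _ (sigma_injective v)).2 ha

theorem prod_abs_sigma (a : 𝓞 K) :
    ∏ v : InfinitePlace K, |sigma v a| = Ideal.absNorm (Ideal.span {a}) := by
  have h := InfinitePlace.prod_eq_abs_norm (a : K)
  rw [Ideal.absNorm_span_singleton]
  have h3 : ∀ v : InfinitePlace K, |sigma v a| = v (a : K) ^ v.mult := by
    intro v
    rw [InfinitePlace.mult_isReal ⟨v, IsTotallyReal.isReal v⟩, pow_one, abs_sigma]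
  rw [Finset.prod_congr rfl fun v _ => h3 v, h, ← Algebra.coe_norm_int]
  simp [Nat.cast_natAbs]

theorem one_le_prod_abs_sigma {a : 𝓞 K} (ha : a ≠ 0) :
    1 ≤ ∏ v : InfinitePlace K, |sigma v a| := by
  rw [prod_abs_sigma, Nat.one_le_cast, Nat.one_le_iff_ne_zero, Ne, Ideal.absNorm_eq_zero_iff,
    Ideal.span_singleton_eq_bot]
  exact ha

theorem prod_abs_sigma_unit {a : 𝓞 K} (ha : IsUnit a) :
    ∏ v : InfinitePlace K, |sigma v a| = 1 := by
  rw [prod_abs_sigma, Ideal.span_singleton_eq_top.2 ha, Ideal.absNorm_top, Nat.cast_one]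

theorem finite_setOf_abs_sigma_le (B : ℝ) :
    {a : 𝓞 K | ∀ v : InfinitePlace K, |sigma v a| ≤ B}.Finite := by
  refine Set.Finite.of_finite_image (f := fun a : 𝓞 K => (a : K)) ?_
    (RingOfIntegers.coe_injective.injOn)
  refine (Embeddings.finite_of_norm_le K ℂ B).subset ?_
  rintro _ ⟨a, ha, rfl⟩
  refine ⟨RingOfIntegers.isIntegral_coe a, fun φ => ?_⟩
  rw [← InfinitePlace.apply φ (a : K), ← abs_sigma]
  exact ha _

variable (K) in
theorem card_infinitePlace : Fintype.card (InfinitePlace K) = Module.finrank ℚ K := by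
  rw [InfinitePlace.card_eq_nrRealPlaces_add_nrComplexPlaces,
    IsTotallyReal.nrComplexPlaces_eq_zero, add_zero, IsTotallyReal.finrank]

variable (K) in
/-- The logarithms of the units approximate every vector of trace zero. -/
theorem exists_unit_log_sub_le :
    ∃ R : ℝ, 0 ≤ R ∧ ∀ l : InfinitePlace K → ℝ, ∑ v, l v = 0 →
      ∃ ε : (𝓞 K)ˣ, ∀ v, |Real.log |sigma v ε| - l v| ≤ R := by
  classical
  obtain ⟨R, hR0, hR⟩ := exists_norm_sub_le_of_isZLattice (Units.unitLattice K)
  -- The unit lattice omits the place `w₀`. The logarithms of a unit and the entries of `l` both sum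
  -- to zero, so the error at `w₀` is minus the sum of the other errors; hence the factor counting
  -- places.
  refine ⟨(Fintype.card (InfinitePlace K) + 1) * R, by positivity, fun l hl => ?_⟩
  obtain ⟨e, he, hle⟩ := hR (fun w => l w.1)
  obtain ⟨ε, -, rfl⟩ := he
  refine ⟨ε.toMul, fun v => ?_⟩
  have hmult : ∀ v : InfinitePlace K, v.mult = 1 := fun v =>
    InfinitePlace.mult_isReal ⟨v, IsTotallyReal.isReal v⟩
  have key : ∀ w : {w : InfinitePlace K // w ≠ Units.dirichletUnitTheorem.w₀},
      |Real.log |sigma w.1 (ε.toMul : 𝓞 K)| - l w.1| ≤ R := by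
    intro w
    have h := (norm_le_pi_norm _ w).trans hle
    rw [Real.norm_eq_abs, Pi.sub_apply, abs_sub_comm] at h
    rw [abs_sigma]
    change |((InfinitePlace.mult w.val : ℕ) : ℝ) * Real.log (w.val (ε.toMul : K)) - l w.1| ≤ R at h
    rw [hmult, Nat.cast_one, one_mul] at h
    exact h
  by_cases hv : v = Units.dirichletUnitTheorem.w₀
  · subst hv
    have h1 := Units.sum_mult_mul_log ε.toMul
    simp only [hmult, Nat.cast_one, one_mul] at h1
    have h2 : ∑ w, (Real.log |sigma w (ε.toMul : 𝓞 K)| - l w) = 0 := by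
      rw [Finset.sum_sub_distrib, hl, sub_zero, ← h1]
      exact Finset.sum_congr rfl fun w _ => by rw [abs_sigma]
    rw [Fintype.sum_eq_add_sum_subtype_ne _ Units.dirichletUnitTheorem.w₀] at h2
    rw [eq_neg_of_add_eq_zero_left h2, abs_neg]
    refine (Finset.abs_sum_le_sum_abs _ _).trans ((Finset.sum_le_card_nsmul _ _ R
      fun w _ => key w).trans ?_)
    rw [nsmul_eq_mul]
    refine mul_le_mul_of_nonneg_right ?_ hR0
    rw [Finset.card_univ]
    have := Fintype.card_subtype_le
      (fun w : InfinitePlace K => w ≠ Units.dirichletUnitTheorem.w₀)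
    exact_mod_cast this.trans (Nat.le_succ _)
  · refine (key ⟨v, hv⟩).trans ?_
    nlinarith [Nat.cast_nonneg (α := ℝ) (Fintype.card (InfinitePlace K))]

variable (K) in
/-- Every positive vector can be balanced by the square of a unit. -/
theorem exists_unit_balance :
    ∃ M : ℝ, 1 ≤ M ∧ ∀ r : InfinitePlace K → ℝ, (∀ v, 0 < r v) →
      ∃ ε : (𝓞 K)ˣ, ∀ v w, sigma v ε ^ 2 * r v ≤ M * (sigma w ε ^ 2 * r w) := by
  obtain ⟨R, hR0, hR⟩ := exists_unit_log_sub_le K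
  -- The unit brings each logarithm of `σ_v(ε)² r_v` within `2R` of the mean `A` of the `log r_v`,
  -- so two of them differ by at most `4R`.
  refine ⟨Real.exp (4 * R), Real.one_le_exp (by positivity), fun r hr => ?_⟩
  let A : ℝ := (∑ v, Real.log (r v)) / Fintype.card (InfinitePlace K)
  have hcard : (Fintype.card (InfinitePlace K) : ℝ) ≠ 0 := by
    exact_mod_cast Fintype.card_ne_zero
  obtain ⟨ε, hε⟩ := hR (fun v => -(Real.log (r v) - A) / 2) (by
    rw [← Finset.sum_div, Finset.sum_neg_distrib, Finset.sum_sub_distrib, Finset.sum_const,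
      Finset.card_univ, nsmul_eq_mul]
    simp only [A]
    field_simp
    simp)
  refine ⟨ε, fun v w => ?_⟩
  have hpos : ∀ v, 0 < sigma v (ε : 𝓞 K) ^ 2 * r v := fun v =>
    mul_pos (sq_pos_of_ne_zero (sigma_ne_zero v ε.ne_zero)) (hr v)
  have hlog : ∀ v, Real.log (sigma v (ε : 𝓞 K) ^ 2 * r v) =
      2 * Real.log |sigma v (ε : 𝓞 K)| + Real.log (r v) := by
    intro v
    rw [Real.log_mul (pow_ne_zero 2 (sigma_ne_zero v ε.ne_zero)) (hr v).ne', Real.log_pow,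
      Real.log_abs]
    norm_num
  rw [← Real.log_le_log_iff (hpos v) (mul_pos (Real.exp_pos _) (hpos w)),
    Real.log_mul (Real.exp_pos _).ne' (hpos w).ne', Real.log_exp, hlog, hlog]
  have h1 := abs_le.1 (hε v)
  have h2 := abs_le.1 (hε w)
  linarith [h1.2, h2.1]

variable (K) in
/-- A positive vector of bounded norm can be bounded after multiplication by the square of a
unit. -/
theorem exists_unit_bound (H : ℝ) :
    ∃ C : ℝ, ∀ r : InfinitePlace K → ℝ, (∀ v, 0 < r v) → ∏ v, r v ≤ H →
      ∃ ε : (𝓞 K)ˣ, ∀ v, sigma v ε ^ 2 * r v ≤ C := by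
  obtain ⟨M, hM1, hM⟩ := exists_unit_balance K
  -- An entry `x > 1` of the balanced vector satisfies `x ≤ xⁿ`, and balance gives `xⁿ ≤ Mⁿ ∏ r_v`
  -- because the unit has norm `±1`.
  refine ⟨max 1 (M ^ Fintype.card (InfinitePlace K) * H), fun r hr hH => ?_⟩
  obtain ⟨ε, hε⟩ := hM r hr
  refine ⟨ε, fun v => ?_⟩
  by_contra! hlt
  have h1 : sigma v (ε : 𝓞 K) ^ 2 * r v ≤
      (sigma v (ε : 𝓞 K) ^ 2 * r v) ^ Fintype.card (InfinitePlace K) :=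
    le_self_pow₀ ((le_max_left _ _).trans hlt.le) Fintype.card_ne_zero
  have h2 : (sigma v (ε : 𝓞 K) ^ 2 * r v) ^ Fintype.card (InfinitePlace K) ≤
      M ^ Fintype.card (InfinitePlace K) * H := by
    calc (sigma v (ε : 𝓞 K) ^ 2 * r v) ^ Fintype.card (InfinitePlace K)
        = ∏ w : InfinitePlace K, (sigma v (ε : 𝓞 K) ^ 2 * r v) := by
          rw [Finset.prod_const, Finset.card_univ]
      _ ≤ ∏ w : InfinitePlace K, M * (sigma w (ε : 𝓞 K) ^ 2 * r w) :=
          Finset.prod_le_prod (fun w _ => mul_nonneg (sq_nonneg _) (hr v).le) fun w _ => hε v w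
      _ = M ^ Fintype.card (InfinitePlace K) * ∏ w, r w := by
          rw [Finset.prod_mul_distrib, Finset.prod_mul_distrib, Finset.prod_const,
            Finset.card_univ, Finset.prod_pow]
          have h : (∏ w : InfinitePlace K, sigma w (ε : 𝓞 K)) ^ 2 = 1 := by
            rw [← sq_abs, Finset.abs_prod, prod_abs_sigma_unit ε.isUnit, one_pow]
          rw [h, one_mul]
      _ ≤ _ := mul_le_mul_of_nonneg_left hH (by positivity)
  exact absurd (h1.trans h2) (not_le.2 ((le_max_right _ _).trans_lt hlt))

variable (K) in
theorem exists_integer_sub_le :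
    ∃ B : ℝ, 0 ≤ B ∧ ∀ x : InfinitePlace K → ℝ, ∃ a : 𝓞 K, ∀ v, |x v - sigma v a| ≤ B := by
  classical
  obtain ⟨R, hR0, hR⟩ := exists_norm_sub_le_of_isZLattice (mixedEmbedding.integerLattice K)
  refine ⟨R, hR0, fun x => ?_⟩
  obtain ⟨l, hl, hle⟩ := hR (fun w => x w.1, 0)
  obtain ⟨a, rfl⟩ := hl
  refine ⟨a, fun v => ?_⟩
  exact (norm_le_pi_norm _ (⟨v, IsTotallyReal.isReal v⟩ : {w : InfinitePlace K // w.IsReal})).trans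
    ((norm_fst_le _).trans hle)

variable (K) in
/-- Simultaneous approximation by a multiple of bounded size. -/
theorem exists_multiple_sub_le :
    ∃ N : ℕ, ∀ x : InfinitePlace K → ℝ, ∃ k : ℕ, 1 ≤ k ∧ k ≤ N ∧
      ∃ a : 𝓞 K, ∀ v, |k * x v - sigma v a| ≤ 1 / 2 := by
  classical
  obtain ⟨B, hB0, hB⟩ := exists_integer_sub_le K
  -- Pigeonhole: among the remainders of `j x` modulo `𝓞_K` for `0 ≤ j ≤ #t`, two lie in one ball of
  -- radius 1/4. The multiple sought is the difference of their indices.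
  obtain ⟨t, ht, hcov⟩ := Metric.totallyBounded_iff.1
    (isCompact_closedBall (0 : InfinitePlace K → ℝ) B).totallyBounded (1 / 4) (by norm_num)
  refine ⟨ht.toFinset.card, fun x => ?_⟩
  choose a ha using fun j : ℕ => hB (fun v => j * x v)
  have hmem : ∀ j : ℕ, ∃ c ∈ ht.toFinset,
      dist (fun v => j * x v - sigma v (a j)) c < 1 / 4 := by
    intro j
    have : (fun v => j * x v - sigma v (a j)) ∈ Metric.closedBall (0 : InfinitePlace K → ℝ) B := by
      rw [mem_closedBall_zero_iff, pi_norm_le_iff_of_nonneg hB0]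
      exact ha j
    obtain ⟨c, hc, hd⟩ := Set.mem_iUnion₂.1 (hcov this)
    exact ⟨c, ht.mem_toFinset.2 hc, hd⟩
  choose c hct hc using hmem
  obtain ⟨i, hi, j, hj, hne, heq⟩ := Finset.exists_ne_map_eq_of_card_lt_of_maps_to
    (s := Finset.range (ht.toFinset.card + 1)) (t := ht.toFinset) (f := c) (by simp)
    (fun j _ => hct j)
  have main : ∀ i j : ℕ, i < j → j < ht.toFinset.card + 1 → c i = c j →
      ∃ k : ℕ, 1 ≤ k ∧ k ≤ ht.toFinset.card ∧
        ∃ a : 𝓞 K, ∀ v, |k * x v - sigma v a| ≤ 1 / 2 := by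
    intro i j hij hj heq
    refine ⟨j - i, by omega, by omega, a j - a i, fun v => ?_⟩
    have h1 := (dist_le_pi_dist _ _ v).trans (hc i).le
    have h2 := (dist_le_pi_dist _ _ v).trans (hc j).le
    rw [heq] at h1
    rw [Real.dist_eq, abs_le] at h1 h2
    rw [Nat.cast_sub hij.le, map_sub, abs_le]
    constructor <;> linarith [h1.1, h1.2, h2.1, h2.2]
  rw [Finset.mem_range] at hi hj
  rcases lt_or_gt_of_ne hne with h | h
  · exact main i j h hj heq
  · exact main j i h hi heq.symm

end

/-! ### The height of a point and its values on an orbit -/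

section

variable {K : Type u} [Field K] [NumberField K] [IsTotallyReal K]

/-- The product of the imaginary parts of `τ`. -/
def hgt (τ : Hn K) : ℝ := ∏ v : InfinitePlace K, (τ v).im

theorem hgt_pos (τ : Hn K) : 0 < hgt τ := Finset.prod_pos fun v _ => (τ v).im_pos

/-- The norm of `c τ + d`, squared. -/
def den (τ : Hn K) (c d : 𝓞 K) : ℝ :=
  ∏ v : InfinitePlace K, Complex.normSq (sigma v c * (τ v : ℂ) + sigma v d)

theorem linear_sigma_ne_zero (τ : Hn K) {c d : 𝓞 K} (h : ¬(c = 0 ∧ d = 0)) (v : InfinitePlace K) :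
    (sigma v c * (τ v : ℂ) + sigma v d : ℂ) ≠ 0 := by
  refine UpperHalfPlane.linear_ne_zero (cd := ![sigma v c, sigma v d]) (τ v) fun h0 => h ?_
  have h1 : sigma v c = 0 := congrFun h0 0
  have h2 : sigma v d = 0 := congrFun h0 1
  exact ⟨(map_eq_zero_iff _ (sigma_injective v)).1 h1, (map_eq_zero_iff _ (sigma_injective v)).1 h2⟩

theorem normSq_linear_pos (τ : Hn K) {c d : 𝓞 K} (h : ¬(c = 0 ∧ d = 0)) (v : InfinitePlace K) :
    0 < Complex.normSq (sigma v c * (τ v : ℂ) + sigma v d) :=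
  Complex.normSq_pos.2 (linear_sigma_ne_zero τ h v)

theorem den_pos (τ : Hn K) {c d : 𝓞 K} (h : ¬(c = 0 ∧ d = 0)) : 0 < den τ c d :=
  Finset.prod_pos fun v _ => normSq_linear_pos τ h v

theorem normSq_linear (τ : Hn K) (c d : 𝓞 K) (v : InfinitePlace K) :
    Complex.normSq (sigma v c * (τ v : ℂ) + sigma v d) =
      (sigma v c * (τ v).re + sigma v d) ^ 2 + (sigma v c * (τ v).im) ^ 2 := by
  rw [Complex.normSq_apply]
  simp
  ring

theorem prod_sigma_sq_unit (ε : (𝓞 K)ˣ) : ∏ v : InfinitePlace K, sigma v (ε : 𝓞 K) ^ 2 = 1 := by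
  rw [Finset.prod_pow, ← sq_abs, Finset.abs_prod, prod_abs_sigma_unit ε.isUnit, one_pow]

theorem den_unit_mul (τ : Hn K) (ε : (𝓞 K)ˣ) (c d : 𝓞 K) :
    den τ (ε * c) (ε * d) = den τ c d := by
  unfold den
  rw [← one_mul (∏ v : InfinitePlace K, Complex.normSq (sigma v c * (τ v : ℂ) + sigma v d)),
    ← prod_sigma_sq_unit ε, ← Finset.prod_mul_distrib]
  refine Finset.prod_congr rfl fun v _ => ?_
  rw [normSq_linear, normSq_linear, map_mul, map_mul]
  ring

theorem den_zero_unit (τ : Hn K) {d : 𝓞 K} (hd : IsUnit d) : den τ 0 d = 1 := by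
  obtain ⟨ε, rfl⟩ := hd
  unfold den
  rw [← prod_sigma_sq_unit ε]
  refine Finset.prod_congr rfl fun v _ => ?_
  rw [normSq_linear]
  simp

/-- Dropping the real parts leaves the factors `(σ_v(c) Im τ_v)²`, and a nonzero integer has norm at
least 1. This inequality is what separates high horoballs from their translates. -/
theorem sq_hgt_le_den (τ : Hn K) {c : 𝓞 K} (hc : c ≠ 0) (d : 𝓞 K) : hgt τ ^ 2 ≤ den τ c d := by
  have h1 : (1 : ℝ) ≤ (∏ v : InfinitePlace K, |sigma v c|) ^ 2 :=
    one_le_pow₀ (one_le_prod_abs_sigma hc)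
  calc hgt τ ^ 2 ≤ (∏ v : InfinitePlace K, |sigma v c|) ^ 2 * hgt τ ^ 2 :=
        le_mul_of_one_le_left (sq_nonneg _) h1
    _ = ∏ v : InfinitePlace K, (sigma v c * (τ v).im) ^ 2 := by
        unfold hgt
        rw [← mul_pow, ← Finset.prod_mul_distrib, ← Finset.prod_pow]
        refine Finset.prod_congr rfl fun v _ => ?_
        rw [mul_pow, mul_pow, sq_abs]
    _ ≤ den τ c d := Finset.prod_le_prod (fun _ _ => sq_nonneg _) fun v _ => by
        rw [normSq_linear]
        exact le_add_of_nonneg_left (sq_nonneg _)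

variable (K) in
/-- The projection to the extended Hilbert modular group. -/
def toExt : totPosGL K →* ExtHilbertGroup K := QuotientGroup.mk' (scalars K)

variable (K) in
theorem toExt_surjective : Function.Surjective (toExt K) := QuotientGroup.mk'_surjective _

theorem toExt_smul_apply (g : totPosGL K) (τ : Hn K) (v : InfinitePlace K) :
    (toExt K g • τ) v = GeneralLinearGroup.map (sigma v) g.1 • τ v := rfl

theorem map_sigma_det (g : totPosGL K) (v : InfinitePlace K) :
    (GeneralLinearGroup.map (sigma v) g.1).det.val = sigma v g.1.val.det :=
  ((sigma v).map_det g.1.val).symm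

theorem denom_map_sigma (g : totPosGL K) (v : InfinitePlace K) (z : ℂ) :
    denom (GeneralLinearGroup.map (sigma v) g.1) z =
      sigma v (g.1.val 1 0) * z + sigma v (g.1.val 1 1) := rfl

theorem coe_toExt_smul (g : totPosGL K) (τ : Hn K) (v : InfinitePlace K) :
    ((toExt K g • τ) v : ℂ) = (sigma v (g.1.val 0 0) * (τ v : ℂ) + sigma v (g.1.val 0 1)) /
      (sigma v (g.1.val 1 0) * (τ v : ℂ) + sigma v (g.1.val 1 1)) := by
  rw [toExt_smul_apply, coe_smul_of_det_pos (by rw [map_sigma_det]; exact g.2 v)]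
  rfl

theorem im_toExt_smul (g : totPosGL K) (τ : Hn K) (v : InfinitePlace K) :
    ((toExt K g • τ) v).im = sigma v g.1.val.det * (τ v).im /
      Complex.normSq (sigma v (g.1.val 1 0) * (τ v : ℂ) + sigma v (g.1.val 1 1)) := by
  rw [toExt_smul_apply, im_smul_eq_div_normSq, map_sigma_det, denom_map_sigma,
    abs_of_pos (g.2 v)]

theorem isUnit_det_totPosGL (g : totPosGL K) : IsUnit g.1.val.det :=
  (Matrix.isUnit_iff_isUnit_det _).1 g.1.isUnit

theorem isCoprime_bottom_row (g : totPosGL K) : IsCoprime (g.1.val 1 0) (g.1.val 1 1) := by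
  obtain ⟨u, hu⟩ := isUnit_det_totPosGL g
  rw [Matrix.det_fin_two] at hu
  refine ⟨-(u⁻¹ : (𝓞 K)ˣ) * g.1.val 0 1, (u⁻¹ : (𝓞 K)ˣ) * g.1.val 0 0, ?_⟩
  have : ((u⁻¹ : (𝓞 K)ˣ) : 𝓞 K) * u = 1 := by simp
  rw [← this, hu]
  ring

theorem not_and_eq_zero_of_isCoprime {c d : 𝓞 K} (h : IsCoprime c d) : ¬(c = 0 ∧ d = 0) := by
  rintro ⟨rfl, rfl⟩
  exact not_isCoprime_zero_zero h

theorem prod_sigma_det (g : totPosGL K) : ∏ v : InfinitePlace K, sigma v g.1.val.det = 1 := by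
  rw [← prod_abs_sigma_unit (isUnit_det_totPosGL g)]
  exact Finset.prod_congr rfl fun v _ => (abs_of_pos (g.2 v)).symm

theorem hgt_toExt_smul (g : totPosGL K) (τ : Hn K) :
    hgt (toExt K g • τ) = hgt τ / den τ (g.1.val 1 0) (g.1.val 1 1) := by
  unfold hgt den
  rw [Finset.prod_congr rfl fun v _ => im_toExt_smul g τ v, Finset.prod_div_distrib,
    Finset.prod_mul_distrib, prod_sigma_det, one_mul]

/-- The class of a matrix of determinant one. -/
def ofDetOne (a b c d : 𝓞 K) (h : a * d - b * c = 1) : totPosGL K :=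
  ⟨SpecialLinearGroup.toGL ⟨!![a, b; c, d], by rw [Matrix.det_fin_two_of, h]⟩, fun v => by
    change 0 < sigma v (Matrix.det !![a, b; c, d])
    rw [Matrix.det_fin_two_of, h, map_one]
    exact one_pos⟩

theorem ofDetOne_val (a b c d : 𝓞 K) (h : a * d - b * c = 1) :
    (ofDetOne a b c d h).1.val = !![a, b; c, d] := rfl

theorem muPair_eq_div_den (τ : Hn K) (α β : 𝓞 K) :
    muPair τ α β = (Ideal.absNorm (Ideal.span {α, β}) : ℝ) ^ 2 * hgt τ / den τ (-β) α := by
  unfold muPair hgt den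
  rw [← Complex.normSq_eq_norm_sq, map_prod]
  congr 1
  refine Finset.prod_congr rfl fun v _ => ?_
  rw [map_neg]
  push_cast
  rfl

theorem muPair_of_isCoprime (τ : Hn K) {α β : 𝓞 K} (h : IsCoprime α β) :
    muPair τ α β = hgt τ / den τ (-β) α := by
  have h' : Ideal.span {α, β} = ⊤ := by
    rw [← Set.singleton_union, Ideal.span_union, ← Ideal.isCoprime_iff_sup_eq,
      Ideal.isCoprime_span_singleton_iff]
    exact h
  rw [muPair_eq_div_den, h', Ideal.absNorm_top, Nat.cast_one, one_pow, one_mul]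

theorem hgt_div_den_le_muPair (τ : Hn K) {α β : 𝓞 K} (h : ¬(α = 0 ∧ β = 0)) :
    hgt τ / den τ (-β) α ≤ muPair τ α β := by
  rw [muPair_eq_div_den]
  have h0 : ¬(-β = 0 ∧ α = 0) := fun h' => h ⟨h'.2, neg_eq_zero.1 h'.1⟩
  refine div_le_div_of_nonneg_right ?_ (den_pos τ h0).le
  refine le_mul_of_one_le_left (hgt_pos τ).le (one_le_pow₀ ?_)
  rw [Nat.one_le_cast, Nat.one_le_iff_ne_zero, Ne, Ideal.absNorm_eq_zero_iff]
  intro h1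
  refine h ⟨?_, ?_⟩
  · have : α ∈ Ideal.span {α, β} := Ideal.subset_span (by simp)
    rwa [h1] at this
  · have : β ∈ Ideal.span {α, β} := Ideal.subset_span (by simp)
    rwa [h1] at this

/-- Over a principal ideal domain, every nonzero vector is a multiple of a coprime pair. -/
theorem exists_eq_smul_coprime [IsPrincipalIdealRing (𝓞 K)] {x : Fin 2 → K} (hx : x ≠ 0) :
    ∃ (l : K) (α β : 𝓞 K), l ≠ 0 ∧ IsCoprime α β ∧ x = l • ![(α : K), (β : K)] := by
  obtain ⟨⟨a, b⟩, h, hmk⟩ := exists_isIntegralRep (Projectivization.mk K x hx)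
  rw [Eq.comm, Projectivization.mk_eq_mk_iff'] at hmk
  obtain ⟨l, hl⟩ := hmk
  have hl0 : l ≠ 0 := by
    rintro rfl
    exact hx (by rw [← hl, zero_smul])
  obtain ⟨g, hg⟩ := IsPrincipalIdealRing.principal (Ideal.span {a, b})
  have ha : a ∈ Ideal.span {g} := by
    have : a ∈ Ideal.span {a, b} := Ideal.subset_span (by simp)
    rw [hg] at this
    exact this
  have hb : b ∈ Ideal.span {g} := by
    have : b ∈ Ideal.span {a, b} := Ideal.subset_span (by simp)
    rw [hg] at this
    exact this
  obtain ⟨α, rfl⟩ := Ideal.mem_span_singleton'.1 ha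
  obtain ⟨β, rfl⟩ := Ideal.mem_span_singleton'.1 hb
  have hgm : g ∈ Ideal.span {α * g, β * g} := by
    rw [hg]
    exact Ideal.mem_span_singleton_self g
  obtain ⟨p, q, hpq⟩ := Ideal.mem_span_pair.1 hgm
  have hg0 : g ≠ 0 := by
    rintro rfl
    apply h
    ext i
    fin_cases i <;> simp
  have hcop : IsCoprime α β := ⟨p, q, mul_right_cancel₀ hg0 (by linear_combination hpq)⟩
  refine ⟨l * g, α, β, mul_ne_zero hl0 (by simpa using hg0), hcop, ?_⟩
  rw [← hl]
  ext i
  fin_cases i <;> simp <;> ring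

theorem coe_pair_ne_zero {α β : 𝓞 K} (h : IsCoprime α β) :
    (![(α : K), (β : K)] : Fin 2 → K) ≠ 0 := by
  intro h0
  refine not_and_eq_zero_of_isCoprime h ⟨?_, ?_⟩
  · simpa using congrFun h0 0
  · simpa using congrFun h0 1

/-- With class number one, the values of `μ(τ, ·)` are the heights of the points of the orbit. -/
theorem range_mu [IsPrincipalIdealRing (𝓞 K)] (τ : Hn K) :
    Set.range (mu τ) = Set.range fun γ : ExtHilbertGroup K => hgt (γ • τ) := by
  ext r
  constructor
  · rintro ⟨c, rfl⟩
    induction c using Projectivization.ind with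
    | h x hx =>
      obtain ⟨l, α, β, hl, hcop, rfl⟩ := exists_eq_smul_coprime hx
      obtain ⟨p, q, hpq⟩ := id hcop
      -- Bézout completes the coprime pair to a matrix with bottom row `(-β, α)`, which carries the
      -- cusp `[α : β]` to infinity.
      refine ⟨toExt K (ofDetOne p q (-β) α (by linear_combination hpq)), ?_⟩
      rw [mu_eq τ _ α β ⟨coe_pair_ne_zero hcop, ?_⟩, muPair_of_isCoprime τ hcop]
      · exact hgt_toExt_smul (ofDetOne p q (-β) α (by linear_combination hpq)) τ
      · rw [Eq.comm, Projectivization.mk_eq_mk_iff']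
        exact ⟨l, rfl⟩
  · rintro ⟨γ, rfl⟩
    obtain ⟨g, rfl⟩ := toExt_surjective K γ
    have hcop : IsCoprime (g.1.val 1 1) (-g.1.val 1 0) := (isCoprime_bottom_row g).symm.neg_right
    refine ⟨Projectivization.mk K _ (coe_pair_ne_zero hcop), ?_⟩
    rw [mu_eq τ _ _ _ ⟨coe_pair_ne_zero hcop, rfl⟩, muPair_of_isCoprime τ hcop, neg_neg]
    exact (hgt_toExt_smul _ τ).symm

/-- The norm `den τ c d` is unchanged when `(c, d)` is multiplied by a unit. Since it is bounded
here, a suitable unit bounds every factor `|cτ_v + d|²`, hence all conjugates of `c` and `d`, and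
only finitely many pairs remain. Therefore heights on an orbit attain their maximum. -/
theorem finite_hgt_div_den (τ : Hn K) {δ : ℝ} (hδ : 0 < δ) :
    {r : ℝ | δ ≤ r ∧ ∃ c d : 𝓞 K, ¬(c = 0 ∧ d = 0) ∧ r = hgt τ / den τ c d}.Finite := by
  obtain ⟨C, hC⟩ := exists_unit_bound K (hgt τ / δ)
  have hbound : ∃ B : ℝ, ∀ c d : 𝓞 K,
      (∀ v, Complex.normSq (sigma v c * (τ v : ℂ) + sigma v d) ≤ C) →
      (∀ v, |sigma v c| ≤ B) ∧ ∀ v, |sigma v d| ≤ B := by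
    let b : InfinitePlace K → ℝ := fun v => √C / (τ v).im
    have hb0 : ∀ v, 0 ≤ b v := fun v => div_nonneg (Real.sqrt_nonneg _) (τ v).im_pos.le
    refine ⟨∑ v, (b v + (√C + b v * |(τ v).re|)), fun c d h => ?_⟩
    have h1 : ∀ v, |sigma v c| ≤ b v := by
      intro v
      rw [le_div_iff₀ (τ v).im_pos, ← abs_of_pos (τ v).im_pos, ← abs_mul]
      refine Real.abs_le_sqrt (le_trans ?_ (h v))
      rw [normSq_linear]
      exact le_add_of_nonneg_left (sq_nonneg _)
    have h2 : ∀ v, |sigma v d| ≤ √C + b v * |(τ v).re| := by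
      intro v
      have h3 : |sigma v c * (τ v).re + sigma v d| ≤ √C := by
        refine Real.abs_le_sqrt (le_trans ?_ (h v))
        rw [normSq_linear]
        exact le_add_of_nonneg_right (sq_nonneg _)
      have h4 : |sigma v c * (τ v).re| ≤ b v * |(τ v).re| := by
        rw [abs_mul]
        exact mul_le_mul_of_nonneg_right (h1 v) (abs_nonneg _)
      calc |sigma v d| = |(sigma v c * (τ v).re + sigma v d) - sigma v c * (τ v).re| := by
            congr 1; ring
        _ ≤ _ := (abs_sub _ _).trans (add_le_add h3 h4)
    have hnn : ∀ v, 0 ≤ √C + b v * |(τ v).re| := fun v =>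
      add_nonneg (Real.sqrt_nonneg _) (mul_nonneg (hb0 v) (abs_nonneg _))
    have hle : ∀ v, b v + (√C + b v * |(τ v).re|) ≤ ∑ v, (b v + (√C + b v * |(τ v).re|)) :=
      fun v => Finset.single_le_sum (f := fun v => b v + (√C + b v * |(τ v).re|))
        (fun v _ => add_nonneg (hb0 v) (hnn v)) (Finset.mem_univ v)
    exact ⟨fun v => (h1 v).trans ((le_add_of_nonneg_right (hnn v)).trans (hle v)),
      fun v => (h2 v).trans ((le_add_of_nonneg_left (hb0 v)).trans (hle v))⟩
  obtain ⟨B, hB⟩ := hbound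
  refine ((finite_setOf_abs_sigma_le (K := K) B).prod (finite_setOf_abs_sigma_le (K := K) B)
    |>.image fun p => hgt τ / den τ p.1 p.2).subset ?_
  rintro r ⟨hr, c, d, hcd, rfl⟩
  have hden := den_pos τ hcd
  obtain ⟨ε, hε⟩ := hC (fun v => Complex.normSq (sigma v c * (τ v : ℂ) + sigma v d))
    (normSq_linear_pos τ hcd) (by
      change den τ c d ≤ _
      rw [le_div_iff₀ hden] at hr
      rw [le_div_iff₀ hδ]
      linarith)
  obtain ⟨h1, h2⟩ := hB (ε * c) (ε * d) (fun v => by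
    refine le_of_eq_of_le ?_ (hε v)
    rw [normSq_linear, normSq_linear, map_mul, map_mul]
    ring)
  exact ⟨(ε * c, ε * d), ⟨h1, h2⟩, congrArg (hgt τ / ·) (den_unit_mul τ ε c d)⟩

theorem exists_isGreatest_hgt (τ : Hn K) :
    ∃ γ : ExtHilbertGroup K,
      IsGreatest (Set.range fun γ : ExtHilbertGroup K => hgt (γ • τ)) (hgt (γ • τ)) := by
  have hfin : (Set.range (fun γ : ExtHilbertGroup K => hgt (γ • τ)) ∩ Set.Ici (hgt τ)).Finite := by
    refine (finite_hgt_div_den τ (hgt_pos τ)).subset ?_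
    rintro _ ⟨⟨γ, rfl⟩, h⟩
    obtain ⟨g, rfl⟩ := toExt_surjective K γ
    exact ⟨h, _, _, not_and_eq_zero_of_isCoprime (isCoprime_bottom_row g), hgt_toExt_smul g τ⟩
  obtain ⟨r, ⟨⟨γ, rfl⟩, h2⟩, hmax⟩ := Set.exists_max_image _ id hfin
    ⟨hgt τ, ⟨1, by simp⟩, Set.mem_Ici.2 le_rfl⟩
  refine ⟨γ, ⟨γ, rfl⟩, ?_⟩
  rintro _ ⟨γ', rfl⟩
  by_cases h : hgt τ ≤ hgt (γ' • τ)
  · exact hmax _ ⟨⟨γ', rfl⟩, h⟩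
  · exact (not_le.1 h).le.trans h2

theorem mu1_isGreatest [IsPrincipalIdealRing (𝓞 K)] (τ : Hn K) :
    IsGreatest (Set.range fun γ : ExtHilbertGroup K => hgt (γ • τ)) (mu1 τ) := by
  obtain ⟨γ, hγ⟩ := exists_isGreatest_hgt τ
  have h : mu1 τ = hgt (γ • τ) := by
    unfold mu1
    rw [range_mu]
    exact hγ.csSup_eq
  rwa [h]

theorem lt_mu1_iff [IsPrincipalIdealRing (𝓞 K)] (τ : Hn K) (s : ℝ) :
    s < mu1 τ ↔ ∃ γ : ExtHilbertGroup K, s < hgt (γ • τ) := by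
  refine ⟨fun h => ?_, fun ⟨γ, h⟩ => h.trans_le ((mu1_isGreatest τ).2 ⟨γ, rfl⟩)⟩
  obtain ⟨γ, hγ⟩ := (mu1_isGreatest τ).1
  exact ⟨γ, h.trans_eq hγ.symm⟩

theorem mu1_pos [IsPrincipalIdealRing (𝓞 K)] (τ : Hn K) : 0 < mu1 τ :=
  (lt_mu1_iff τ 0).2 ⟨1, hgt_pos _⟩

end

/-! ### Reduction to a Siegel set -/

section

variable {K : Type u} [Field K] [NumberField K] [IsTotallyReal K]

/-- The pair need not be coprime: its ideal norm is at least 1 and can only enlarge `muPair`, which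
is the height of some point of the orbit. -/
theorem one_le_den_of_forall_hgt_le [IsPrincipalIdealRing (𝓞 K)] {τ : Hn K}
    (h : ∀ γ : ExtHilbertGroup K, hgt (γ • τ) ≤ hgt τ) {α β : 𝓞 K} (h0 : ¬(α = 0 ∧ β = 0)) :
    1 ≤ den τ (-β) α := by
  have hne : (![(α : K), (β : K)] : Fin 2 → K) ≠ 0 := fun h1 => h0
    ⟨by simpa using congrFun h1 0, by simpa using congrFun h1 1⟩
  have h1 : muPair τ α β ∈ Set.range (mu τ) :=
    ⟨Projectivization.mk K _ hne, mu_eq τ _ α β ⟨hne, rfl⟩⟩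
  rw [range_mu] at h1
  obtain ⟨γ, hγ⟩ := h1
  have h2 := (hgt_div_den_le_muPair τ h0).trans (hγ.symm.le.trans (h γ))
  rw [div_le_iff₀ (den_pos τ fun h' => h0 ⟨h'.2, neg_eq_zero.1 h'.1⟩)] at h2
  exact (le_mul_iff_one_le_right (hgt_pos τ)).1 h2

/-- The upper triangular element acting by `τ ↦ ε² τ - a`. -/
def affineElt (ε : (𝓞 K)ˣ) (a : 𝓞 K) : totPosGL K :=
  ofDetOne ε (-a * (ε⁻¹ : (𝓞 K)ˣ)) 0 (ε⁻¹ : (𝓞 K)ˣ) (by simp)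

theorem coe_affineElt_smul (ε : (𝓞 K)ˣ) (a : 𝓞 K) (τ : Hn K) (v : InfinitePlace K) :
    ((toExt K (affineElt ε a) • τ) v : ℂ) =
      (sigma v (ε : 𝓞 K) : ℂ) ^ 2 * (τ v : ℂ) - (sigma v a : ℂ) := by
  rw [coe_toExt_smul]
  unfold affineElt
  rw [ofDetOne_val]
  have h : (sigma v (ε : 𝓞 K) : ℂ) * (sigma v ((ε⁻¹ : (𝓞 K)ˣ) : 𝓞 K) : ℂ) = 1 := by
    rw [← Complex.ofReal_mul, ← map_mul, Units.mul_inv, map_one, Complex.ofReal_one]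
  have h0 : (sigma v ((ε⁻¹ : (𝓞 K)ˣ) : 𝓞 K) : ℂ) ≠ 0 := right_ne_zero_of_mul_eq_one h
  simp only [of_apply, cons_val', cons_val_zero, cons_val_one, cons_val_fin_one, map_zero,
    Complex.ofReal_zero, zero_mul, zero_add, map_mul, map_neg, Complex.ofReal_mul,
    Complex.ofReal_neg]
  rw [div_eq_iff h0]
  linear_combination (-(sigma v (ε : 𝓞 K) : ℂ) * (τ v : ℂ)) * h

theorem hgt_affineElt_smul (ε : (𝓞 K)ˣ) (a : 𝓞 K) (τ : Hn K) :
    hgt (toExt K (affineElt ε a) • τ) = hgt τ := by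
  rw [hgt_toExt_smul]
  have h : den τ ((affineElt ε a).1.val 1 0) ((affineElt ε a).1.val 1 1) = 1 :=
    den_zero_unit τ (ε⁻¹).isUnit
  rw [h, div_one]

variable (K) in
/-- A Siegel set meets every orbit. -/
theorem exists_smul_mem_siegel [IsPrincipalIdealRing (𝓞 K)] :
    ∃ B δ : ℝ, 0 ≤ B ∧ 0 < δ ∧ ∀ τ : Hn K, ∃ g : totPosGL K, ∀ v,
      |((toExt K g • τ) v).re| ≤ B ∧ δ ≤ ((toExt K g • τ) v).im := by
  obtain ⟨B, hB0, hB⟩ := exists_integer_sub_le K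
  obtain ⟨M, hM1, hM⟩ := exists_unit_balance K
  obtain ⟨N, hN⟩ := exists_multiple_sub_le K
  have hN1 : (1 : ℝ) ≤ N := by
    obtain ⟨k, h1, h2, -⟩ := hN 0
    exact_mod_cast h1.trans h2
  -- Approximation will give one imaginary part at least `1/(2N)`; balancing by units transfers this
  -- to all places at the cost of `M`.
  refine ⟨B, 1 / (2 * N * M), hB0, by positivity, fun τ => ?_⟩
  obtain ⟨γ, hγ⟩ := exists_isGreatest_hgt τ
  obtain ⟨g, rfl⟩ := toExt_surjective K γ
  obtain ⟨ε, hε⟩ := hM (fun v => ((toExt K g • τ) v).im) fun v => im_pos _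
  obtain ⟨a, ha⟩ := hB fun v => sigma v (ε : 𝓞 K) ^ 2 * ((toExt K g • τ) v).re
  refine ⟨affineElt ε a * g, ?_⟩
  have hre : ∀ v, ((toExt K (affineElt ε a * g) • τ) v).re =
      sigma v (ε : 𝓞 K) ^ 2 * ((toExt K g • τ) v).re - sigma v a := by
    intro v
    rw [map_mul, mul_smul, ← coe_re, coe_affineElt_smul, ← Complex.ofReal_pow, Complex.sub_re,
      Complex.re_ofReal_mul, Complex.ofReal_re, coe_re]
  have him : ∀ v, ((toExt K (affineElt ε a * g) • τ) v).im =
      sigma v (ε : 𝓞 K) ^ 2 * ((toExt K g • τ) v).im := by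
    intro v
    rw [map_mul, mul_smul, ← coe_im, coe_affineElt_smul, ← Complex.ofReal_pow, Complex.sub_im,
      Complex.im_ofReal_mul, Complex.ofReal_im, sub_zero, coe_im]
  have hmax : ∀ γ : ExtHilbertGroup K, hgt (γ • (toExt K (affineElt ε a * g) • τ)) ≤
      hgt (toExt K (affineElt ε a * g) • τ) := by
    intro γ
    have h1 : hgt (toExt K (affineElt ε a * g) • τ) = hgt (toExt K g • τ) := by
      rw [map_mul, mul_smul, hgt_affineElt_smul]
    rw [h1, smul_smul]
    exact hγ.2 ⟨_, rfl⟩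
  obtain ⟨k, hk1, hkN, b, hb⟩ := hN fun v => ((toExt K (affineElt ε a * g) • τ) v).re
  have hk0 : (k : 𝓞 K) ≠ 0 := by
    rw [Nat.cast_ne_zero]
    omega
  have hden := one_le_den_of_forall_hgt_le hmax (α := b) (β := (k : 𝓞 K)) fun h => hk0 h.2
  -- If all imaginary parts were below `1/(2N)`, then with `k ≤ N` each factor of the denominator of
  -- `(-k, b)` would be at most `1/4 + 1/4`, contradicting the maximality of the height.
  have hex : ∃ w, 1 / (2 * N) ≤ ((toExt K (affineElt ε a * g) • τ) w).im := by
    by_contra! hcon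
    refine absurd hden (not_le.2 ?_)
    unfold den
    have hlt : ∀ w, Complex.normSq (sigma w (-(k : 𝓞 K)) *
        (((toExt K (affineElt ε a * g) • τ) w : ℍ) : ℂ) + sigma w b) < 1 := by
      intro w
      have h1 := sq_le_sq' (neg_le_of_abs_le (hb w)) (le_of_abs_le (hb w))
      have hy := im_pos ((toExt K (affineElt ε a * g) • τ) w)
      have h2 : (k : ℝ) * ((toExt K (affineElt ε a * g) • τ) w).im < 1 / 2 := by
        have h3 := hcon w
        rw [lt_div_iff₀ (by positivity)] at h3
        have h4 : (k : ℝ) ≤ N := by exact_mod_cast hkN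
        nlinarith
      have h3 : ((k : ℝ) * ((toExt K (affineElt ε a * g) • τ) w).im) ^ 2 ≤ (1 / 2) ^ 2 :=
        pow_le_pow_left₀ (by positivity) h2.le 2
      rw [normSq_linear, map_neg, map_natCast]
      nlinarith
    refine (Finset.prod_lt_prod_of_nonempty (fun w _ => ?_) (fun w _ => hlt w)
      Finset.univ_nonempty).trans_eq Finset.prod_const_one
    exact normSq_linear_pos _ (fun h => hk0 (neg_eq_zero.1 h.1)) w
  obtain ⟨w, hw⟩ := hex
  refine fun v => ⟨?_, ?_⟩
  · rw [hre]
    exact ha v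
  · have h1 := hε w v
    rw [← him, ← him] at h1
    have h2 : 1 / (2 * N * M) = 1 / (2 * N) / M := by
      rw [div_div]
    rw [h2, div_le_iff₀ (by positivity), mul_comm _ M]
    exact hw.trans h1

end

/-! ### Fundamental domains -/

/-- A greedy choice: almost every point has a basic open neighbourhood meeting none of its
nontrivial translates. Enumerate these neighbourhoods and keep from each the part lying outside the
saturations of the earlier ones. An orbit is then represented only in the first neighbourhood that
it meets, and there only once. -/
theorem exists_isFundamentalDomain {G X : Type*} [Group G] [Countable G] [TopologicalSpace X]
    [SecondCountableTopology X] [T2Space X] [MeasurableSpace X] [BorelSpace X] [MulAction G X]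
    [ContinuousConstSMul G X] (μ : Measure X) (hfree : ∀ᵐ x ∂μ, ∀ g : G, g • x = x → g = 1)
    (hfin : ∀ x : X, ∃ U ∈ nhds x, {g : G | ∃ y ∈ U, g • y ∈ U}.Finite) :
    ∃ F : Set X, IsFundamentalDomain G F μ := by
  -- The empty set is added only to make the countable family nonempty, so that `ℕ` enumerates it.
  let S : Set (Set X) := insert ∅
    {U | U ∈ TopologicalSpace.countableBasis X ∧ ∀ g : G, ∀ y ∈ U, g • y ∈ U → g = 1}
  have hS : S.Countable := Set.Countable.insert _
    ((TopologicalSpace.countable_countableBasis X).mono fun U hU => hU.1)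
  obtain ⟨U, hU⟩ := hS.exists_eq_range ⟨∅, Set.mem_insert _ _⟩
  have hUS : ∀ n, U n ∈ S := fun n => hU ▸ Set.mem_range_self n
  have hUo : ∀ n, IsOpen (U n) := by
    intro n
    rcases hUS n with h | h
    · rw [h]
      exact isOpen_empty
    · exact TopologicalSpace.isOpen_of_mem_countableBasis h.1
  have hUf : ∀ n, ∀ g : G, ∀ y ∈ U n, g • y ∈ U n → g = 1 := by
    intro n g y hy hgy
    rcases hUS n with h | h
    · rw [h] at hy
      exact hy.elim
    · exact h.2 g y hy hgy
  let W : ℕ → Set X := fun n => ⋃ g : G, (fun x => g • x) ⁻¹' U n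
  have hWo : ∀ n, IsOpen (W n) := fun n =>
    isOpen_iUnion fun g => (hUo n).preimage (continuous_const_smul g)
  have hWmem : ∀ n x, x ∈ W n ↔ ∃ g : G, g • x ∈ U n := fun n x => by simp [W]
  have hWinv : ∀ n (g : G) x, g • x ∈ W n ↔ x ∈ W n := by
    intro n g x
    rw [hWmem, hWmem]
    constructor
    · rintro ⟨h, hh⟩
      exact ⟨h * g, by rwa [mul_smul]⟩
    · rintro ⟨h, hh⟩
      exact ⟨h * g⁻¹, by rwa [mul_smul, inv_smul_smul]⟩
  let F : Set X := ⋃ n, (U n \ ⋃ j ∈ Set.Iio n, W j)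
  have hFmem : ∀ x, x ∈ F ↔ ∃ n, x ∈ U n ∧ ∀ j < n, x ∉ W j := fun x => by simp [F]
  have hFm : MeasurableSet F := MeasurableSet.iUnion fun n => MeasurableSet.diff (hUo n).measurableSet
    (MeasurableSet.biUnion (Set.to_countable _) fun j _ => (hWo j).measurableSet)
  have hFdisj : ∀ (g : G) x, x ∈ F → g • x ∈ F → g = 1 := by
    intro g x hx hgx
    obtain ⟨n, hn, hn'⟩ := (hFmem x).1 hx
    obtain ⟨m, hm, hm'⟩ := (hFmem _).1 hgx
    rcases lt_trichotomy n m with h | h | h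
    · exact absurd ((hWinv n g x).2 ((hWmem n x).2 ⟨1, by rwa [one_smul]⟩)) (hm' n h)
    · subst h
      exact hUf n g x hn hm
    · exact absurd ((hWmem m x).2 ⟨g, hm⟩) (hn' m h)
  refine ⟨F, hFm.nullMeasurableSet, ?_, fun g h hgh => Disjoint.aedisjoint ?_⟩
  · filter_upwards [hfree] with x hx
    -- Only finitely many elements bring a point of `V` back into `V`. The nontrivial ones among
    -- them move `x`, so shrinking the neighbourhood removes each of them.
    have hex : ∃ n, x ∈ W n := by
      obtain ⟨V, hV, hVfin⟩ := hfin x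
      have hA : ∀ g : G, g ≠ 1 → ∃ A ∈ nhds x, ∀ y ∈ A, g • y ∉ A := by
        intro g hg
        obtain ⟨A, B, hA, hB, hxA, hxB, hAB⟩ := t2_separation fun h : g • x = x => hg (hx g h)
        refine ⟨B ∩ (fun y => g • y) ⁻¹' A, Filter.inter_mem (hB.mem_nhds hxB)
          ((hA.preimage (continuous_const_smul g)).mem_nhds hxA), fun y hy hgy => ?_⟩
        exact Set.disjoint_left.1 hAB hy.2 hgy.1
      choose A hA hA' using hA
      have hmem : V ∩ ⋂ g ∈ {g : G | ∃ y ∈ V, g • y ∈ V}, ⋂ h : g ≠ 1, A g h ∈ nhds x := by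
        refine Filter.inter_mem hV ((Filter.biInter_mem hVfin).2 fun g _ => ?_)
        exact Filter.iInter_mem.2 fun h => hA g h
      obtain ⟨O, hO, hxO, hOs⟩ :=
        (TopologicalSpace.isBasis_countableBasis X).mem_nhds_iff.1 hmem
      have hOS : O ∈ S := by
        refine Set.mem_insert_of_mem _ ⟨hO, fun g y hy hgy => ?_⟩
        by_contra hg
        have h1 := Set.mem_iInter.1 (Set.mem_iInter₂.1 (hOs hy).2 g
          ⟨y, (hOs hy).1, (hOs hgy).1⟩) hg
        have h2 := Set.mem_iInter.1 (Set.mem_iInter₂.1 (hOs hgy).2 g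
          ⟨y, (hOs hy).1, (hOs hgy).1⟩) hg
        exact hA' g hg y h1 h2
      rw [hU] at hOS
      obtain ⟨n, rfl⟩ := hOS
      exact ⟨n, (hWmem n x).2 ⟨1, by rwa [one_smul]⟩⟩
    classical
    obtain ⟨g, hg⟩ := (hWmem _ x).1 (Nat.find_spec hex)
    refine ⟨g, (hFmem _).2 ⟨_, hg, fun j hj => ?_⟩⟩
    rw [hWinv]
    exact Nat.find_min hex hj
  · rw [Set.disjoint_left]
    rintro x ⟨y, hy, rfl⟩ ⟨z, hz, hzy⟩
    have h1 : z = (h⁻¹ * g) • y := by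
      rw [mul_smul, eq_inv_smul_iff]
      exact hzy
    exact hgh (inv_mul_eq_one.1 (hFdisj _ y hy (h1 ▸ hz))).symm

/-! ### Discontinuity of the action and stabilizer of infinity -/

section

variable {K : Type u} [Field K] [NumberField K] [IsTotallyReal K]

instance : Countable (𝓞 K) :=
  (Module.Free.chooseBasis ℤ (𝓞 K)).equivFun.toEquiv.countable_iff.2 inferInstance

instance : Countable (totPosGL K) := by
  have : Countable (Matrix (Fin 2) (Fin 2) (𝓞 K)) :=
    inferInstanceAs (Countable (Fin 2 → Fin 2 → 𝓞 K))
  exact (Units.val_injective.comp Subtype.val_injective :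
    Function.Injective fun g : totPosGL K => g.1.val).countable

instance : Countable (ExtHilbertGroup K) := (toExt_surjective K).countable

instance : ContinuousConstSMul (ExtHilbertGroup K) (Hn K) where
  continuous_const_smul γ := by
    obtain ⟨g, rfl⟩ := toExt_surjective K γ
    refine continuous_pi fun v => ?_
    exact (continuous_const_smul (GeneralLinearGroup.map (sigma v) g.1)).comp (continuous_apply v)

instance : SMulInvariantMeasure (ExtHilbertGroup K) (Hn K) volume where
  measure_preimage_smul γ s hs := by
    obtain ⟨g, rfl⟩ := toExt_surjective K γ
    exact (volume_preserving_pi fun v =>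
      measurePreserving_smul (GeneralLinearGroup.map (sigma v) g.1) volume).measure_preimage
        hs.nullMeasurableSet

instance : NullSingletonClass (volume : Measure ℍ) where
  measure_singleton z := by
    rw [volume_eq_lintegral, Set.image_singleton, Measure.restrict_singleton]
    simp

/-- The elements of the group that preserve heights. -/
def cuspGroup (K : Type u) [Field K] [NumberField K] [IsTotallyReal K] :
    Subgroup (ExtHilbertGroup K) where
  carrier := {γ | ∀ τ : Hn K, hgt (γ • τ) = hgt τ}
  mul_mem' {a b} ha hb τ := by rw [mul_smul, ha, hb]
  one_mem' τ := by rw [one_smul]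
  inv_mem' {a} ha τ := by
    have h := ha (a⁻¹ • τ)
    rw [smul_inv_smul] at h
    exact h.symm

instance : ContinuousConstSMul (cuspGroup K) (Hn K) where
  continuous_const_smul p := continuous_const_smul (p : ExtHilbertGroup K)

/-- If `c ≠ 0`, then `N(Im τ) N(Im gτ) = N(Im τ)² / |N(cτ + d)|² ≤ 1` by `sq_hgt_le_den`. -/
theorem bottom_left_eq_zero_of_one_lt {g : totPosGL K} {τ : Hn K}
    (h : 1 < hgt τ * hgt (toExt K g • τ)) : g.1.val 1 0 = 0 := by
  by_contra hc
  rw [hgt_toExt_smul, mul_div_assoc', ← sq, one_lt_div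
    (den_pos τ (not_and_eq_zero_of_isCoprime (isCoprime_bottom_row g)))] at h
  exact absurd h (not_lt.2 (sq_hgt_le_den τ hc _))

theorem mem_cuspGroup_iff {g : totPosGL K} : toExt K g ∈ cuspGroup K ↔ g.1.val 1 0 = 0 := by
  constructor
  · intro h
    -- Any point of height above 1 would serve: its image has the same height, so the product of the
    -- two exceeds 1.
    let τ : Hn K := fun _ => ⟨2 * Complex.I, by simp⟩
    have hτ : 1 < hgt τ := by
      have h1 : hgt τ = 2 ^ Fintype.card (InfinitePlace K) := by
        unfold hgt
        rw [← Finset.card_univ, ← Finset.prod_const]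
        refine Finset.prod_congr rfl fun v _ => ?_
        change (2 * Complex.I).im = 2
        simp
      rw [h1]
      exact one_lt_pow₀ (by norm_num) Fintype.card_ne_zero
    refine bottom_left_eq_zero_of_one_lt (τ := τ) ?_
    rw [h τ]
    nlinarith
  · intro h τ
    have hcop := isCoprime_bottom_row g
    rw [h, isCoprime_zero_left] at hcop
    rw [hgt_toExt_smul, h, den_zero_unit τ hcop, div_one]

theorem mem_cuspGroup_of_one_lt {γ : ExtHilbertGroup K} {τ : Hn K}
    (h : 1 < hgt τ * hgt (γ • τ)) : γ ∈ cuspGroup K := by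
  obtain ⟨g, rfl⟩ := toExt_surjective K γ
  exact mem_cuspGroup_iff.2 (bottom_left_eq_zero_of_one_lt h)

theorem toExt_eq_one_of_entries {g : totPosGL K} (hc : g.1.val 1 0 = 0)
    (hb : g.1.val 0 1 = 0) (had : g.1.val 0 0 = g.1.val 1 1) : toExt K g = 1 := by
  have hcop := isCoprime_bottom_row g
  rw [hc, isCoprime_zero_left] at hcop
  obtain ⟨ε, hε⟩ := hcop
  refine (QuotientGroup.eq_one_iff g).2 ⟨ε, ?_⟩
  refine Units.ext (Matrix.ext fun i j => ?_)
  change (Matrix.scalar (Fin 2) (ε : 𝓞 K)) i j = g.1.val i j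
  fin_cases i <;> fin_cases j <;> simp [hc, hb, had, hε]

theorem toExt_scalar_mul (ε : (𝓞 K)ˣ) (g : totPosGL K) :
    ∃ g' : totPosGL K, toExt K g' = toExt K g ∧ ∀ i j, g'.1.val i j = ε * g.1.val i j := by
  let e : totPosGL K := ⟨GeneralLinearGroup.scalar (Fin 2) ε, fun v => by
    change 0 < sigma v (Matrix.scalar (Fin 2) (ε : 𝓞 K)).det
    have h : (Matrix.scalar (Fin 2) (ε : 𝓞 K)).det = ε ^ 2 := by simp [Matrix.det_diagonal, sq]
    rw [h, map_pow]
    exact sq_pos_of_ne_zero (sigma_ne_zero v ε.ne_zero)⟩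
  have he : toExt K e = 1 := (QuotientGroup.eq_one_iff e).2 ⟨ε, rfl⟩
  refine ⟨e * g, by rw [map_mul, he, one_mul], fun i j => ?_⟩
  change ((Matrix.scalar (Fin 2) (ε : 𝓞 K)) * g.1.val) i j = _
  simp

/-- The real and imaginary parts of the fixed-point equation at a single place `v` determine `τ_v`,
unless the matrix is scalar. The fixed points thus lie in a slice on which `τ_v` is constant. -/
theorem volume_setOf_smul_eq {γ : ExtHilbertGroup K} (hγ : γ ≠ 1) :
    volume {τ : Hn K | γ • τ = τ} = 0 := by
  obtain ⟨g, rfl⟩ := toExt_surjective K γ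
  let v : InfinitePlace K := Classical.arbitrary _
  have key : ∀ τ : Hn K, toExt K g • τ = τ →
      2 * sigma v (g.1.val 1 0) * (τ v).re = sigma v (g.1.val 0 0) - sigma v (g.1.val 1 1) ∧
      sigma v (g.1.val 1 0) * ((τ v).re ^ 2 + (τ v).im ^ 2) = -sigma v (g.1.val 0 1) := by
    intro τ hτ
    have h := coe_toExt_smul g τ v
    rw [hτ, eq_div_iff (linear_sigma_ne_zero τ
      (not_and_eq_zero_of_isCoprime (isCoprime_bottom_row g)) v)] at h
    have hre := congrArg Complex.re h
    have him := congrArg Complex.im h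
    simp at hre him
    have hy := (τ v).im_ne_zero
    have h1 : 2 * sigma v (g.1.val 1 0) * (τ v).re =
        sigma v (g.1.val 0 0) - sigma v (g.1.val 1 1) := by
      apply mul_right_cancel₀ hy
      linear_combination him
    refine ⟨h1, ?_⟩
    linear_combination (τ v).re * h1 - hre
  by_cases hne : ∃ τ₀ : Hn K, toExt K g • τ₀ = τ₀
  · obtain ⟨τ₀, hτ₀⟩ := hne
    refine measure_mono_null (fun τ hτ => ?_) (Measure.pi_hyperplane (fun _ => volume) v (τ₀ v))
    obtain ⟨h1, h2⟩ := key τ₀ hτ₀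
    obtain ⟨h3, h4⟩ := key τ hτ
    have hc : sigma v (g.1.val 1 0) ≠ 0 := by
      intro hc
      rw [hc] at h1 h2
      refine hγ (toExt_eq_one_of_entries ((map_eq_zero_iff _ (sigma_injective v)).1 hc)
        ((map_eq_zero_iff _ (sigma_injective v)).1 (by linarith)) (sigma_injective v (by linarith)))
    have hre : (τ v).re = (τ₀ v).re := by
      apply mul_left_cancel₀ (mul_ne_zero two_ne_zero hc)
      linarith
    have him : (τ v).im = (τ₀ v).im := by
      have h5 := mul_left_cancel₀ hc (h4.trans h2.symm)
      rw [hre] at h5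
      exact (sq_eq_sq₀ (τ v).im_pos.le (τ₀ v).im_pos.le).1 (by linarith)
    exact UpperHalfPlane.ext_re_im hre him
  · rw [show {τ : Hn K | toExt K g • τ = τ} = ∅ from Set.eq_empty_of_forall_notMem
      fun τ hτ => hne ⟨τ, hτ⟩, measure_empty]

theorem abs_le_of_linear_sq_le {c d x y D a R : ℝ} (ha : 0 < a) (hy : a ≤ y) (hx : |x| ≤ R)
    (h : (c * x + d) ^ 2 + (c * y) ^ 2 ≤ D) : |c| ≤ √D / a ∧ |d| ≤ √D + √D / a * R := by
  have h1 : |c * x + d| ≤ √D := Real.abs_le_sqrt (by nlinarith [sq_nonneg (c * y)])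
  have h2 : |c * y| ≤ √D := Real.abs_le_sqrt (by nlinarith [sq_nonneg (c * x + d)])
  have h3 : |c| ≤ √D / a := by
    rw [le_div_iff₀ ha]
    rw [abs_mul, abs_of_pos (ha.trans_le hy)] at h2
    exact (mul_le_mul_of_nonneg_left hy (abs_nonneg c)).trans h2
  refine ⟨h3, ?_⟩
  have h4 : |c * x| ≤ √D / a * R := by
    rw [abs_mul]
    exact mul_le_mul h3 hx (abs_nonneg _) ((abs_nonneg _).trans h3)
  calc |d| = |(c * x + d) - c * x| := by congr 1; ring
    _ ≤ _ := (abs_sub _ _).trans (add_le_add h1 h4)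

/-- A scalar unit, which changes the determinant by its square, makes the determinant at most `C` at
every place. Then `Im γτ ≥ a` bounds `|cτ + d|²` by `D = Cb/a`, and the bound on `|γτ|` gives `D'`
for the top row. As `Im τ ≥ a` and `|Re τ| ≤ R`, all conjugates of the entries are at most `T`,
which leaves finitely many matrices. -/
theorem finite_setOf_smul_box {a b R : ℝ} (ha : 0 < a) :
    {γ : ExtHilbertGroup K | ∃ τ ∈ {τ : Hn K | ∀ v, a ≤ (τ v).im ∧ (τ v).im ≤ b ∧
      |(τ v).re| ≤ R}, γ • τ ∈ {τ : Hn K | ∀ v, a ≤ (τ v).im ∧ (τ v).im ≤ b ∧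
      |(τ v).re| ≤ R}}.Finite := by
  obtain ⟨C, hC⟩ := exists_unit_bound K 1
  let D : ℝ := C * b / a
  let D' : ℝ := (R ^ 2 + b ^ 2) * D
  let T : ℝ := max (max (√D / a) (√D + √D / a * R)) (max (√D' / a) (√D' + √D' / a * R))
  let S : Set (totPosGL K) := {g | ∀ i j v, |sigma v (g.1.val i j)| ≤ T}
  have hS : S.Finite := by
    refine Set.Finite.of_finite_image (f := fun g : totPosGL K => (g.1.val : Fin 2 → Fin 2 → 𝓞 K))
      ?_ (Units.val_injective.comp Subtype.val_injective).injOn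
    refine (Set.Finite.pi fun _ => Set.Finite.pi fun _ =>
      finite_setOf_abs_sigma_le (K := K) T).subset ?_
    rintro _ ⟨g, hg, rfl⟩ i - j -
    exact hg i j
  refine (hS.image (toExt K)).subset ?_
  rintro γ ⟨τ, hτ, hγτ⟩
  obtain ⟨g₀, rfl⟩ := toExt_surjective K γ
  obtain ⟨ε, hε⟩ := hC (fun v => sigma v g₀.1.val.det) g₀.2 (prod_sigma_det g₀).le
  obtain ⟨g, hg, hgε⟩ := toExt_scalar_mul ε g₀
  rw [← hg] at hγτ
  refine ⟨g, ?_, hg⟩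
  have hdet : ∀ v, sigma v g.1.val.det ≤ C := by
    intro v
    refine le_of_eq_of_le ?_ (hε v)
    rw [Matrix.det_fin_two, Matrix.det_fin_two, hgε, hgε, hgε, hgε, ← map_pow, ← map_mul]
    congr 1
    ring
  have hrow : ¬(g.1.val 1 0 = 0 ∧ g.1.val 1 1 = 0) :=
    not_and_eq_zero_of_isCoprime (isCoprime_bottom_row g)
  have h1 : ∀ v, Complex.normSq (sigma v (g.1.val 1 0) * (τ v : ℂ) + sigma v (g.1.val 1 1)) ≤ D := by
    intro v
    have hn := normSq_linear_pos τ hrow v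
    have him := im_toExt_smul g τ v
    obtain ⟨h1, h2, -⟩ := hτ v
    obtain ⟨h3, -, -⟩ := hγτ v
    rw [him, le_div_iff₀ hn] at h3
    rw [le_div_iff₀ ha, mul_comm]
    refine h3.trans (mul_le_mul (hdet v) h2 (ha.le.trans h1) ((g.2 v).le.trans (hdet v)))
  have h2 : ∀ v, Complex.normSq (sigma v (g.1.val 0 0) * (τ v : ℂ) + sigma v (g.1.val 0 1)) ≤ D' := by
    intro v
    have h := coe_toExt_smul g τ v
    rw [eq_div_iff (linear_sigma_ne_zero τ hrow v)] at h
    rw [← h, map_mul]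
    refine mul_le_mul ?_ (h1 v) (Complex.normSq_nonneg _) (by positivity)
    obtain ⟨h3, h4, h5⟩ := hγτ v
    rw [Complex.normSq_apply, coe_re, coe_im, ← sq, ← sq]
    exact add_le_add (sq_le_sq' (neg_le_of_abs_le h5) (le_of_abs_le h5))
      (pow_le_pow_left₀ (ha.le.trans h3) h4 2)
  intro i j v
  obtain ⟨ha', -, hR⟩ := hτ v
  have e1 := abs_le_of_linear_sq_le ha ha' hR ((normSq_linear τ _ _ v).symm.le.trans (h1 v))
  have e2 := abs_le_of_linear_sq_le ha ha' hR ((normSq_linear τ _ _ v).symm.le.trans (h2 v))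
  fin_cases i <;> fin_cases j
  · exact e2.1.trans ((le_max_left _ _).trans (le_max_right _ _))
  · exact e2.2.trans ((le_max_right _ _).trans (le_max_right _ _))
  · exact e1.1.trans ((le_max_left _ _).trans (le_max_left _ _))
  · exact e1.2.trans ((le_max_right _ _).trans (le_max_left _ _))

theorem exists_nhds_finite_smul (τ : Hn K) :
    ∃ U ∈ nhds τ, {γ : ExtHilbertGroup K | ∃ τ' ∈ U, γ • τ' ∈ U}.Finite := by
  obtain ⟨v₁, h₁⟩ := Finite.exists_min fun v => (τ v).im
  obtain ⟨v₂, h₂⟩ := Finite.exists_max fun v => (τ v).im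
  obtain ⟨v₃, h₃⟩ := Finite.exists_max fun v => |(τ v).re|
  refine ⟨_, ?_, finite_setOf_smul_box (a := (τ v₁).im / 2) (b := (τ v₂).im + 1)
    (R := |(τ v₃).re| + 1) (half_pos (τ v₁).im_pos)⟩
  refine Filter.eventually_all.2 fun v => ?_
  have hv : Filter.Tendsto (fun τ' : Hn K => τ' v) (nhds τ) (nhds (τ v)) :=
    (continuous_apply v).tendsto τ
  have him := (continuous_im.tendsto (τ v)).comp hv
  have hre := ((continuous_abs.comp continuous_re).tendsto (τ v)).comp hv
  refine (him.eventually_const_le ?_).and ((him.eventually_le_const ?_).and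
    (hre.eventually_le_const ?_))
  · exact (half_lt_self (τ v₁).im_pos).trans_le (h₁ v)
  · exact (h₂ v).trans_lt (lt_add_one _)
  · exact (h₃ v).trans_lt (lt_add_one _)

variable (K) in
theorem ae_forall_smul_eq :
    ∀ᵐ τ : Hn K, ∀ γ : ExtHilbertGroup K, γ • τ = τ → γ = 1 := by
  rw [ae_all_iff]
  intro γ
  by_cases hγ : γ = 1
  · exact Filter.Eventually.of_forall fun _ _ => hγ
  · refine measure_mono_null (fun τ hτ => ?_) (volume_setOf_smul_eq hγ)
    by_contra h
    exact hτ fun h' => absurd h' h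

variable (K) in
theorem exists_fundamentalDomain_ext :
    ∃ F : Set (Hn K), IsFundamentalDomain (ExtHilbertGroup K) F volume :=
  exists_isFundamentalDomain volume (ae_forall_smul_eq K) exists_nhds_finite_smul

variable (K) in
theorem exists_fundamentalDomain_cuspGroup :
    ∃ D : Set (Hn K), IsFundamentalDomain (cuspGroup K) D volume := by
  refine exists_isFundamentalDomain volume ?_ fun τ => ?_
  · filter_upwards [ae_forall_smul_eq K] with τ hτ p hp
    exact Subtype.ext (hτ p hp)
  · obtain ⟨U, hU, hfin⟩ := exists_nhds_finite_smul τ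
    refine ⟨U, hU, Set.Finite.of_finite_image (f := Subtype.val) (hfin.subset ?_)
      Subtype.val_injective.injOn⟩
    rintro _ ⟨p, hp, rfl⟩
    exact hp

end

/-! ### Vertical scaling -/

/-- The map `x + i y ↦ x + i l y` of the upper half-plane. -/
def vscaleFun (l : ℝ) (hl : 0 < l) (z : ℍ) : ℍ := ⟨⟨z.re, l * z.im⟩, mul_pos hl z.im_pos⟩

theorem continuous_vscaleFun (l : ℝ) (hl : 0 < l) : Continuous (vscaleFun l hl) :=
  isOpenEmbedding_coe.isInducing.continuous_iff.2
    (Complex.equivRealProdCLM.symm.continuous.comp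
      (continuous_re.prodMk (continuous_const.mul continuous_im)))

/-- Vertical scaling as a homeomorphism. -/
def vscale (l : ℝ) (hl : 0 < l) : ℍ ≃ₜ ℍ where
  toFun := vscaleFun l hl
  invFun := vscaleFun l⁻¹ (inv_pos.2 hl)
  left_inv z := UpperHalfPlane.ext_re_im rfl (inv_mul_cancel_left₀ hl.ne' z.im)
  right_inv z := UpperHalfPlane.ext_re_im rfl (mul_inv_cancel_left₀ hl.ne' z.im)
  continuous_toFun := continuous_vscaleFun l hl
  continuous_invFun := continuous_vscaleFun _ _

theorem vscale_re (l : ℝ) (hl : 0 < l) (z : ℍ) : (vscale l hl z).re = z.re := rfl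

theorem vscale_im (l : ℝ) (hl : 0 < l) (z : ℍ) : (vscale l hl z).im = l * z.im := rfl

/-- The stretch multiplies `dx dy` by `l` and the density `y⁻²` by `l⁻²`, so it divides areas by
`l`. -/
theorem volume_vscale_preimage (l : ℝ) (hl : 0 < l) {s : Set ℍ} (hs : MeasurableSet s) :
    volume (vscale l hl ⁻¹' s) = ENNReal.ofReal l * volume s := by
  let L : ℂ →ₗ[ℝ] ℂ := Matrix.toLin Complex.basisOneI Complex.basisOneI !![1, 0; 0, l]
  let L' : ℂ →L[ℝ] ℂ := L.toContinuousLinearMap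
  have hL : ∀ z : ℂ, L' z = ⟨z.re, l * z.im⟩ := by
    intro z
    have : L' z = L z := rfl
    rw [this, Matrix.toLin_apply]
    apply Complex.ext <;> simp [Fin.sum_univ_two, Matrix.mulVec, dotProduct]
  have hdet : L'.det = l := by
    change LinearMap.det L = l
    rw [LinearMap.det_toLin, Matrix.det_fin_two_of]
    ring
  have himg : ((↑) '' s : Set ℂ) = L' '' ((↑) '' (vscale l hl ⁻¹' s)) := by
    rw [Set.image_image]
    ext z
    constructor
    · rintro ⟨w, hw, rfl⟩
      refine ⟨(vscale l hl).symm w, by simpa using hw, ?_⟩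
      refine (hL _).trans ?_
      exact congrArg UpperHalfPlane.coe ((vscale l hl).apply_symm_apply w)
    · rintro ⟨w, hw, rfl⟩
      exact ⟨vscale l hl w, hw, (hL _).symm⟩
  have hmeas : MeasurableSet ((↑) '' (vscale l hl ⁻¹' s) : Set ℂ) :=
    measurableEmbedding_coe.measurableSet_image.2 ((vscale l hl).measurable hs)
  have hinj : Function.Injective L' := by
    intro z w h
    rw [hL, hL, Complex.mk.injEq] at h
    exact Complex.ext h.1 (mul_left_cancel₀ hl.ne' h.2)
  rw [volume_eq_lintegral s, himg, lintegral_image_eq_lintegral_abs_det_fderiv_mul volume hmeas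
    (fun z _ => L'.hasFDerivWithinAt) hinj.injOn, volume_eq_lintegral,
    ← lintegral_const_mul' _ _ ENNReal.ofReal_ne_top]
  refine setLIntegral_congr_fun hmeas ?_
  rintro _ ⟨z, -, rfl⟩
  simp only [hdet, hL, abs_of_pos hl, ENNReal.ofReal]
  rw [← ENNReal.coe_mul, ← ENNReal.coe_mul, ENNReal.coe_inj]
  ext
  have hz := z.im_ne_zero
  simp only [NNReal.coe_mul, NNReal.coe_pow, NNReal.coe_div, NNReal.coe_one, coe_nnnorm,
    Real.coe_toNNReal l hl.le, norm_mul, Real.norm_of_nonneg hl.le, coe_im]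
  have hz' : ‖z.im‖ ≠ 0 := norm_ne_zero_iff.2 hz
  field_simp

/-- A Siegel strip of the upper half-plane has finite area. -/
theorem volume_strip_lt_top (B : ℝ) {δ : ℝ} (hδ : 0 < δ) :
    volume {z : ℍ | |z.re| ≤ B ∧ δ ≤ z.im} < ⊤ := by
  -- Dyadic layers: `T k` is `T 0` stretched by `2^k`, so its area is `2^(-k)` times that of `T 0`,
  -- and the sum is geometric.
  let T : ℕ → Set ℍ := fun k => {z | |z.re| ≤ B ∧ δ * 2 ^ k ≤ z.im ∧ z.im < δ * 2 ^ (k + 1)}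
  have hTm : ∀ k, MeasurableSet (T k) := fun k =>
    ((continuous_re.abs.measurable measurableSet_Iic).inter
      ((continuous_im.measurable measurableSet_Ici).inter
        (continuous_im.measurable measurableSet_Iio)))
  have hT0 : volume (T 0) < ⊤ := by
    have hc : IsCompact {z : ℍ | |z.re| ≤ B ∧ δ ≤ z.im ∧ z.im ≤ δ * 2} := by
      rw [isOpenEmbedding_coe.isInducing.isCompact_iff]
      have : UpperHalfPlane.coe '' {z : ℍ | |z.re| ≤ B ∧ δ ≤ z.im ∧ z.im ≤ δ * 2} =
          Set.Icc (-B) B ×ℂ Set.Icc δ (δ * 2) := by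
        ext z
        constructor
        · rintro ⟨w, ⟨h1, h2, h3⟩, rfl⟩
          exact ⟨abs_le.1 h1, h2, h3⟩
        · rintro ⟨h1, h2, h3⟩
          exact ⟨⟨z, hδ.trans_le h2⟩, ⟨abs_le.2 h1, h2, h3⟩, rfl⟩
      rw [this]
      exact isCompact_Icc.reProdIm isCompact_Icc
    refine (measure_mono fun z hz => ?_).trans_lt hc.measure_lt_top
    refine ⟨hz.1, ?_, ?_⟩
    · simpa using hz.2.1
    · simpa using hz.2.2.le
  have hTk : ∀ k, volume (T k) = (ENNReal.ofReal (2 ^ k))⁻¹ * volume (T 0) := by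
    intro k
    have hk : (0 : ℝ) < 2 ^ k := by positivity
    have h1 : vscale (2 ^ k) hk ⁻¹' T k = T 0 := by
      ext z
      simp only [T, Set.mem_preimage, Set.mem_ofPred_eq, vscale_re, vscale_im, pow_zero, mul_one,
        one_mul, pow_succ]
      rw [mul_comm (2 ^ k) z.im, mul_le_mul_iff_of_pos_right hk,
        show δ * (2 ^ k * 2) = δ * 2 * 2 ^ k by ring, mul_lt_mul_iff_of_pos_right hk]
    rw [← h1, volume_vscale_preimage _ hk (hTm k), ← mul_assoc, ENNReal.inv_mul_cancel, one_mul]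
    · exact (ENNReal.ofReal_pos.2 hk).ne'
    · exact ENNReal.ofReal_ne_top
  have hsub : {z : ℍ | |z.re| ≤ B ∧ δ ≤ z.im} ⊆ ⋃ k, T k := by
    rintro z ⟨h1, h2⟩
    obtain ⟨k, hk1, hk2⟩ := exists_nat_pow_near (x := z.im / δ) (y := 2)
      ((one_le_div hδ).2 h2) one_lt_two
    refine Set.mem_iUnion.2 ⟨k, h1, ?_, ?_⟩
    · rw [le_div_iff₀ hδ] at hk1
      linarith
    · rw [div_lt_iff₀ hδ] at hk2
      linarith
  refine (measure_mono hsub).trans_lt ((measure_iUnion_le _).trans_lt ?_)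
  rw [tsum_congr hTk, ENNReal.tsum_mul_right]
  refine ENNReal.mul_lt_top ?_ hT0
  have h2 : ∀ k : ℕ, (ENNReal.ofReal (2 ^ k))⁻¹ = 2⁻¹ ^ k := by
    intro k
    rw [ENNReal.ofReal_pow zero_le_two, ENNReal.inv_pow]
    norm_num
  rw [tsum_congr h2, ENNReal.tsum_geometric]
  simp

section

variable {K : Type u} [Field K] [NumberField K] [IsTotallyReal K]

variable (K) in
/-- Vertical scaling on the product of upper half-planes. -/
def vscaleHn (l : ℝ) (hl : 0 < l) : Hn K ≃ₜ Hn K := Homeomorph.piCongrRight fun _ => vscale l hl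

theorem vscaleHn_apply (l : ℝ) (hl : 0 < l) (τ : Hn K) (v : InfinitePlace K) :
    vscaleHn K l hl τ v = vscale l hl (τ v) := rfl

theorem hgt_vscaleHn (l : ℝ) (hl : 0 < l) (τ : Hn K) :
    hgt (vscaleHn K l hl τ) = l ^ Fintype.card (InfinitePlace K) * hgt τ := by
  unfold hgt
  simp_rw [vscaleHn_apply, vscale_im]
  rw [Finset.prod_mul_distrib, Finset.prod_const, Finset.card_univ]

theorem map_vscaleHn (l : ℝ) (hl : 0 < l) :
    (volume : Measure (Hn K)).map (vscaleHn K l hl) =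
      ENNReal.ofReal l ^ Fintype.card (InfinitePlace K) • volume := by
  let c : ENNReal := ENNReal.ofReal l ^ Fintype.card (InfinitePlace K)
  have hc0 : c ≠ 0 := pow_ne_zero _ (ENNReal.ofReal_pos.2 hl).ne'
  have hct : c ≠ ⊤ := ENNReal.pow_ne_top ENNReal.ofReal_ne_top
  have h : c⁻¹ • (volume : Measure (Hn K)).map (vscaleHn K l hl) = volume := by
    refine (Measure.pi_eq fun s hs => ?_).symm
    rw [Measure.smul_apply, smul_eq_mul, Measure.map_apply (vscaleHn K l hl).measurable
      (MeasurableSet.univ_pi hs)]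
    have h1 : vscaleHn K l hl ⁻¹' Set.univ.pi s = Set.univ.pi fun v => vscale l hl ⁻¹' s v := rfl
    rw [h1, volume_pi_pi]
    simp_rw [fun v => volume_vscale_preimage l hl (hs v)]
    rw [Finset.prod_mul_distrib, Finset.prod_const, Finset.card_univ, ← mul_assoc,
      ENNReal.inv_mul_cancel hc0 hct, one_mul]
  rw [← h, smul_smul]
  change _ = (c * c⁻¹) • _
  rw [ENNReal.mul_inv_cancel hc0 hct, one_smul]
  congr 1

/-- An upper triangular matrix acts at each place by an affine map with real coefficients, and such
a map treats real and imaginary parts separately. -/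
theorem vscaleHn_smul_cuspGroup (l : ℝ) (hl : 0 < l) (p : cuspGroup K) (τ : Hn K) :
    vscaleHn K l hl (p • τ) = p • vscaleHn K l hl τ := by
  obtain ⟨γ, hγ⟩ := p
  obtain ⟨g, rfl⟩ := toExt_surjective K γ
  have hc := mem_cuspGroup_iff.1 hγ
  ext v : 1
  change vscale l hl ((toExt K g • τ) v) = (toExt K g • vscaleHn K l hl τ) v
  have hd : sigma v (g.1.val 1 1) ≠ 0 := by
    have h := not_and_eq_zero_of_isCoprime (isCoprime_bottom_row g)
    exact sigma_ne_zero v fun h' => h ⟨hc, h'⟩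
  have key : ∀ τ : Hn K, ((toExt K g • τ) v).re =
        (sigma v (g.1.val 0 0) * (τ v).re + sigma v (g.1.val 0 1)) / sigma v (g.1.val 1 1) ∧
      ((toExt K g • τ) v).im = sigma v (g.1.val 0 0) * (τ v).im / sigma v (g.1.val 1 1) := by
    intro τ
    have h := coe_toExt_smul g τ v
    rw [hc, map_zero, Complex.ofReal_zero, zero_mul, zero_add] at h
    constructor
    · rw [← coe_re, h, Complex.div_ofReal_re]
      simp
    · rw [← coe_im, h, Complex.div_ofReal_im]
      simp
  refine UpperHalfPlane.ext_re_im ?_ ?_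
  · rw [vscale_re, (key _).1, (key _).1]
    rfl
  · rw [vscale_im, (key _).2, (key _).2, vscaleHn_apply, vscale_im]
    ring

/-! ### Volumes of the superlevel sets -/

open scoped Pointwise

variable (K) in
/-- The neighbourhood of infinity where the height exceeds `s`. -/
def horoball (s : ℝ) : Set (Hn K) := {τ | s < hgt τ}

theorem continuous_hgt : Continuous (hgt : Hn K → ℝ) :=
  continuous_finsetProd _ fun v _ => continuous_im.comp (continuous_apply v)

theorem measurableSet_horoball (s : ℝ) : MeasurableSet (horoball K s) :=
  continuous_hgt.measurable measurableSet_Ioi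

theorem setOf_lt_mu1 [IsPrincipalIdealRing (𝓞 K)] (s : ℝ) :
    {τ : Hn K | s < mu1 τ} = ⋃ γ : ExtHilbertGroup K, (fun τ => γ • τ) ⁻¹' horoball K s := by
  ext τ
  rw [Set.mem_ofPred_eq, lt_mu1_iff, Set.mem_iUnion]
  rfl

theorem measurable_mu1 [IsPrincipalIdealRing (𝓞 K)] : Measurable (mu1 : Hn K → ℝ) := by
  refine measurable_of_Ioi fun s => ?_
  change MeasurableSet {τ : Hn K | s < mu1 τ}
  rw [setOf_lt_mu1]
  exact MeasurableSet.iUnion fun γ => measurable_const_smul γ (measurableSet_horoball s)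

/-- The volume of `S` is the sum of those of the pieces `γS ∩ F`, and these pieces cover `F`. -/
theorem volume_le_of_forall_exists_smul_mem {F S : Set (Hn K)}
    (hF : IsFundamentalDomain (ExtHilbertGroup K) F volume)
    (hS : ∀ τ : Hn K, ∃ γ : ExtHilbertGroup K, γ • τ ∈ S) : volume F ≤ volume S := by
  rw [hF.measure_eq_tsum S]
  refine (measure_mono fun τ hτ => ?_).trans (measure_iUnion_le _)
  obtain ⟨γ, hγ⟩ := hS τ
  exact Set.mem_iUnion.2 ⟨γ⁻¹, ⟨γ • τ, hγ, inv_smul_smul γ τ⟩, hτ⟩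

theorem volume_fundamentalDomain_lt_top [IsPrincipalIdealRing (𝓞 K)] {F : Set (Hn K)}
    (hF : IsFundamentalDomain (ExtHilbertGroup K) F volume) : volume F < ⊤ := by
  obtain ⟨B, δ, -, hδ, h⟩ := exists_smul_mem_siegel K
  refine (volume_le_of_forall_exists_smul_mem hF (S := Set.univ.pi fun _ =>
    {z : ℍ | |z.re| ≤ B ∧ δ ≤ z.im}) fun τ => ?_).trans_lt ?_
  · obtain ⟨g, hg⟩ := h τ
    exact ⟨toExt K g, fun v _ => hg v⟩
  · rw [volume_pi_pi]
    exact ENNReal.prod_lt_top fun v _ => volume_strip_lt_top B hδ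

theorem volume_fundamentalDomain_pos {F : Set (Hn K)}
    (hF : IsFundamentalDomain (ExtHilbertGroup K) F volume) : 0 < volume F := by
  refine pos_iff_ne_zero.2 (hF.measure_ne_zero fun h0 => ?_)
  have h1 : (volume : Measure (Hn K)) Set.univ = 0 := by rw [h0]; simp
  rw [← Set.pi_univ Set.univ, volume_pi_pi, Finset.prod_eq_zero_iff] at h1
  obtain ⟨v, -, hv⟩ := h1
  rw [volume_eq_lintegral, Set.image_univ] at hv
  have hopen : 0 < volume (Set.range UpperHalfPlane.coe) :=
    isOpenEmbedding_coe.isOpen_range.measure_pos volume (Set.range_nonempty _)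
  have hpos := (setLIntegral_pos_iff (μ := (volume : Measure ℂ))
    (s := Set.range UpperHalfPlane.coe)
    (f := fun z : ℂ => (((1 / ‖z.im‖₊) ^ 2 : NNReal) : ENNReal)) (by fun_prop)).2 ?_
  · exact hpos.ne' hv
  · rwa [Set.inter_eq_right.2]
    rintro _ ⟨z, rfl⟩
    have := z.im_ne_zero
    simpa using this

/-- The surjective half of the unfolding, valid for every `s`: a point with `μ₁ > s` has a translate
of height above `s`, and an element of `cuspGroup` moves it into `D` without changing its height. -/
theorem volume_inter_lt_mu1_le [IsPrincipalIdealRing (𝓞 K)] {F D : Set (Hn K)}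
    (hF : IsFundamentalDomain (ExtHilbertGroup K) F volume)
    (hD : IsFundamentalDomain (cuspGroup K) D volume) (s : ℝ) :
    volume (F ∩ {τ | s < mu1 τ}) ≤ volume (D ∩ horoball K s) := by
  rw [hF.measure_eq_tsum (D ∩ horoball K s)]
  refine le_trans (measure_mono_ae ?_) (measure_iUnion_le _)
  -- `D` covers only almost everywhere; since the group is countable, one null set can be discarded
  -- for all translates of `τ` together.
  have hcov : ∀ᵐ τ : Hn K, ∀ γ : ExtHilbertGroup K, ∃ p : cuspGroup K, p • γ • τ ∈ D :=
    ae_all_iff.2 fun γ => (measurePreserving_smul γ (volume : Measure (Hn K))).quasiMeasurePreserving.ae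
      hD.ae_covers
  filter_upwards [hcov] with τ hτ hmem
  obtain ⟨γ, hγ⟩ := (lt_mu1_iff τ s).1 hmem.2
  obtain ⟨p, hp⟩ := hτ γ
  refine Set.mem_iUnion.2 ⟨((p : ExtHilbertGroup K) * γ)⁻¹,
    ⟨((p : ExtHilbertGroup K) * γ) • τ, ⟨?_, ?_⟩, inv_smul_smul _ τ⟩, hmem.1⟩
  · rw [mul_smul]
    exact hp
  · change s < _
    rw [mul_smul, p.2]
    exact hγ

/-- The injective half of the unfolding: translates of `D ∩ horoball K s` overlap in null sets. If
they differ by an element of `cuspGroup`, this is the fundamental domain property of `D`; otherwise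
a common point would yield two points of one orbit with heights above 1, and
`mem_cuspGroup_of_one_lt` applies. -/
theorem volume_inter_horoball_le [IsPrincipalIdealRing (𝓞 K)] {F D : Set (Hn K)}
    (hF : IsFundamentalDomain (ExtHilbertGroup K) F volume)
    (hD : IsFundamentalDomain (cuspGroup K) D volume) {s : ℝ} (hs : 1 ≤ s) :
    volume (D ∩ horoball K s) ≤ volume (F ∩ {τ | s < mu1 τ}) := by
  rw [hF.measure_eq_tsum (D ∩ horoball K s), ← measure_iUnion₀]
  · refine measure_mono (Set.iUnion_subset fun γ => ?_)
    rintro _ ⟨⟨τ, ⟨-, hτ⟩, rfl⟩, hF'⟩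
    refine ⟨hF', (lt_mu1_iff _ s).2 ⟨γ⁻¹, ?_⟩⟩
    change s < hgt (γ⁻¹ • γ • τ)
    rw [inv_smul_smul]
    exact hτ
  · intro γ γ' hne
    refine AEDisjoint.mono (s := γ • (D ∩ horoball K s)) (t := γ' • (D ∩ horoball K s)) ?_
      Set.inter_subset_left Set.inter_subset_left
    by_cases hp : γ'⁻¹ * γ ∈ cuspGroup K
    · have hne' : (⟨γ'⁻¹ * γ, hp⟩ : cuspGroup K) ≠ 1 := fun h =>
        hne (inv_mul_eq_one.1 (congrArg Subtype.val h)).symm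
      have h0 := hD.aedisjoint hne'
      have h1 : volume (γ' • ((γ'⁻¹ * γ) • D ∩ D)) = 0 := by
        rw [measure_smul]
        simpa [Function.onFun, AEDisjoint] using h0
      refine measure_mono_null ?_ h1
      rw [Set.smul_set_inter (a := γ') (s := (γ'⁻¹ * γ) • D), smul_smul, mul_inv_cancel_left]
      exact Set.inter_subset_inter (Set.smul_set_mono Set.inter_subset_left)
        (Set.smul_set_mono Set.inter_subset_left)
    · refine (Set.disjoint_left.2 ?_).aedisjoint
      rintro _ ⟨τ, ⟨-, hτ⟩, rfl⟩ ⟨τ', ⟨-, hτ'⟩, h⟩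
      refine hp (mem_cuspGroup_of_one_lt (τ := τ) ?_)
      have h1 : (γ'⁻¹ * γ) • τ = τ' := by
        rw [mul_smul, inv_smul_eq_iff]
        exact h.symm
      rw [h1]
      have h2 : 1 < hgt τ := hs.trans_lt hτ
      have h3 : 1 < hgt τ' := hs.trans_lt hτ'
      nlinarith
  · exact fun γ => ((hD.nullMeasurableSet.inter
      (measurableSet_horoball s).nullMeasurableSet).smul γ).inter hF.nullMeasurableSet

/-- Stretching by `l` with `lⁿ = s` carries `horoball K 1` onto `horoball K s` and divides volumes
by `s`. It pulls `D` back to another fundamental domain of `cuspGroup`, and the volume of an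
invariant set does not depend on the domain chosen. -/
theorem volume_inter_horoball_one {D : Set (Hn K)}
    (hD : IsFundamentalDomain (cuspGroup K) D volume) {s : ℝ} (hs : 0 < s) :
    volume (D ∩ horoball K 1) = ENNReal.ofReal s * volume (D ∩ horoball K s) := by
  let n := Fintype.card (InfinitePlace K)
  have hn : (n : ℝ) ≠ 0 := Nat.cast_ne_zero.2 Fintype.card_ne_zero
  let l : ℝ := s ^ (1 / (n : ℝ))
  have hl : 0 < l := Real.rpow_pos_of_pos hs _
  have hln : l ^ n = s := by
    rw [← Real.rpow_natCast, ← Real.rpow_mul hs.le, one_div_mul_cancel hn, Real.rpow_one]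
  let e := (vscaleHn K l hl).toMeasurableEquiv
  have hmap : ∀ T : Set (Hn K), volume (vscaleHn K l hl ⁻¹' T) = ENNReal.ofReal s * volume T := by
    intro T
    have h := e.map_apply (μ := volume) T
    change (volume : Measure (Hn K)).map (vscaleHn K l hl) T = volume (vscaleHn K l hl ⁻¹' T) at h
    rw [← h, map_vscaleHn, Measure.smul_apply, smul_eq_mul, ← ENNReal.ofReal_pow hl.le]
    change ENNReal.ofReal (l ^ n) * _ = _
    rw [hln]
  have hquasi : Measure.QuasiMeasurePreserving (vscaleHn K l hl) volume volume :=
    ⟨(vscaleHn K l hl).measurable, by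
      rw [map_vscaleHn]
      exact Measure.smul_absolutelyContinuous⟩
  have hD' : IsFundamentalDomain (cuspGroup K) (vscaleHn K l hl ⁻¹' D) volume :=
    hD.preimage_of_equiv hquasi (e := id) Function.bijective_id
      fun p τ => vscaleHn_smul_cuspGroup l hl p τ
  have hpre : vscaleHn K l hl ⁻¹' horoball K s = horoball K 1 := by
    ext τ
    change s < hgt _ ↔ 1 < hgt τ
    rw [hgt_vscaleHn]
    change s < l ^ n * _ ↔ _
    rw [hln, lt_mul_iff_one_lt_right hs]
  have h1 := hD.measure_set_eq hD' (measurableSet_horoball (K := K) 1) fun p => by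
    ext τ
    change 1 < hgt ((p : ExtHilbertGroup K) • τ) ↔ 1 < hgt τ
    rw [p.2]
  rw [Set.inter_comm, h1, ← hpre, ← Set.preimage_inter, hmap, Set.inter_comm]

end

/-! ### Moments of a function with a prescribed tail -/

theorem lintegral_Ioc_rpow {m t : ℝ} (hm : 0 ≤ m) (ht : 0 < t) :
    ∫⁻ s in Set.Ioc 0 m, ENNReal.ofReal (s ^ (t - 1)) = ENNReal.ofReal (m ^ t / t) := by
  have hInt : IntegrableOn (fun s : ℝ => s ^ (t - 1)) (Set.Ioc 0 m) := by
    rw [← intervalIntegrable_iff_integrableOn_Ioc_of_le hm]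
    exact intervalIntegral.intervalIntegrable_rpow' (by linarith)
  rw [← ofReal_integral_eq_lintegral_ofReal hInt, ← intervalIntegral.integral_of_le hm,
    integral_rpow (Or.inl (by linarith)), sub_add_cancel, Real.zero_rpow ht.ne', sub_zero]
  exact (ae_restrict_mem measurableSet_Ioc).mono fun s hs => Real.rpow_nonneg hs.1.le _

theorem lintegral_Ioi_one_rpow {t : ℝ} (ht : t < 1) :
    ∫⁻ s in Set.Ioi (1 : ℝ), ENNReal.ofReal (s ^ (t - 2)) = ENNReal.ofReal (1 / (1 - t)) := by
  rw [← ofReal_integral_eq_lintegral_ofReal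
    (integrableOn_Ioi_rpow_of_lt (by linarith) one_pos), integral_Ioi_rpow_of_lt (by linarith)
      one_pos, Real.one_rpow]
  · congr 1
    rw [show t - 2 + 1 = -(1 - t) by ring, neg_div_neg_eq]
  · exact (ae_restrict_mem measurableSet_Ioi).mono fun s hs =>
      Real.rpow_nonneg (zero_le_one.trans (Set.mem_Ioi.1 hs).le) _

/-- Integrate `t s^(t-1) ν{f > s}` over `s > 0`. The tail is `C/s` beyond 1 and contributes
`tC/(1-t)`; before 1 it is at most `V`, and it equals `V` for `s < m`. The two bounds then use `C ≤
V` and `mV ≤ C`. -/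
theorem moment_bounds {X : Type*} [MeasurableSpace X] (ν : Measure X) [IsFiniteMeasure ν]
    (hν : ν Set.univ ≠ 0) {f : X → ℝ} (hf : Measurable f) {m : ℝ} (hm : 0 < m)
    (hmf : ∀ x, m ≤ f x)
    (htail : ∀ s : ℝ, 1 ≤ s → ENNReal.ofReal s * ν {x | s < f x} = ν {x | 1 < f x})
    (hmass : ENNReal.ofReal m * ν Set.univ ≤ ν {x | 1 < f x}) {t : ℝ} (ht0 : 0 ≤ t) (ht1 : t < 1) :
    Integrable (fun x => f x ^ t) ν ∧
      m ^ t + t / (1 - t) * m ≤ 1 / (ν Set.univ).toReal * ∫ x, f x ^ t ∂ν ∧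
      1 / (ν Set.univ).toReal * ∫ x, f x ^ t ∂ν ≤ 1 / (1 - t) := by
  have hV : 0 < (ν Set.univ).toReal := ENNReal.toReal_pos hν (measure_ne_top _ _)
  -- The layer-cake formula needs `t > 0`; for `t = 0` both inequalities are equalities.
  rcases ht0.eq_or_lt with rfl | ht
  · simp only [Real.rpow_zero, zero_div, zero_mul, add_zero, sub_zero, integral_const, smul_eq_mul,
      mul_one, Measure.real]
    rw [one_div_mul_cancel hV.ne']
    exact ⟨integrable_const _, le_rfl, by norm_num⟩
  let V : ℝ := (ν Set.univ).toReal
  let C : ℝ := (ν {x | 1 < f x}).toReal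
  have hVeq : ν Set.univ = ENNReal.ofReal V := (ENNReal.ofReal_toReal (measure_ne_top _ _)).symm
  have hCeq : ν {x | 1 < f x} = ENNReal.ofReal C :=
    (ENNReal.ofReal_toReal (measure_ne_top _ _)).symm
  have hC0 : 0 ≤ C := ENNReal.toReal_nonneg
  have hCV : C ≤ V := ENNReal.toReal_mono (measure_ne_top _ _) (measure_mono (Set.subset_univ _))
  have hmV : m * V ≤ C := by
    rw [hVeq, hCeq, ← ENNReal.ofReal_mul hm.le] at hmass
    exact (ENNReal.ofReal_le_ofReal_iff hC0).1 hmass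
  have hm1 : m ≤ 1 := by
    by_contra! h
    have : V < m * V := lt_mul_of_one_lt_left hV h
    linarith
  have ht1' : 0 < 1 - t := by linarith
  have hfpos : ∀ x, 0 < f x := fun x => hm.trans_le (hmf x)
  let φ : ℝ → ENNReal := fun s => ν {x | s < f x} * ENNReal.ofReal (s ^ (t - 1))
  have hlayer : ∫⁻ x, ENNReal.ofReal (f x ^ t) ∂ν =
      ENNReal.ofReal t * ((∫⁻ s in Set.Ioc 0 1, φ s) + ∫⁻ s in Set.Ioi 1, φ s) := by
    rw [lintegral_rpow_eq_lintegral_meas_lt_mul ν (Filter.Eventually.of_forall fun x =>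
      (hfpos x).le) hf.aemeasurable ht, ← Set.Ioc_union_Ioi_eq_Ioi zero_le_one,
      lintegral_union measurableSet_Ioi (Set.Ioc_disjoint_Ioi le_rfl)]
  have htop : ∫⁻ s in Set.Ioi 1, φ s = ENNReal.ofReal (C * (1 / (1 - t))) := by
    have h1 : ∫⁻ s in Set.Ioi 1, φ s =
        ∫⁻ s in Set.Ioi (1 : ℝ), ENNReal.ofReal C * ENNReal.ofReal (s ^ (t - 2)) := by
      refine setLIntegral_congr_fun measurableSet_Ioi fun s hs => ?_
      have hs1 : (1 : ℝ) < s := hs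
      have hs0 : 0 < s := zero_lt_one.trans hs1
      simp only [φ]
      rw [← hCeq, ← htail s hs1.le, show t - 1 = t - 2 + 1 by ring, Real.rpow_add hs0,
        Real.rpow_one, ENNReal.ofReal_mul (Real.rpow_nonneg hs0.le _)]
      ring
    rw [h1, lintegral_const_mul' _ _ ENNReal.ofReal_ne_top, lintegral_Ioi_one_rpow ht1,
      ENNReal.ofReal_mul hC0]
  have hlow : ∫⁻ s in Set.Ioc 0 1, φ s ≤ ENNReal.ofReal (V * (1 / t)) := by
    calc ∫⁻ s in Set.Ioc 0 1, φ s
        ≤ ∫⁻ s in Set.Ioc (0 : ℝ) 1, ENNReal.ofReal V * ENNReal.ofReal (s ^ (t - 1)) := by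
          refine lintegral_mono fun s => ?_
          rw [← hVeq]
          exact mul_le_mul_left (measure_mono (Set.subset_univ _)) _
      _ = _ := by
          rw [lintegral_const_mul' _ _ ENNReal.ofReal_ne_top, lintegral_Ioc_rpow zero_le_one ht,
            Real.one_rpow, ENNReal.ofReal_mul hV.le]
  have hlow' : ENNReal.ofReal (V * (m ^ t / t)) ≤ ∫⁻ s in Set.Ioc 0 1, φ s := by
    calc ENNReal.ofReal (V * (m ^ t / t))
        = ∫⁻ s in Set.Ioc (0 : ℝ) m, ENNReal.ofReal V * ENNReal.ofReal (s ^ (t - 1)) := by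
          rw [lintegral_const_mul' _ _ ENNReal.ofReal_ne_top, lintegral_Ioc_rpow hm.le ht,
            ENNReal.ofReal_mul hV.le]
      -- The endpoint is dropped because `f` may take the value `m`: only for `s < m` is `{s < f}`
      -- known to be everything.
      _ = ∫⁻ s in Set.Ioo (0 : ℝ) m, ENNReal.ofReal V * ENNReal.ofReal (s ^ (t - 1)) :=
          setLIntegral_congr Ioo_ae_eq_Ioc.symm
      _ = ∫⁻ s in Set.Ioo (0 : ℝ) m, φ s := by
          refine setLIntegral_congr_fun measurableSet_Ioo fun s hs => ?_
          have : {x | s < f x} = Set.univ := Set.eq_univ_of_forall fun x => hs.2.trans_le (hmf x)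
          simp only [φ]
          rw [this, hVeq]
      _ ≤ _ := lintegral_mono_set (show Set.Ioo (0 : ℝ) m ⊆ Set.Ioc 0 1 from
          fun s hs => ⟨hs.1, hs.2.le.trans hm1⟩)
  have hupper : ∫⁻ x, ENNReal.ofReal (f x ^ t) ∂ν ≤ ENNReal.ofReal (V / (1 - t)) := by
    rw [hlayer, htop]
    refine (mul_le_mul_right (add_le_add_left hlow _) _).trans ?_
    rw [← ENNReal.ofReal_add (by positivity) (by positivity), ← ENNReal.ofReal_mul ht.le]
    refine ENNReal.ofReal_le_ofReal ?_
    rw [le_div_iff₀ ht1']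
    have : t * (V * (1 / t) + C * (1 / (1 - t))) * (1 - t) = V * (1 - t) + C * t := by
      field_simp
    rw [this]
    nlinarith
  have hlower : ENNReal.ofReal (V * (m ^ t + t / (1 - t) * m)) ≤
      ∫⁻ x, ENNReal.ofReal (f x ^ t) ∂ν := by
    rw [hlayer, htop]
    refine le_trans ?_ (mul_le_mul_right (add_le_add_left hlow' _) _)
    have hmt : 0 < m ^ t := Real.rpow_pos_of_pos hm t
    rw [← ENNReal.ofReal_add (by positivity) (by positivity), ← ENNReal.ofReal_mul ht.le]
    refine ENNReal.ofReal_le_ofReal ?_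
    have e1 : t * (V * (m ^ t / t) + C * (1 / (1 - t))) = V * m ^ t + t / (1 - t) * C := by
      field_simp
    rw [e1]
    have h2 : 0 ≤ t / (1 - t) := by positivity
    nlinarith
  have hnn : ∀ x, 0 ≤ f x ^ t := fun x => Real.rpow_nonneg (hfpos x).le t
  have hmeas : AEStronglyMeasurable (fun x => f x ^ t) ν :=
    (hf.pow_const t).aestronglyMeasurable
  have hInt : Integrable (fun x => f x ^ t) ν := by
    refine ⟨hmeas, ?_⟩
    rw [hasFiniteIntegral_iff_ofReal (Filter.Eventually.of_forall hnn)]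
    exact hupper.trans_lt ENNReal.ofReal_lt_top
  refine ⟨hInt, ?_⟩
  rw [← ofReal_integral_eq_lintegral_ofReal hInt (Filter.Eventually.of_forall hnn)] at hupper hlower
  have hI0 : 0 ≤ ∫ x, f x ^ t ∂ν := integral_nonneg hnn
  rw [ENNReal.ofReal_le_ofReal_iff hI0] at hlower
  rw [ENNReal.ofReal_le_ofReal_iff (by positivity)] at hupper
  change _ ≤ 1 / V * _ ∧ 1 / V * _ ≤ _
  rw [one_div_mul_eq_div, le_div_iff₀ hV, div_le_iff₀ hV]
  refine ⟨by linarith, ?_⟩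
  rwa [one_div_mul_eq_div]

/-! ### Finite places -/

section

variable {K : Type u} [Field K] [NumberField K]

theorem norm_algebraMap_int_le_one (v : HeightOneSpectrum (𝓞 K)) (a : 𝓞 K) :
    ‖algebraMap K (v.adicCompletion K) (a : K)‖ ≤ 1 :=
  FinitePlace.norm_le_one K v a

theorem norm_algebraMap_int_lt_one_iff (v : HeightOneSpectrum (𝓞 K)) (a : 𝓞 K) :
    ‖algebraMap K (v.adicCompletion K) (a : K)‖ < 1 ↔ a ∈ v.asIdeal :=
  FinitePlace.norm_lt_one_iff_mem K v a

theorem norm_algebraMap_int_eq_one_iff (v : HeightOneSpectrum (𝓞 K)) (a : 𝓞 K) :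
    ‖algebraMap K (v.adicCompletion K) (a : K)‖ = 1 ↔ a ∉ v.asIdeal :=
  FinitePlace.norm_eq_one_iff_notMem K v a

instance (v : HeightOneSpectrum (𝓞 K)) : IsUltrametricDist (v.adicCompletion K) := by
  refine IsUltrametricDist.isUltrametricDist_of_forall_norm_natCast_le_one fun n => ?_
  have h := norm_algebraMap_int_le_one v (n : 𝓞 K)
  rwa [show algebraMap K (v.adicCompletion K) ((n : 𝓞 K) : K) = (n : v.adicCompletion K) by
    simp only [map_natCast]] at h

theorem finprod_norm_algebraMap {x : K} (hx : x ≠ 0) :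
    ∏ᶠ v : HeightOneSpectrum (𝓞 K), ‖algebraMap K (v.adicCompletion K) x‖ =
      (∏ v : InfinitePlace K, v x ^ v.mult)⁻¹ := by
  have h := prod_abs_eq_one hx
  rw [← finprod_comp_equiv FinitePlace.equivHeightOneSpectrum.symm] at h
  exact eq_inv_of_mul_eq_one_right h

theorem finite_mulSupport_norm_algebraMap {x : K} (hx : x ≠ 0) :
    (Function.mulSupport fun v : HeightOneSpectrum (𝓞 K) =>
      ‖algebraMap K (v.adicCompletion K) x‖).Finite := by
  have h : (Function.mulSupport fun w : FinitePlace K => w x).Finite :=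
    FinitePlace.hasFiniteMulSupport hx
  refine (h.image FinitePlace.equivHeightOneSpectrum).subset fun v hv => ?_
  exact ⟨FinitePlace.equivHeightOneSpectrum.symm v, hv, Equiv.apply_symm_apply _ _⟩

theorem exists_norm_sub_lt (v : HeightOneSpectrum (𝓞 K)) (x : v.adicCompletion K) {r : ℝ}
    (hr : 0 < r) : ∃ y : K, ‖x - algebraMap K (v.adicCompletion K) y‖ < r := by
  obtain ⟨y, hy⟩ := Metric.denseRange_iff.1
    (HeightOneSpectrum.denseRange_algebraMap K v) x r hr
  exact ⟨y, by rwa [dist_eq_norm] at hy⟩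

variable [IsTotallyReal K] [IsPrincipalIdealRing (𝓞 K)]

theorem exists_coprime_div (y : K) : ∃ α β : 𝓞 K, β ≠ 0 ∧ IsCoprime α β ∧ y * β = α := by
  have hx : (![y, 1] : Fin 2 → K) ≠ 0 := fun h => one_ne_zero (congrFun h 1)
  obtain ⟨l, α, β, hl, hcop, h⟩ := exists_eq_smul_coprime hx
  have h0 : y = l * α := congrFun h 0
  have h1 : 1 = l * β := congrFun h 1
  refine ⟨α, β, ?_, hcop, ?_⟩
  · rintro rfl
    simp at h1
  · rw [h0]
    linear_combination (-(α : K)) * h1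

theorem notMem_of_norm_le_one (v : HeightOneSpectrum (𝓞 K)) {y : K} {α β : 𝓞 K}
    (hcop : IsCoprime α β) (h : y * β = α)
    (hy : ‖algebraMap K (v.adicCompletion K) y‖ ≤ 1) : β ∉ v.asIdeal := by
  intro hβ
  have hα : α ∈ v.asIdeal := by
    rw [← norm_algebraMap_int_lt_one_iff] at hβ ⊢
    rw [← h, map_mul, norm_mul]
    exact (mul_le_of_le_one_left (norm_nonneg _) hy).trans_lt hβ
  obtain ⟨p, q, hpq⟩ := hcop
  refine v.isPrime.ne_top ((Ideal.eq_top_iff_one _).2 ?_)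
  rw [← hpq]
  exact Ideal.add_mem _ (Ideal.mul_mem_left _ _ hα) (Ideal.mul_mem_left _ _ hβ)

/-- The ring of integers maps onto the residue field of every completion. -/
theorem exists_int_norm_sub_lt_one (v : HeightOneSpectrum (𝓞 K)) {x : v.adicCompletion K}
    (hx : ‖x‖ ≤ 1) : ∃ a : 𝓞 K, ‖x - algebraMap K (v.adicCompletion K) (a : K)‖ < 1 := by
  obtain ⟨y, hy⟩ := exists_norm_sub_lt v x one_pos
  have hy1 : ‖algebraMap K (v.adicCompletion K) y‖ ≤ 1 := by
    rw [← norm_neg, neg_sub] at hy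
    rw [← sub_add_cancel (algebraMap K (v.adicCompletion K) y) x]
    exact (IsUltrametricDist.norm_add_le_max _ _).trans (max_le hy.le hx)
  obtain ⟨α, β, hβ0, hcop, h⟩ := exists_coprime_div y
  have hβ := notMem_of_norm_le_one v hcop h hy1
  have hmax : v.asIdeal.IsMaximal := v.isMaximal
  -- The denominator `β` of `y` is prime to `v`; with `b` an inverse of `β` modulo `v`, the integer
  -- `bα` is congruent to `y = α/β`.
  obtain ⟨b, hb⟩ := Ideal.IsMaximal.exists_inv hmax hβ
  obtain ⟨i, hi, hbi⟩ := hb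
  refine ⟨b * α, ?_⟩
  have h2 : ‖algebraMap K (v.adicCompletion K) (y - ((b * α : 𝓞 K) : K))‖ < 1 := by
    have e : y - ((b * α : 𝓞 K) : K) = y * (i : K) := by
      have e1 : (b : K) * β + i = 1 := by exact_mod_cast congrArg (fun z : 𝓞 K => (z : K)) hbi
      have e2 : ((b * α : 𝓞 K) : K) = b * α := rfl
      rw [e2]
      linear_combination (-y) * e1 + (b : K) * h
    rw [e, map_mul, norm_mul]
    exact (mul_le_of_le_one_left (norm_nonneg _) hy1).trans_lt
      ((norm_algebraMap_int_lt_one_iff v i).2 hi)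
  rw [map_sub] at h2
  have e2 : x - algebraMap K (v.adicCompletion K) ((b * α : 𝓞 K) : K) =
      (x - algebraMap K (v.adicCompletion K) y) + (algebraMap K (v.adicCompletion K) y -
        algebraMap K (v.adicCompletion K) ((b * α : 𝓞 K) : K)) := by ring
  rw [e2]
  exact (IsUltrametricDist.norm_add_le_max _ _).trans_lt (max_lt hy h2)

/-- By the ultrametric inequality `x` has the norm of a nearby `y ∈ K`. In lowest terms the
denominator of `y` is a unit at `v`, and the numerator is a multiple of `π`. -/
theorem norm_le_norm_uniformizer (v : HeightOneSpectrum (𝓞 K)) {π : 𝓞 K}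
    (hπ : v.asIdeal = Ideal.span {π}) {x : v.adicCompletion K} (hx : ‖x‖ < 1) :
    ‖x‖ ≤ ‖algebraMap K (v.adicCompletion K) (π : K)‖ := by
  by_cases hx0 : x = 0
  · rw [hx0, norm_zero]
    exact norm_nonneg _
  obtain ⟨y, hy⟩ := exists_norm_sub_lt v x (norm_pos_iff.2 hx0)
  have hxy : ‖x‖ = ‖algebraMap K (v.adicCompletion K) y‖ := by
    rw [← norm_neg (x - _), neg_sub] at hy
    have h := IsUltrametricDist.norm_add_eq_max_of_norm_ne_norm hy.ne
    rw [sub_add_cancel, max_eq_right hy.le] at h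
    exact h.symm
  obtain ⟨α, β, hβ0, hcop, h⟩ := exists_coprime_div y
  have hβ := notMem_of_norm_le_one v hcop h (hxy ▸ hx.le)
  rw [← norm_algebraMap_int_eq_one_iff] at hβ
  have hyα : ‖algebraMap K (v.adicCompletion K) y‖ =
      ‖algebraMap K (v.adicCompletion K) (α : K)‖ := by
    rw [← h, map_mul, norm_mul, hβ, mul_one]
  have hα : α ∈ v.asIdeal := by
    rw [← norm_algebraMap_int_lt_one_iff, ← hyα, ← hxy]
    exact hx
  rw [hπ] at hα
  obtain ⟨a, rfl⟩ := Ideal.mem_span_singleton'.1 hα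
  have e : ((a * π : 𝓞 K) : K) = a * π := rfl
  rw [hxy, hyα, e, map_mul, norm_mul]
  exact mul_le_of_le_one_left (norm_nonneg _) (norm_algebraMap_int_le_one v a)

theorem exists_uniformizer (v : HeightOneSpectrum (𝓞 K)) :
    ∃ π : 𝓞 K, π ≠ 0 ∧ v.asIdeal = Ideal.span {π} ∧
      (∀ w : HeightOneSpectrum (𝓞 K), w ≠ v →
        ‖algebraMap K (w.adicCompletion K) (π : K)‖ = 1) ∧
      2 ≤ ∏ w : InfinitePlace K, w (π : K) ^ w.mult := by
  obtain ⟨π, hπ⟩ := IsPrincipalIdealRing.principal v.asIdeal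
  have hπ' : v.asIdeal = Ideal.span {π} := hπ
  have hπ0 : π ≠ 0 := by
    rintro rfl
    exact v.ne_bot (by rw [hπ', Ideal.span_singleton_eq_bot])
  refine ⟨π, hπ0, hπ', fun w hw => ?_, ?_⟩
  · rw [norm_algebraMap_int_eq_one_iff]
    intro h
    refine hw (HeightOneSpectrum.ext ?_)
    refine (v.isMaximal.eq_of_le w.isPrime.ne_top ?_).symm
    rw [hπ', Ideal.span_singleton_le_iff_mem]
    exact h
  · have h1 := HeightOneSpectrum.one_lt_absNorm v
    have h2 : ∏ w : InfinitePlace K, w (π : K) ^ w.mult = Ideal.absNorm v.asIdeal := by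
      rw [InfinitePlace.prod_eq_abs_norm, hπ', Ideal.absNorm_span_singleton,
        ← Algebra.coe_norm_int]
      simp [Nat.cast_natAbs]
    rw [h2]
    exact_mod_cast h1

/-! ### Trivialization of a rigid adelic space at the finite places -/

/-- The matrix of the norm at `v` in the basis given by the columns of `g`. -/
def localMat (E : RigidAdelicSpace K) (g : Matrix (Fin 2) (Fin 2) K)
    (v : HeightOneSpectrum (𝓞 K)) : Matrix (Fin 2) (Fin 2) (v.adicCompletion K) :=
  (E.Afin v).val * g.map (algebraMap K (v.adicCompletion K))

/-- The columns of `g` are integral for the norms at all finite places. -/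
def IsIntegralBasis (E : RigidAdelicSpace K) (g : Matrix (Fin 2) (Fin 2) K) : Prop :=
  g.det ≠ 0 ∧ ∀ v i j, ‖localMat E g v i j‖ ≤ 1

theorem det_localMat (E : RigidAdelicSpace K) (g : Matrix (Fin 2) (Fin 2) K)
    (v : HeightOneSpectrum (𝓞 K)) : (localMat E g v).det =
      (E.Afin v).val.det * algebraMap K (v.adicCompletion K) g.det := by
  unfold localMat
  rw [Matrix.det_mul]
  congr 1
  exact ((algebraMap K (v.adicCompletion K)).map_det g).symm

theorem norm_det_le_one {v : HeightOneSpectrum (𝓞 K)}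
    {M : Matrix (Fin 2) (Fin 2) (v.adicCompletion K)} (hM : ∀ i j, ‖M i j‖ ≤ 1) :
    ‖M.det‖ ≤ 1 := by
  rw [Matrix.det_fin_two, sub_eq_add_neg]
  refine (IsUltrametricDist.norm_add_le_max _ _).trans (max_le ?_ ?_)
  · rw [norm_mul]
    exact mul_le_one₀ (hM _ _) (norm_nonneg _) (hM _ _)
  · rw [norm_neg, norm_mul]
    exact mul_le_one₀ (hM _ _) (norm_nonneg _) (hM _ _)

theorem eventually_norm_Afin (E : RigidAdelicSpace K) :
    ∀ᶠ v in Filter.cofinite, (∀ i j, ‖(E.Afin v).val i j‖ ≤ 1) ∧ ‖(E.Afin v).val.det‖ = 1 := by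
  filter_upwards [E.almost_all_integral] with v hv
  obtain ⟨u, hu⟩ := hv
  have key : ∀ u : GL (Fin 2) (v.adicCompletionIntegers K), ∀ i j,
      ‖(GeneralLinearGroup.map (n := Fin 2) (v.adicCompletionIntegers K).subtype u).val i j‖ ≤ 1 := by
    intro u i j
    exact Valued.toNormedField.norm_le_one_iff.2 (u.val i j).2
  rw [← hu]
  refine ⟨key u, le_antisymm (norm_det_le_one (key u)) ?_⟩
  have h1 := norm_det_le_one (key u⁻¹)
  have h2 : (GeneralLinearGroup.map (n := Fin 2) (v.adicCompletionIntegers K).subtype u).val.det *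
      (GeneralLinearGroup.map (n := Fin 2) (v.adicCompletionIntegers K).subtype u⁻¹).val.det = 1 := by
    rw [← Matrix.det_mul, ← Units.val_mul, ← map_mul, mul_inv_cancel, map_one, Units.val_one,
      Matrix.det_one]
  have h3 := congrArg norm h2
  rw [norm_mul, norm_one] at h3
  rw [← h3]
  exact mul_le_of_le_one_right (norm_nonneg _) h1

/-- Only finitely many `A_v` fail to be integral, and a power of a uniformizer clears the
denominators of each; their product `d` works at all places. -/
theorem exists_isIntegralBasis (E : RigidAdelicSpace K) :
    ∃ g : Matrix (Fin 2) (Fin 2) K, IsIntegralBasis E g := by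
  classical
  have hfin : {v : HeightOneSpectrum (𝓞 K) | ¬ ∀ i j, ‖(E.Afin v).val i j‖ ≤ 1}.Finite := by
    refine Set.Finite.subset (Filter.eventually_cofinite.1 (eventually_norm_Afin E)) fun v hv h => ?_
    exact hv h.1
  have hloc : ∀ v : HeightOneSpectrum (𝓞 K), ∃ a : 𝓞 K, a ≠ 0 ∧ ∀ i j,
      ‖(E.Afin v).val i j‖ * ‖algebraMap K (v.adicCompletion K) (a : K)‖ ≤ 1 := by
    intro v
    obtain ⟨π, hπ0, hπ, -, -⟩ := exists_uniformizer v
    have hlt : ‖algebraMap K (v.adicCompletion K) (π : K)‖ < 1 := by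
      rw [norm_algebraMap_int_lt_one_iff, hπ]
      exact Ideal.mem_span_singleton_self π
    let T : ℝ := ∑ i, ∑ j, ‖(E.Afin v).val i j‖
    have hT : ∀ i j, ‖(E.Afin v).val i j‖ ≤ T := fun i j =>
      (Finset.single_le_sum (f := fun j => ‖(E.Afin v).val i j‖) (fun _ _ => norm_nonneg _)
        (Finset.mem_univ j)).trans (Finset.single_le_sum
          (f := fun i => ∑ j, ‖(E.Afin v).val i j‖)
          (fun _ _ => Finset.sum_nonneg fun _ _ => norm_nonneg _) (Finset.mem_univ i))
    have hT0 : 0 ≤ T := (norm_nonneg _).trans (hT 0 0)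
    obtain ⟨k, hk⟩ := exists_pow_lt_of_lt_one (show 0 < 1 / (T + 1) by positivity) hlt
    refine ⟨π ^ k, pow_ne_zero k hπ0, fun i j => ?_⟩
    have e : ((π ^ k : 𝓞 K) : K) = (π : K) ^ k := rfl
    rw [e, map_pow, norm_pow]
    calc _ ≤ T * (1 / (T + 1)) := mul_le_mul (hT i j) hk.le (by positivity) hT0
      _ ≤ 1 := by
        rw [mul_one_div, div_le_one (by positivity)]
        linarith
  choose a ha0 ha using hloc
  let d : 𝓞 K := ∏ v ∈ hfin.toFinset, a v
  have hd0 : d ≠ 0 := Finset.prod_ne_zero_iff.2 fun v _ => ha0 v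
  have hd0' : (d : K) ≠ 0 := by simpa using hd0
  refine ⟨!![(d : K), 0; 0, (d : K)], ?_, fun v i j => ?_⟩
  · rw [Matrix.det_fin_two_of, mul_zero, sub_zero]
    exact mul_ne_zero hd0' hd0'
  · have e : localMat E !![(d : K), 0; 0, (d : K)] v i j =
        (E.Afin v).val i j * algebraMap K (v.adicCompletion K) (d : K) := by
      unfold localMat
      fin_cases i <;> fin_cases j <;> simp [Matrix.mul_apply, Fin.sum_univ_two]
    rw [e, norm_mul]
    by_cases hv : v ∈ hfin.toFinset
    · refine (mul_le_mul_of_nonneg_left ?_ (norm_nonneg _)).trans (ha v i j)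
      have e2 : (d : K) = (a v : K) * ((∏ w ∈ hfin.toFinset.erase v, a w : 𝓞 K) : K) := by
        rw [← map_mul, Finset.mul_prod_erase _ _ hv]
      rw [e2, map_mul, norm_mul]
      exact mul_le_of_le_one_right (norm_nonneg _) (norm_algebraMap_int_le_one v _)
    · have hv' : ∀ i j, ‖(E.Afin v).val i j‖ ≤ 1 := by
        by_contra h
        exact hv (hfin.mem_toFinset.2 h)
      exact mul_le_one₀ (hv' i j) (norm_nonneg _) (norm_algebraMap_int_le_one v d)

/-- Modulo `v` the matrix is singular, so its columns are dependent over the residue field, whose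
elements lift to `𝓞_K`. Either the second column is a multiple of the first or the first vanishes.
-/
theorem exists_residual_relation {v : HeightOneSpectrum (𝓞 K)}
    {M : Matrix (Fin 2) (Fin 2) (v.adicCompletion K)} (hM : ∀ i j, ‖M i j‖ ≤ 1)
    (hdet : ‖M.det‖ < 1) :
    (∃ a : 𝓞 K, ∀ i, ‖M i 0 * algebraMap K (v.adicCompletion K) (a : K) + M i 1‖ < 1) ∨
      ∀ i, ‖M i 0‖ < 1 := by
  have main : ∀ p q r s : v.adicCompletion K, ‖p‖ = 1 → ‖q‖ ≤ 1 → ‖r‖ ≤ 1 → ‖p * s - q * r‖ < 1 →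
      ∃ a : 𝓞 K, ‖p * algebraMap K (v.adicCompletion K) (a : K) + q‖ < 1 ∧
        ‖r * algebraMap K (v.adicCompletion K) (a : K) + s‖ < 1 := by
    intro p q r s hp hq hr hd
    have hp0 : p ≠ 0 := norm_ne_zero_iff.1 (by rw [hp]; exact one_ne_zero)
    obtain ⟨a, ha⟩ := exists_int_norm_sub_lt_one v (x := -(q / p)) (by
      rw [norm_neg, norm_div, hp, div_one]
      exact hq)
    rw [← norm_neg] at ha
    refine ⟨a, ?_, ?_⟩
    · have e : p * algebraMap K (v.adicCompletion K) (a : K) + q =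
          p * -(-(q / p) - algebraMap K (v.adicCompletion K) (a : K)) := by
        field_simp
        ring
      rw [e, norm_mul, hp, one_mul]
      exact ha
    · have e : r * algebraMap K (v.adicCompletion K) (a : K) + s =
          r * -(-(q / p) - algebraMap K (v.adicCompletion K) (a : K)) + (p * s - q * r) / p := by
        field_simp
        ring
      rw [e]
      refine (IsUltrametricDist.norm_add_le_max _ _).trans_lt (max_lt ?_ ?_)
      · rw [norm_mul]
        exact (mul_le_of_le_one_left (norm_nonneg _) hr).trans_lt ha
      · rwa [norm_div, hp, div_one]
  rw [Matrix.det_fin_two] at hdet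
  by_cases h0 : ‖M 0 0‖ = 1
  · obtain ⟨a, h1, h2⟩ := main _ _ _ _ h0 (hM 0 1) (hM 1 0) hdet
    exact Or.inl ⟨a, Fin.forall_fin_two.2 ⟨h1, h2⟩⟩
  by_cases h1 : ‖M 1 0‖ = 1
  · obtain ⟨a, h2, h3⟩ := main (M 1 0) (M 1 1) (M 0 0) (M 0 1) h1 (hM 1 1) (hM 0 0) (by
      rw [← norm_neg, show -(M 1 0 * M 0 1 - M 1 1 * M 0 0) =
        M 0 0 * M 1 1 - M 0 1 * M 1 0 by ring]
      exact hdet)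
    exact Or.inl ⟨a, Fin.forall_fin_two.2 ⟨h3, h2⟩⟩
  · exact Or.inr (Fin.forall_fin_two.2
      ⟨lt_of_le_of_ne (hM 0 0) h0, lt_of_le_of_ne (hM 1 0) h1⟩)

theorem localMat_mul (E : RigidAdelicSpace K) (g T : Matrix (Fin 2) (Fin 2) K)
    (v : HeightOneSpectrum (𝓞 K)) :
    localMat E (g * T) v = localMat E g v * T.map (algebraMap K (v.adicCompletion K)) := by
  unfold localMat
  rw [Matrix.map_mul, Matrix.mul_assoc]

/-- Dividing the dependent combination of columns by a generator `π` of `v` keeps integrality: the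
combination is divisible by `π` at `v`, and `π` is a unit at the other finite places. The
determinant is divided by `π`, whose norm is at least 2. -/
theorem exists_descent (E : RigidAdelicSpace K) {g : Matrix (Fin 2) (Fin 2) K}
    (hg : IsIntegralBasis E g) {v : HeightOneSpectrum (𝓞 K)} (hv : ‖(localMat E g v).det‖ < 1) :
    ∃ g' : Matrix (Fin 2) (Fin 2) K, IsIntegralBasis E g' ∧
      2 * ∏ w : InfinitePlace K, w g'.det ^ w.mult ≤ ∏ w : InfinitePlace K, w g.det ^ w.mult := by
  obtain ⟨π, hπ0, hπ, hπ1, hπ2⟩ := exists_uniformizer v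
  have hπ0' : (π : K) ≠ 0 := by simpa using hπ0
  have hdiv : ∀ (w : HeightOneSpectrum (𝓞 K)) (x : w.adicCompletion K), ‖x‖ ≤ 1 →
      (w = v → ‖x‖ < 1) → ‖x * (algebraMap K (w.adicCompletion K) (π : K))⁻¹‖ ≤ 1 := by
    intro w x hx hx'
    have hpos : 0 < ‖algebraMap K (w.adicCompletion K) (π : K)‖ :=
      norm_pos_iff.2 ((map_ne_zero _).2 hπ0')
    rw [norm_mul, norm_inv, ← div_eq_mul_inv, div_le_one hpos]
    by_cases hw : w = v
    · subst hw
      exact norm_le_norm_uniformizer w hπ (hx' rfl)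
    · rw [hπ1 w hw]
      exact hx
  have hgain : ∀ T : Matrix (Fin 2) (Fin 2) K, T.det = (π : K)⁻¹ →
      (g * T).det ≠ 0 ∧ 2 * ∏ w : InfinitePlace K, w (g * T).det ^ w.mult ≤
        ∏ w : InfinitePlace K, w g.det ^ w.mult := by
    intro T hT
    refine ⟨?_, ?_⟩
    · rw [Matrix.det_mul, hT]
      exact mul_ne_zero hg.1 (inv_ne_zero hπ0')
    · have e : g.det = π * (g * T).det := by
        rw [Matrix.det_mul, hT]
        field_simp
      have e2 : ∏ w : InfinitePlace K, w g.det ^ w.mult =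
          (∏ w : InfinitePlace K, w (π : K) ^ w.mult) *
            ∏ w : InfinitePlace K, w (g * T).det ^ w.mult := by
        rw [← Finset.prod_mul_distrib, e]
        refine Finset.prod_congr rfl fun w _ => ?_
        rw [map_mul, mul_pow]
      rw [e2]
      exact mul_le_mul_of_nonneg_right hπ2
        (Finset.prod_nonneg fun w _ => pow_nonneg (apply_nonneg _ _) _)
  rcases exists_residual_relation (hg.2 v) hv with ⟨a, ha⟩ | h
  · let T : Matrix (Fin 2) (Fin 2) K := !![1, (a : K) * (π : K)⁻¹; 0, (π : K)⁻¹]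
    obtain ⟨h1, h2⟩ := hgain T (by simp [T, Matrix.det_fin_two_of])
    refine ⟨g * T, ⟨h1, fun w i j => ?_⟩, h2⟩
    rw [localMat_mul, Matrix.mul_apply, Fin.sum_univ_two]
    fin_cases j
    · simpa [T] using hg.2 w i 0
    · have e : localMat E g w i 0 * (T.map (algebraMap K (w.adicCompletion K))) 0 1 +
          localMat E g w i 1 * (T.map (algebraMap K (w.adicCompletion K))) 1 1 =
          (localMat E g w i 0 * algebraMap K (w.adicCompletion K) (a : K) + localMat E g w i 1) *
            (algebraMap K (w.adicCompletion K) (π : K))⁻¹ := by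
        simp only [T, Matrix.map_apply, of_apply, cons_val', cons_val_zero, cons_val_one,
          cons_val_fin_one, map_mul, map_inv₀]
        ring
      refine (congrArg norm e).trans_le (hdiv w _ ?_ ?_)
      · refine (IsUltrametricDist.norm_add_le_max _ _).trans (max_le ?_ (hg.2 w i 1))
        rw [norm_mul]
        exact mul_le_one₀ (hg.2 w i 0) (norm_nonneg _) (norm_algebraMap_int_le_one w a)
      · rintro rfl
        exact ha i
  · let T : Matrix (Fin 2) (Fin 2) K := !![(π : K)⁻¹, 0; 0, 1]
    obtain ⟨h1, h2⟩ := hgain T (by simp [T, Matrix.det_fin_two_of])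
    refine ⟨g * T, ⟨h1, fun w i j => ?_⟩, h2⟩
    rw [localMat_mul, Matrix.mul_apply, Fin.sum_univ_two]
    fin_cases j
    · have e : localMat E g w i 0 * (T.map (algebraMap K (w.adicCompletion K))) 0 0 +
          localMat E g w i 1 * (T.map (algebraMap K (w.adicCompletion K))) 1 0 =
          localMat E g w i 0 * (algebraMap K (w.adicCompletion K) (π : K))⁻¹ := by
        simp [T]
      refine (congrArg norm e).trans_le (hdiv w _ (hg.2 w i 0) ?_)
      rintro rfl
      exact h i
    · simpa [T] using hg.2 w i 1

/-- Integrality gives `‖det A_v · det g‖ ≤ 1` at every finite place; the product formula turns the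
product of these inequalities into a lower bound at infinity. -/
theorem exists_lower_bound_det (E : RigidAdelicSpace K) :
    ∃ c : ℝ, 0 < c ∧ ∀ g : Matrix (Fin 2) (Fin 2) K, IsIntegralBasis E g →
      c ≤ ∏ w : InfinitePlace K, w g.det ^ w.mult := by
  have hsupp : (Function.mulSupport fun v => ‖(E.Afin v).val.det‖).Finite :=
    Set.Finite.subset (Filter.eventually_cofinite.1 (eventually_norm_Afin E)) fun v hv h => hv h.2
  refine ⟨∏ᶠ v, ‖(E.Afin v).val.det‖, ?_, fun g hg => ?_⟩
  · refine finprod_induction (fun x : ℝ => 0 < x) one_pos (fun _ _ => mul_pos) fun v => ?_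
    exact norm_pos_iff.2 (E.Afin v).det_ne_zero
  · have h1 : ∏ᶠ v, ‖(localMat E g v).det‖ ≤ 1 :=
      (finprod_induction (fun x : ℝ => 0 ≤ x ∧ x ≤ 1) ⟨zero_le_one, le_rfl⟩
        (fun _ _ h h' => ⟨mul_nonneg h.1 h'.1, mul_le_one₀ h.2 h'.1 h'.2⟩)
        fun v => ⟨norm_nonneg _, norm_det_le_one (hg.2 v)⟩).2
    simp_rw [det_localMat, norm_mul] at h1
    rw [finprod_mul_distrib hsupp (finite_mulSupport_norm_algebraMap hg.1),
      finprod_norm_algebraMap hg.1, ← div_eq_mul_inv, div_le_one] at h1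
    · exact h1
    · exact Finset.prod_pos fun w _ => pow_pos (InfinitePlace.pos_iff.2 hg.1) _

/-- With class number one, a rigid adelic space has a basis that is orthonormal at all finite
places. -/
theorem exists_unimodular_basis (E : RigidAdelicSpace K) :
    ∃ g : Matrix (Fin 2) (Fin 2) K, IsIntegralBasis E g ∧
      ∀ v, ‖(localMat E g v).det‖ = 1 := by
  by_contra! hcon
  obtain ⟨c, hc, hcg⟩ := exists_lower_bound_det E
  obtain ⟨g₀, hg₀⟩ := exists_isIntegralBasis E
  -- Without a unimodular basis the descent could be repeated forever, halving the determinant at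
  -- each step and finally violating its lower bound `c`.
  have hstep : ∀ k : ℕ, ∃ g, IsIntegralBasis E g ∧
      2 ^ k * ∏ w : InfinitePlace K, w g.det ^ w.mult ≤
        ∏ w : InfinitePlace K, w g₀.det ^ w.mult := by
    intro k
    induction k with
    | zero => exact ⟨g₀, hg₀, by rw [pow_zero, one_mul]⟩
    | succ k ih =>
      obtain ⟨g, hg, hle⟩ := ih
      obtain ⟨v, hv⟩ := hcon g hg
      obtain ⟨g', hg', hle'⟩ := exists_descent E hg
        (lt_of_le_of_ne (norm_det_le_one (hg.2 v)) hv)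
      refine ⟨g', hg', le_trans ?_ hle⟩
      rw [pow_succ, mul_assoc]
      exact mul_le_mul_of_nonneg_left hle' (by positivity)
  obtain ⟨k, hk⟩ := pow_unbounded_of_one_lt
    ((∏ w : InfinitePlace K, w g₀.det ^ w.mult) / c) one_lt_two
  obtain ⟨g, hg, hle⟩ := hstep k
  rw [div_lt_iff₀ hc] at hk
  have : 2 ^ k * c ≤ 2 ^ k * ∏ w : InfinitePlace K, w g.det ^ w.mult :=
    mul_le_mul_of_nonneg_left (hcg g hg) (by positivity)
  linarith

end

/-! ### Infinite places of a rigid adelic space -/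

section

variable {K : Type u} [Field K] [NumberField K] [IsTotallyReal K]

/-- The isomorphism of the completion at an infinite place with the real numbers. -/
def rho (v : InfinitePlace K) : v.Completion ≃+* ℝ :=
  InfinitePlace.Completion.ringEquivRealOfIsReal (IsTotallyReal.isReal v)

/-- The real embedding of an infinite place. -/
def realEmb (v : InfinitePlace K) : K →+* ℝ :=
  InfinitePlace.embedding_of_isReal (IsTotallyReal.isReal v)

theorem realEmb_coe (v : InfinitePlace K) (a : 𝓞 K) : realEmb v (a : K) = sigma v a := rfl

theorem abs_realEmb (v : InfinitePlace K) (x : K) : |realEmb v x| = v x :=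
  InfinitePlace.norm_embedding_of_isReal (IsTotallyReal.isReal v) x

theorem abs_rho (v : InfinitePlace K) (x : v.Completion) : |rho v x| = ‖x‖ :=
  (InfinitePlace.Completion.isometry_extensionEmbeddingOfIsReal
    (IsTotallyReal.isReal v)).norm_map_of_map_zero (map_zero _) x

theorem rho_algebraMap (v : InfinitePlace K) (x : K) :
    rho v (algebraMap K v.Completion x) = realEmb v x :=
  InfinitePlace.Completion.extensionEmbeddingOfIsReal_coe (IsTotallyReal.isReal v)
    ((WithAbs.equiv v.1).symm x)

theorem mult_eq_one (v : InfinitePlace K) : v.mult = 1 :=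
  InfinitePlace.mult_isReal ⟨v, IsTotallyReal.isReal v⟩

theorem normInf_eq (E : RigidAdelicSpace K) (v : InfinitePlace K) (x : E.carrier) :
    E.normInf v x =
      √((rho v ((E.Ainf v).val 0 0) * realEmb v (E.φ x 0) +
          rho v ((E.Ainf v).val 0 1) * realEmb v (E.φ x 1)) ^ 2 +
        (rho v ((E.Ainf v).val 1 0) * realEmb v (E.φ x 0) +
          rho v ((E.Ainf v).val 1 1) * realEmb v (E.φ x 1)) ^ 2) := by
  have h : ∀ i, ‖((E.Ainf v).val *ᵥ fun j => algebraMap K v.Completion (E.φ x j)) i‖ ^ 2 =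
      (rho v ((E.Ainf v).val i 0) * realEmb v (E.φ x 0) +
          rho v ((E.Ainf v).val i 1) * realEmb v (E.φ x 1)) ^ 2 := by
    intro i
    rw [← abs_rho, sq_abs, Matrix.mulVec, dotProduct, Fin.sum_univ_two, map_add, map_mul, map_mul,
      rho_algebraMap, rho_algebraMap]
  unfold RigidAdelicSpace.normInf
  simp only [h]

theorem normInf_nonneg (E : RigidAdelicSpace K) (v : InfinitePlace K) (x : E.carrier) :
    0 ≤ E.normInf v x := Real.sqrt_nonneg _

theorem normFin_nonneg (E : RigidAdelicSpace K) (v : HeightOneSpectrum (𝓞 K)) (x : E.carrier) :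
    0 ≤ E.normFin v x := (norm_nonneg _).trans (le_max_left _ _)

theorem heightVec_eq (E : RigidAdelicSpace K) (x : E.carrier) :
    E.heightVec x = ((∏ v : InfinitePlace K, E.normInf v x) *
      ∏ᶠ v : HeightOneSpectrum (𝓞 K), E.normFin v x) ^ (1 / (Module.finrank ℚ K : ℝ)) := by
  unfold RigidAdelicSpace.heightVec
  simp_rw [mult_eq_one, pow_one]

theorem finprod_normFin_nonneg (E : RigidAdelicSpace K) (x : E.carrier) :
    0 ≤ ∏ᶠ v : HeightOneSpectrum (𝓞 K), E.normFin v x :=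
  finprod_induction (fun r : ℝ => 0 ≤ r) zero_le_one (fun _ _ => mul_nonneg)
    fun v => normFin_nonneg E v x

theorem heightVec_nonneg (E : RigidAdelicSpace K) (x : E.carrier) : 0 ≤ E.heightVec x := by
  rw [heightVec_eq]
  exact Real.rpow_nonneg (mul_nonneg (Finset.prod_nonneg fun v _ => normInf_nonneg E v x)
    (finprod_normFin_nonneg E x)) _

theorem height_pos (E : RigidAdelicSpace K) : 0 < E.height := by
  refine Real.rpow_pos_of_pos (mul_pos (Finset.prod_pos fun v _ => pow_pos
    (norm_pos_iff.2 (E.Ainf v).det_ne_zero) _) ?_) _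
  exact finprod_induction (fun r : ℝ => 0 < r) one_pos (fun _ _ => mul_pos)
    fun v => norm_pos_iff.2 (E.Afin v).det_ne_zero

theorem left_ne_zero_of_span_eq_top (E : RigidAdelicSpace K) {x y : E.carrier}
    (h : Submodule.span K {x, y} = ⊤) : x ≠ 0 := by
  rintro rfl
  rw [Submodule.span_insert_zero] at h
  have h1 : Module.finrank K E.carrier = 2 := by
    rw [E.φ.finrank_eq, Module.finrank_fin_fun]
  have h2 := finrank_span_le_card (R := K) ({y} : Set E.carrier)
  rw [h, finrank_top, h1] at h2
  simp at h2

theorem bddBelow_heights (E : RigidAdelicSpace K) :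
    BddBelow {h | ∃ x : E.carrier, x ≠ 0 ∧ h = E.heightVec x} :=
  ⟨0, by rintro _ ⟨x, -, rfl⟩; exact heightVec_nonneg E x⟩

theorem Lambda1_le (E : RigidAdelicSpace K) {x : E.carrier} (hx : x ≠ 0) :
    E.Lambda1 ≤ E.heightVec x :=
  csInf_le (bddBelow_heights E) ⟨x, hx, rfl⟩

theorem Lambda2_le (E : RigidAdelicSpace K) {x y : E.carrier}
    (h : Submodule.span K {x, y} = ⊤) : E.Lambda2 ≤ max (E.heightVec x) (E.heightVec y) :=
  csInf_le ⟨0, by rintro _ ⟨x, y, -, rfl⟩; exact (heightVec_nonneg E x).trans (le_max_left _ _)⟩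
    ⟨x, y, h, rfl⟩

/-- The first minimum bounds the smaller of the two heights from below and the second the larger;
the product does not see which is which. -/
theorem Lambda1_mul_Lambda2_le (E : RigidAdelicSpace K) {x y : E.carrier}
    (h : Submodule.span K {x, y} = ⊤) :
    E.Lambda1 * E.Lambda2 ≤ E.heightVec x * E.heightVec y := by
  have hx := left_ne_zero_of_span_eq_top E h
  have hy := left_ne_zero_of_span_eq_top E (by rwa [Set.pair_comm] at h)
  rw [← min_mul_max (E.heightVec x) (E.heightVec y)]
  refine mul_le_mul (le_min (Lambda1_le E hx) (Lambda1_le E hy)) (Lambda2_le E h) ?_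
    (le_min (heightVec_nonneg E x) (heightVec_nonneg E y))
  exact Real.sInf_nonneg (by
    rintro _ ⟨x, y, -, rfl⟩
    exact (heightVec_nonneg E x).trans (le_max_left _ _))

theorem span_columns_eq_top (E : RigidAdelicSpace K) {G : Matrix (Fin 2) (Fin 2) K}
    (hG : G.det ≠ 0) : Submodule.span K
      {E.φ.symm (fun i => G i 0), E.φ.symm (fun i => G i 1)} = ⊤ := by
  rw [eq_top_iff]
  intro w _
  rw [Submodule.mem_span_pair]
  let u := G⁻¹ *ᵥ E.φ w
  refine ⟨u 0, u 1, ?_⟩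
  apply E.φ.injective
  rw [map_add, map_smul, map_smul, LinearEquiv.apply_symm_apply, LinearEquiv.apply_symm_apply]
  have h : G *ᵥ u = E.φ w := by
    rw [Matrix.mulVec_mulVec, Matrix.mul_nonsing_inv _ (isUnit_iff_ne_zero.2 hG), Matrix.one_mulVec]
  rw [← h]
  ext i
  simp [Matrix.mulVec, dotProduct, Fin.sum_univ_two]
  ring

/-- A positive definite binary form comes from a point of the upper half-plane. -/
theorem exists_upperHalfPlane_form (p q r s : ℝ) (h : p * s - q * r ≠ 0) :
    ∃ z : ℍ, ∀ a b : ℝ, (p * a + q * b) ^ 2 + (r * a + s * b) ^ 2 =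
      |p * s - q * r| * ((-b * z.re + a) ^ 2 + (-b * z.im) ^ 2) / z.im := by
  have hA : 0 < p ^ 2 + r ^ 2 := by
    by_contra! hle
    have hp : p = 0 := by nlinarith [sq_nonneg p, sq_nonneg r]
    have hr : r = 0 := by nlinarith [sq_nonneg p, sq_nonneg r]
    exact h (by rw [hp, hr]; ring)
  have hD : 0 < |p * s - q * r| := abs_pos.2 h
  refine ⟨⟨⟨-(p * q + r * s) / (p ^ 2 + r ^ 2), |p * s - q * r| / (p ^ 2 + r ^ 2)⟩,
    div_pos hD hA⟩, fun a b => ?_⟩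
  change _ = |p * s - q * r| * ((-b * (-(p * q + r * s) / (p ^ 2 + r ^ 2)) + a) ^ 2 +
    (-b * (|p * s - q * r| / (p ^ 2 + r ^ 2))) ^ 2) / (|p * s - q * r| / (p ^ 2 + r ^ 2))
  have e : (-b * (|p * s - q * r| / (p ^ 2 + r ^ 2))) ^ 2 =
      b ^ 2 * (p * s - q * r) ^ 2 / (p ^ 2 + r ^ 2) ^ 2 := by
    rw [mul_pow, div_pow, sq_abs]
    ring
  rw [e]
  field_simp
  ring

/-- The real matrix of the norm at `v` in the basis given by the columns of `g`. -/
def realMat (E : RigidAdelicSpace K) (g : Matrix (Fin 2) (Fin 2) K) (v : InfinitePlace K) :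
    Matrix (Fin 2) (Fin 2) ℝ :=
  (E.Ainf v).val.map (rho v) * g.map (realEmb v)

theorem abs_det_realMat (E : RigidAdelicSpace K) (g : Matrix (Fin 2) (Fin 2) K)
    (v : InfinitePlace K) : |(realMat E g v).det| = ‖(E.Ainf v).val.det‖ * v g.det := by
  unfold realMat
  rw [Matrix.det_mul, abs_mul, ← abs_rho, ← abs_realEmb]
  congr 2
  · exact ((rho v).toRingHom.map_det _).symm
  · exact ((realEmb v).map_det _).symm

theorem normInf_column (E : RigidAdelicSpace K) (g : Matrix (Fin 2) (Fin 2) K)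
    (v : InfinitePlace K) (α β : 𝓞 K) {x : E.carrier}
    (hx : ∀ i, E.φ x i = g i 0 * (α : K) + g i 1 * (β : K)) :
    E.normInf v x = √((realMat E g v 0 0 * sigma v α + realMat E g v 0 1 * sigma v β) ^ 2 +
      (realMat E g v 1 0 * sigma v α + realMat E g v 1 1 * sigma v β) ^ 2) := by
  rw [normInf_eq]
  unfold realMat
  simp only [hx, map_add, map_mul, realEmb_coe, Matrix.mul_apply, Fin.sum_univ_two,
    Matrix.map_apply]
  congr 3 <;> ring

theorem normFin_column_le_one [IsPrincipalIdealRing (𝓞 K)] (E : RigidAdelicSpace K)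
    {g : Matrix (Fin 2) (Fin 2) K} (hg : IsIntegralBasis E g) (v : HeightOneSpectrum (𝓞 K))
    (α β : 𝓞 K) {x : E.carrier}
    (hx : ∀ i, E.φ x i = g i 0 * (α : K) + g i 1 * (β : K)) : E.normFin v x ≤ 1 := by
  have key : ∀ i, ‖((E.Afin v).val *ᵥ
      fun j => algebraMap K (v.adicCompletion K) (E.φ x j)) i‖ ≤ 1 := by
    intro i
    have e : ((E.Afin v).val *ᵥ fun j => algebraMap K (v.adicCompletion K) (E.φ x j)) i =
        localMat E g v i 0 * algebraMap K (v.adicCompletion K) (α : K) +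
          localMat E g v i 1 * algebraMap K (v.adicCompletion K) (β : K) := by
      unfold localMat
      simp only [Matrix.mulVec, dotProduct, Fin.sum_univ_two, hx, map_add, map_mul,
        Matrix.mul_apply, Matrix.map_apply]
      ring
    rw [e]
    refine (IsUltrametricDist.norm_add_le_max _ _).trans (max_le ?_ ?_)
    · rw [norm_mul]
      exact mul_le_one₀ (hg.2 v i 0) (norm_nonneg _) (norm_algebraMap_int_le_one v α)
    · rw [norm_mul]
      exact mul_le_one₀ (hg.2 v i 1) (norm_nonneg _) (norm_algebraMap_int_le_one v β)
  exact max_le (key 0) (key 1)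

theorem height_eq_of_unimodular [IsPrincipalIdealRing (𝓞 K)] (E : RigidAdelicSpace K)
    {g : Matrix (Fin 2) (Fin 2) K} (hg : IsIntegralBasis E g)
    (hdet : ∀ v, ‖(localMat E g v).det‖ = 1) :
    E.height = (∏ v : InfinitePlace K, |(realMat E g v).det|) ^
      (1 / (Module.finrank ℚ K : ℝ)) := by
  unfold RigidAdelicSpace.height
  congr 1
  have h1 : ∀ v : HeightOneSpectrum (𝓞 K), ‖(E.Afin v).val.det‖ =
      ‖algebraMap K (v.adicCompletion K) g.det‖⁻¹ := by
    intro v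
    have h := hdet v
    rw [det_localMat, norm_mul] at h
    exact eq_inv_of_mul_eq_one_left h
  rw [finprod_congr h1, finprod_inv_distrib, finprod_norm_algebraMap hg.1, inv_inv,
    ← Finset.prod_mul_distrib]
  refine Finset.prod_congr rfl fun v _ => ?_
  rw [abs_det_realMat, mult_eq_one, pow_one, pow_one]

/-! ### Finiteness of the Hermite constant -/

variable (K) in
-- In a basis unimodular at the finite places, the norms at infinity are given by a point `τ`. If
-- `h` moves `τ` to `w` in the Siegel set, the rows of `h` provide vectors whose norms involve `|cτ
-- + d|` and `|aτ + b|`. At each place the product of the two norms is `|det| σ_v(det h) |w|/Im w`,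
-- where the `σ_v(det h)` multiply to 1.
theorem exists_basis_heightVec_le [IsPrincipalIdealRing (𝓞 K)] :
    ∃ Q : ℝ, 0 ≤ Q ∧ ∀ E : RigidAdelicSpace K, ∃ x y : E.carrier,
      Submodule.span K {x, y} = ⊤ ∧ E.heightVec x * E.heightVec y ≤ Q * E.height := by
  obtain ⟨B, δ, hB, hδ, hS⟩ := exists_smul_mem_siegel K
  -- A bound for `|w| / Im w` on the Siegel set.
  let Q : ℝ := √(B ^ 2 / δ ^ 2 + 1)
  have hQ0 : 0 ≤ Q := Real.sqrt_nonneg _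
  have hQsq : Q ^ 2 = B ^ 2 / δ ^ 2 + 1 := Real.sq_sqrt (by positivity)
  refine ⟨Q, hQ0, fun E => ?_⟩
  obtain ⟨g, hg, hdet⟩ := exists_unimodular_basis E
  have hdetB : ∀ v, (realMat E g v).det ≠ 0 := by
    intro v
    rw [← abs_pos, abs_det_realMat]
    exact mul_pos (norm_pos_iff.2 (E.Ainf v).det_ne_zero) (InfinitePlace.pos_iff.2 hg.1)
  have hform : ∀ v, ∃ z : ℍ, ∀ a b : ℝ,
      (realMat E g v 0 0 * a + realMat E g v 0 1 * b) ^ 2 +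
        (realMat E g v 1 0 * a + realMat E g v 1 1 * b) ^ 2 =
      |(realMat E g v).det| * ((-b * z.re + a) ^ 2 + (-b * z.im) ^ 2) / z.im := by
    intro v
    have h := hdetB v
    rw [Matrix.det_fin_two] at h ⊢
    exact exists_upperHalfPlane_form _ _ _ _ h
  choose τ hτ using hform
  obtain ⟨h, hh⟩ := hS τ
  let a := h.1.val 0 0
  let b := h.1.val 0 1
  let c := h.1.val 1 0
  let d := h.1.val 1 1
  have hrow : ¬(c = 0 ∧ d = 0) := not_and_eq_zero_of_isCoprime (isCoprime_bottom_row h)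
  have hdeth : h.1.val.det = a * d - b * c := Matrix.det_fin_two _
  -- The form of `τ` at `(α, β)` is `|α - βτ|²`, so the columns `(d, -c)` and `(b, -a)` give `|cτ +
  -- d|²` and `|aτ + b|²`.
  let T : Matrix (Fin 2) (Fin 2) K := !![(d : K), (b : K); -(c : K), -(a : K)]
  have hT : T.det ≠ 0 := by
    have e : T.det = -((h.1.val.det : 𝓞 K) : K) := by
      rw [Matrix.det_fin_two_of, hdeth]
      have e1 : ((a * d - b * c : 𝓞 K) : K) = (a : K) * d - b * c := rfl
      rw [e1]
      ring
    rw [e, neg_ne_zero]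
    simpa using (isUnit_det_totPosGL h).ne_zero
  let x := E.φ.symm fun i => (g * T) i 0
  let y := E.φ.symm fun i => (g * T) i 1
  have hx : ∀ i, E.φ x i = g i 0 * (d : K) + g i 1 * ((-c : 𝓞 K) : K) := by
    intro i
    have e1 : ((-c : 𝓞 K) : K) = -(c : K) := rfl
    simp only [x, LinearEquiv.apply_symm_apply, Matrix.mul_apply, Fin.sum_univ_two, e1]
    rfl
  have hy : ∀ i, E.φ y i = g i 0 * (b : K) + g i 1 * ((-a : 𝓞 K) : K) := by
    intro i
    have e1 : ((-a : 𝓞 K) : K) = -(a : K) := rfl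
    simp only [y, LinearEquiv.apply_symm_apply, Matrix.mul_apply, Fin.sum_univ_two, e1]
    rfl
  refine ⟨x, y, span_columns_eq_top E (by
    rw [Matrix.det_mul]
    exact mul_ne_zero hg.1 hT), ?_⟩
  have hlocal : ∀ v, E.normInf v x * E.normInf v y ≤
      |(realMat E g v).det| * sigma v h.1.val.det * Q := by
    intro v
    rw [normInf_column E g v d (-c) hx, normInf_column E g v b (-a) hy, hτ, hτ,
      ← Real.sqrt_mul (by have := (τ v).im_pos; positivity)]
    have hD := abs_pos.2 (hdetB v)
    have hdv := h.2 v
    refine Real.sqrt_le_iff.2 ⟨by positivity, ?_⟩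
    rw [mul_pow _ Q, hQsq]
    have hn := normSq_linear_pos τ hrow v
    have him := im_toExt_smul h τ v
    have hcoe := coe_toExt_smul h τ v
    rw [eq_div_iff (linear_sigma_ne_zero τ hrow v)] at hcoe
    have hcoe' := congrArg Complex.normSq hcoe
    rw [map_mul] at hcoe'
    obtain ⟨hre, hδy⟩ := hh v
    have e1 : (-sigma v (-c) * (τ v).re + sigma v d) ^ 2 + (-sigma v (-c) * (τ v).im) ^ 2 =
        Complex.normSq (sigma v c * (τ v : ℂ) + sigma v d) := by
      rw [normSq_linear, map_neg, neg_neg]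
    have e2 : (-sigma v (-a) * (τ v).re + sigma v b) ^ 2 + (-sigma v (-a) * (τ v).im) ^ 2 =
        Complex.normSq (sigma v a * (τ v : ℂ) + sigma v b) := by
      rw [normSq_linear, map_neg, neg_neg]
    rw [e1, e2, ← hcoe', Complex.normSq_apply ((toExt K h • τ) v : ℂ), coe_re, coe_im]
    set N := Complex.normSq (sigma v c * (τ v : ℂ) + sigma v d)
    set X := ((toExt K h • τ) v).re
    set Y := ((toExt K h • τ) v).im
    set D := |(realMat E g v).det|
    set u := sigma v h.1.val.det
    have hY : 0 < Y := hδ.trans_le hδy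
    have hy0 := (τ v).im_pos
    change Y = u * (τ v).im / N at him
    have hNY : N / (τ v).im = u / Y := by
      rw [him]
      field_simp
    have e3 : D * N / (τ v).im * (D * ((X * X + Y * Y) * N) / (τ v).im) =
        D ^ 2 * (N / (τ v).im) ^ 2 * (X ^ 2 + Y ^ 2) := by ring
    have e4 : (X ^ 2 + Y ^ 2) / Y ^ 2 ≤ B ^ 2 / δ ^ 2 + 1 := by
      rw [add_div, div_self (by positivity)]
      refine add_le_add ?_ le_rfl
      exact div_le_div₀ (by positivity) (sq_le_sq' (neg_le_of_abs_le hre) (le_of_abs_le hre))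
        (by positivity) (pow_le_pow_left₀ hδ.le hδy 2)
    calc _ = D ^ 2 * (N / (τ v).im) ^ 2 * (X ^ 2 + Y ^ 2) := e3
      _ = (D * u) ^ 2 * ((X ^ 2 + Y ^ 2) / Y ^ 2) := by
        rw [hNY]
        ring
      _ ≤ _ := mul_le_mul_of_nonneg_left e4 (by positivity)
  have hfin : ∀ z : E.carrier, (∀ v, E.normFin v z ≤ 1) →
      ∏ᶠ v : HeightOneSpectrum (𝓞 K), E.normFin v z ≤ 1 := fun z hz =>
    (finprod_induction (fun r : ℝ => 0 ≤ r ∧ r ≤ 1) ⟨zero_le_one, le_rfl⟩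
      (fun _ _ h h' => ⟨mul_nonneg h.1 h'.1, mul_le_one₀ h.2 h'.1 h'.2⟩)
      fun v => ⟨normFin_nonneg E v z, hz v⟩).2
  have hfx := hfin x fun v => normFin_column_le_one E hg v d (-c) hx
  have hfy := hfin y fun v => normFin_column_le_one E hg v b (-a) hy
  have hfx0 := finprod_normFin_nonneg E x
  have hfy0 := finprod_normFin_nonneg E y
  have hPx : 0 ≤ ∏ v : InfinitePlace K, E.normInf v x :=
    Finset.prod_nonneg fun v _ => normInf_nonneg E v x
  have hPy : 0 ≤ ∏ v : InfinitePlace K, E.normInf v y :=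
    Finset.prod_nonneg fun v _ => normInf_nonneg E v y
  have hprod : (∏ v : InfinitePlace K, E.normInf v x) * ∏ v : InfinitePlace K, E.normInf v y ≤
      (∏ v : InfinitePlace K, |(realMat E g v).det|) * Q ^ Module.finrank ℚ K := by
    rw [← Finset.prod_mul_distrib]
    refine (Finset.prod_le_prod (fun v _ => mul_nonneg (normInf_nonneg E v x)
      (normInf_nonneg E v y)) fun v _ => hlocal v).trans_eq ?_
    rw [Finset.prod_mul_distrib, Finset.prod_mul_distrib, prod_sigma_det, mul_one,
      Finset.prod_const, Finset.card_univ, card_infinitePlace]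
  have hn : (Module.finrank ℚ K : ℝ) ≠ 0 := Nat.cast_ne_zero.2 Module.finrank_pos.ne'
  rw [heightVec_eq, heightVec_eq, height_eq_of_unimodular E hg hdet,
    ← Real.mul_rpow (mul_nonneg hPx hfx0) (mul_nonneg hPy hfy0)]
  have hQ : Q = (Q ^ Module.finrank ℚ K) ^ (1 / (Module.finrank ℚ K : ℝ)) := by
    rw [← Real.rpow_natCast, ← Real.rpow_mul hQ0, mul_one_div_cancel hn, Real.rpow_one]
  have hD0 : 0 ≤ ∏ v : InfinitePlace K, |(realMat E g v).det| :=
    Finset.prod_nonneg fun v _ => abs_nonneg _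
  conv_rhs => rw [hQ, ← Real.mul_rpow (pow_nonneg hQ0 _) hD0]
  refine Real.rpow_le_rpow (mul_nonneg (mul_nonneg hPx hfx0) (mul_nonneg hPy hfy0)) ?_
    (by positivity)
  calc _ ≤ (∏ v : InfinitePlace K, E.normInf v x) * ∏ v : InfinitePlace K, E.normInf v y :=
        mul_le_mul (mul_le_of_le_one_right hPx hfx) (mul_le_of_le_one_right hPy hfy)
          (mul_nonneg hPy hfy0) hPx
    _ ≤ _ := hprod
    _ = _ := mul_comm _ _

variable (K) in
theorem bddAbove_hermiteRatio [IsPrincipalIdealRing (𝓞 K)] :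
    BddAbove (Set.range (RigidAdelicSpace.hermiteRatio (K := K))) := by
  obtain ⟨Q, hQ, h⟩ := exists_basis_heightVec_le K
  refine ⟨√Q, ?_⟩
  rintro _ ⟨E, rfl⟩
  obtain ⟨x, y, hspan, hle⟩ := h E
  refine Real.sqrt_le_sqrt ?_
  rw [div_le_iff₀ (height_pos E)]
  exact (Lambda1_mul_Lambda2_le E hspan).trans hle

end

/-! ### The rigid adelic space of a point -/

section

variable {K : Type u} [Field K] [NumberField K] [IsTotallyReal K]

theorem det_pointMat (z : ℍ) :
    Matrix.det !![1 / √z.im, -z.re / √z.im; 0, √z.im] = (1 : ℝ) := by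
  have := (Real.sqrt_pos.2 z.im_pos).ne'
  rw [Matrix.det_fin_two_of]
  field_simp
  ring

/-- A real matrix of determinant one for which the form `‖A (a, b)‖²` is `|a - b z|² / Im z`. -/
def pointMat (z : ℍ) : GL (Fin 2) ℝ :=
  GeneralLinearGroup.mkOfDetNeZero !![1 / √z.im, -z.re / √z.im; 0, √z.im]
    (by rw [det_pointMat]; exact one_ne_zero)

/-- The rigid adelic space attached to a point of the product of upper half-planes. -/
def pointSpace (τ : Hn K) : RigidAdelicSpace K where
  carrier := Fin 2 → K
  φ := LinearEquiv.refl K _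
  Ainf v := GeneralLinearGroup.map ((rho v).symm : ℝ →+* v.Completion) (pointMat (τ v))
  Afin _ := 1
  almost_all_integral := Filter.Eventually.of_forall fun _ => one_mem _

theorem rho_pointSpace (τ : Hn K) (v : InfinitePlace K) (i j : Fin 2) :
    rho v (((pointSpace τ).Ainf v).val i j) =
      !![1 / √(τ v).im, -(τ v).re / √(τ v).im; 0, √(τ v).im] i j :=
  (rho v).apply_symm_apply _

theorem norm_det_pointSpace (τ : Hn K) (v : InfinitePlace K) :
    ‖((pointSpace τ).Ainf v).val.det‖ = 1 := by
  rw [← abs_rho]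
  have h : rho v ((pointSpace τ).Ainf v).val.det =
      (((pointSpace τ).Ainf v).val.map (rho v)).det := (rho v).toRingHom.map_det _
  have h2 : ((pointSpace τ).Ainf v).val.map (rho v) =
      !![1 / √(τ v).im, -(τ v).re / √(τ v).im; 0, √(τ v).im] :=
    Matrix.ext fun i j => rho_pointSpace τ v i j
  rw [h, h2, det_pointMat, abs_one]

theorem height_pointSpace (τ : Hn K) : (pointSpace τ).height = 1 := by
  unfold RigidAdelicSpace.height
  have h : ∀ v : HeightOneSpectrum (𝓞 K), ‖((pointSpace τ).Afin v).val.det‖ = 1 := by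
    intro v
    change ‖(1 : Matrix (Fin 2) (Fin 2) (v.adicCompletion K)).det‖ = 1
    rw [Matrix.det_one, norm_one]
  simp_rw [norm_det_pointSpace, one_pow]
  rw [finprod_congr h, finprod_one, Finset.prod_const_one, one_mul, Real.one_rpow]

theorem normInf_pointSpace (τ : Hn K) (v : InfinitePlace K) {x : (pointSpace τ).carrier} {l : K}
    {α β : 𝓞 K} (e0 : (pointSpace τ).φ x 0 = l * α) (e1 : (pointSpace τ).φ x 1 = l * β) :
    (pointSpace τ).normInf v x =
      v l * √(Complex.normSq (sigma v (-β) * (τ v : ℂ) + sigma v α) / (τ v).im) := by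
  rw [normInf_eq, rho_pointSpace, rho_pointSpace, rho_pointSpace, rho_pointSpace]
  rw [e0, e1, map_mul, map_mul, realEmb_coe, realEmb_coe, normSq_linear, map_neg,
    ← abs_realEmb, ← Real.sqrt_sq_eq_abs, ← Real.sqrt_mul (sq_nonneg _)]
  congr 1
  have hy := (τ v).im_pos
  have hs := Real.sqrt_pos.2 hy
  have hsq := (Real.sq_sqrt hy.le).symm
  simp only [of_apply, cons_val', cons_val_zero, cons_val_one, cons_val_fin_one]
  generalize √(τ v).im = s at hs hsq ⊢
  rw [hsq]
  field_simp
  ring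

theorem normFin_pointSpace (τ : Hn K) (v : HeightOneSpectrum (𝓞 K)) {x : (pointSpace τ).carrier}
    {l : K} {α β : 𝓞 K} (hcop : IsCoprime α β) (e0 : (pointSpace τ).φ x 0 = l * α)
    (e1 : (pointSpace τ).φ x 1 = l * β) :
    (pointSpace τ).normFin v x = ‖algebraMap K (v.adicCompletion K) l‖ := by
  have e2 : ((pointSpace τ).Afin v).val = 1 := rfl
  unfold RigidAdelicSpace.normFin
  simp only [e2, Matrix.one_mulVec, e0, e1, map_mul, norm_mul]
  rw [← mul_max_of_nonneg _ _ (norm_nonneg _)]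
  have h : max ‖algebraMap K (v.adicCompletion K) (α : K)‖
      ‖algebraMap K (v.adicCompletion K) (β : K)‖ = 1 := by
    refine le_antisymm (max_le (norm_algebraMap_int_le_one v α)
      (norm_algebraMap_int_le_one v β)) ?_
    by_contra! hlt
    obtain ⟨h1, h2⟩ := max_lt_iff.1 hlt
    rw [norm_algebraMap_int_lt_one_iff] at h1 h2
    obtain ⟨p, q, hpq⟩ := hcop
    refine v.isPrime.ne_top ((Ideal.eq_top_iff_one _).2 ?_)
    rw [← hpq]
    exact Ideal.add_mem _ (Ideal.mul_mem_left _ _ h1) (Ideal.mul_mem_left _ _ h2)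
  rw [h, mul_one]

/-- Write `x` as a scalar times a coprime pair. The product formula removes the scalar and
coprimality makes the finite norms trivial, so what remains of the height is a power of `1/μ(τ, [α :
β])`. -/
theorem le_heightVec_pointSpace [IsPrincipalIdealRing (𝓞 K)] (τ : Hn K)
    {x : (pointSpace τ).carrier} (hx : x ≠ 0) :
    √(mu1 τ)⁻¹ ^ (1 / (Module.finrank ℚ K : ℝ)) ≤ (pointSpace τ).heightVec x := by
  obtain ⟨l, α, β, hl, hcop, h⟩ := exists_eq_smul_coprime (x := x) hx
  have e0 : (pointSpace τ).φ x 0 = l * α := congrFun h 0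
  have e1 : (pointSpace τ).φ x 1 = l * β := congrFun h 1
  rw [heightVec_eq]
  refine Real.rpow_le_rpow (Real.sqrt_nonneg _) ?_ (by positivity)
  have hl' : ∏ v : InfinitePlace K, v l ≠ 0 :=
    Finset.prod_ne_zero_iff.2 fun v _ => (InfinitePlace.pos_iff.2 hl).ne'
  rw [Finset.prod_congr rfl fun v _ => normInf_pointSpace τ v e0 e1,
    finprod_congr fun v => normFin_pointSpace τ v hcop e0 e1, finprod_norm_algebraMap hl,
    Finset.prod_mul_distrib]
  simp_rw [mult_eq_one, pow_one]
  rw [mul_right_comm, mul_inv_cancel₀ hl', one_mul, ← Real.sqrt_prod _ fun v _ =>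
    div_nonneg (Complex.normSq_nonneg _) (τ v).im_pos.le, Finset.prod_div_distrib]
  refine Real.sqrt_le_sqrt ?_
  change (mu1 τ)⁻¹ ≤ den τ (-β) α / hgt τ
  have h1 : hgt τ / den τ (-β) α ≤ mu1 τ := by
    rw [← muPair_of_isCoprime τ hcop]
    refine (mu1_isGreatest τ).2 ?_
    rw [← range_mu]
    exact ⟨Projectivization.mk K _ (coe_pair_ne_zero hcop),
      mu_eq τ _ α β ⟨coe_pair_ne_zero hcop, rfl⟩⟩
  rw [← inv_div (hgt τ)]
  refine inv_anti₀ (div_pos (hgt_pos τ) (den_pos τ fun h => ?_)) h1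
  exact not_and_eq_zero_of_isCoprime hcop ⟨h.2, neg_eq_zero.1 h.1⟩

/-- Both minima of `pointSpace τ` are bounded below by the height bound valid for all nonzero
vectors, and the space has height 1. Finiteness of the supremum is needed to compare it with a
member. -/
theorem le_hermiteConstant [IsPrincipalIdealRing (𝓞 K)] (τ : Hn K) :
    √(mu1 τ)⁻¹ ^ (1 / (Module.finrank ℚ K : ℝ)) ≤ hermiteConstant K := by
  refine le_trans ?_ (le_csSup (bddAbove_hermiteRatio K) ⟨pointSpace τ, rfl⟩)
  set L := √(mu1 τ)⁻¹ ^ (1 / (Module.finrank ℚ K : ℝ))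
  have hL0 : 0 ≤ L := Real.rpow_nonneg (Real.sqrt_nonneg _) _
  have hspan := span_columns_eq_top (pointSpace τ) (G := (1 : Matrix (Fin 2) (Fin 2) K))
    (by rw [Matrix.det_one]; exact one_ne_zero)
  have h1 : L ≤ (pointSpace τ).Lambda1 := by
    refine le_csInf ⟨_, _, left_ne_zero_of_span_eq_top _ hspan, rfl⟩ ?_
    rintro _ ⟨x, hx, rfl⟩
    exact le_heightVec_pointSpace τ hx
  have h2 : L ≤ (pointSpace τ).Lambda2 := by
    refine le_csInf ⟨_, _, _, hspan, rfl⟩ ?_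
    rintro _ ⟨x, y, hxy, rfl⟩
    exact (le_heightVec_pointSpace τ (left_ne_zero_of_span_eq_top _ hxy)).trans (le_max_left _ _)
  unfold RigidAdelicSpace.hermiteRatio
  rw [height_pointSpace, div_one]
  refine Real.le_sqrt_of_sq_le ?_
  rw [sq]
  exact mul_le_mul h1 h2 hL0 (hL0.trans h1)

variable (K) in
theorem hermiteConstant_pos [IsPrincipalIdealRing (𝓞 K)] : 0 < hermiteConstant K := by
  have τ : Hn K := fun _ => UpperHalfPlane.I
  refine (Real.rpow_pos_of_pos (Real.sqrt_pos.2 (inv_pos.2 (mu1_pos τ))) _).trans_le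
    (le_hermiteConstant τ)

theorem inv_hermiteConstant_pow_le_mu1 [IsPrincipalIdealRing (𝓞 K)] (τ : Hn K) :
    1 / hermiteConstant K ^ (2 * Module.finrank ℚ K) ≤ mu1 τ := by
  have hn : (Module.finrank ℚ K : ℝ) ≠ 0 := Nat.cast_ne_zero.2 Module.finrank_pos.ne'
  have hμ := inv_pos.2 (mu1_pos τ)
  have h := pow_le_pow_left₀ (Real.rpow_nonneg (Real.sqrt_nonneg _) _) (le_hermiteConstant τ)
    (2 * Module.finrank ℚ K)
  rw [mul_comm 2, pow_mul, ← Real.rpow_natCast (_ ^ (1 / (Module.finrank ℚ K : ℝ))),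
    ← Real.rpow_mul (Real.sqrt_nonneg _), one_div_mul_cancel hn, Real.rpow_one,
    Real.sq_sqrt hμ.le] at h
  rw [one_div, mul_comm 2]
  exact inv_le_of_inv_le₀ (mu1_pos τ) h

end

/-! ### The moments of `μ₁` -/

section

variable {K : Type u} [Field K] [NumberField K] [IsTotallyReal K] [IsPrincipalIdealRing (𝓞 K)]

theorem restrict_lt_mu1 (F : Set (Hn K)) (s : ℝ) :
    volume.restrict F {τ | s < mu1 τ} = volume (F ∩ {τ | s < mu1 τ}) := by
  rw [Measure.restrict_apply (measurableSet_lt measurable_const measurable_mu1), Set.inter_comm]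

theorem volume_inter_one_lt_mu1 {F : Set (Hn K)}
    (hF : IsFundamentalDomain (ExtHilbertGroup K) F volume) {s : ℝ} (hs : 1 ≤ s) :
    ENNReal.ofReal s * volume (F ∩ {τ | s < mu1 τ}) = volume (F ∩ {τ | 1 < mu1 τ}) := by
  obtain ⟨D, hD⟩ := exists_fundamentalDomain_cuspGroup K
  have h : ∀ r : ℝ, 1 ≤ r → volume (F ∩ {τ | r < mu1 τ}) = volume (D ∩ horoball K r) :=
    fun r hr => le_antisymm (volume_inter_lt_mu1_le hF hD r) (volume_inter_horoball_le hF hD hr)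
  rw [h s hs, h 1 le_rfl, volume_inter_horoball_one hD (zero_lt_one.trans_le hs)]

/-- For `s < m` the set `{μ₁ > s}` is everything, so the unfolding inequality and scaling give `s ·
vol F ≤ C(1)`. Strictness matters, as `μ₁` may equal `m`; the bound at `m` follows in the limit. -/
theorem mul_volume_le_of_le_mu1 {F : Set (Hn K)}
    (hF : IsFundamentalDomain (ExtHilbertGroup K) F volume) {m : ℝ} (hm : ∀ τ : Hn K, m ≤ mu1 τ) :
    ENNReal.ofReal m * volume F ≤ volume (F ∩ {τ | 1 < mu1 τ}) := by
  obtain ⟨D, hD⟩ := exists_fundamentalDomain_cuspGroup K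
  have key : ∀ s : ℝ, 0 < s → s < m →
      ENNReal.ofReal s * volume F ≤ volume (F ∩ {τ | 1 < mu1 τ}) := by
    intro s hs hsm
    have hall : F ∩ {τ | s < mu1 τ} = F :=
      Set.inter_eq_left.2 fun τ _ => hsm.trans_le (hm τ)
    calc ENNReal.ofReal s * volume F
        ≤ ENNReal.ofReal s * volume (D ∩ horoball K s) := by
          refine mul_le_mul' le_rfl ?_
          simpa only [hall] using volume_inter_lt_mu1_le hF hD s
      _ = volume (D ∩ horoball K 1) := (volume_inter_horoball_one hD hs).symm
      _ ≤ _ := volume_inter_horoball_le hF hD le_rfl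
  rcases le_or_gt m 0 with h0 | h0
  · simp [ENNReal.ofReal_of_nonpos h0]
  have hlim : Filter.Tendsto (fun s : ℝ => ENNReal.ofReal s * volume F) (nhdsWithin m (Set.Iio m))
      (nhds (ENNReal.ofReal m * volume F)) :=
    ENNReal.Tendsto.mul_const
      (ENNReal.continuous_ofReal.continuousAt.tendsto.mono_left nhdsWithin_le_nhds)
      (Or.inr (volume_fundamentalDomain_lt_top hF).ne)
  refine le_of_tendsto hlim ?_
  filter_upwards [Ioo_mem_nhdsLT h0] with s hs using key s hs.1 hs.2

end

end HilbertModular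

end

/-! ### The moment inequalities -/

theorem mainTheorem2 (K : Type*) [Field K] [NumberField K] [IsTotallyReal K]
    (hK : classNumber K = 1) :
    -- the Hermite constant is finite, and the maximum that defines `μ₁` is attained
    BddAbove (Set.range (HilbertModular.RigidAdelicSpace.hermiteRatio (K := K))) ∧
    (∀ τ : HilbertModular.Hn K,
      IsGreatest (Set.range (HilbertModular.mu τ)) (HilbertModular.mu1 τ)) ∧
    -- integrals over the Hilbert modular variety are integrals over a fundamental domain
    (∃ F : Set (HilbertModular.Hn K),
      IsFundamentalDomain (HilbertModular.ExtHilbertGroup K) F volume) ∧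
    ∀ F : Set (HilbertModular.Hn K),
      IsFundamentalDomain (HilbertModular.ExtHilbertGroup K) F volume →
      0 < volume F ∧ volume F < ⊤ ∧
      ∀ t : ℝ, 0 ≤ t → t < 1 →
        IntegrableOn (fun τ => HilbertModular.mu1 τ ^ t) F volume ∧
        1 / HilbertModular.hermiteConstant K ^ (2 * (Module.finrank ℚ K : ℝ) * t) +
            t / (1 - t) * (1 / HilbertModular.hermiteConstant K ^ (2 * Module.finrank ℚ K)) ≤
          1 / (volume F).toReal * (∫ τ in F, HilbertModular.mu1 τ ^ t ∂volume) ∧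
        1 / (volume F).toReal * (∫ τ in F, HilbertModular.mu1 τ ^ t ∂volume) ≤ 1 / (1 - t) := by
  have : IsPrincipalIdealRing (𝓞 K) := classNumber_eq_one_iff.1 hK
  refine ⟨HilbertModular.bddAbove_hermiteRatio K, fun τ => ?_,
    HilbertModular.exists_fundamentalDomain_ext K, fun F hF =>
    ⟨HilbertModular.volume_fundamentalDomain_pos hF,
      HilbertModular.volume_fundamentalDomain_lt_top hF, fun t ht0 ht1 => ?_⟩⟩
  · rw [HilbertModular.range_mu]
    exact HilbertModular.mu1_isGreatest τ
  have hc := HilbertModular.hermiteConstant_pos K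
  have hm := HilbertModular.inv_hermiteConstant_pow_le_mu1 (K := K)
  have : IsFiniteMeasure (volume.restrict F) :=
    ⟨by rw [Measure.restrict_apply_univ]; exact HilbertModular.volume_fundamentalDomain_lt_top hF⟩
  have h := HilbertModular.moment_bounds (volume.restrict F)
    (by rw [Measure.restrict_apply_univ]
        exact (HilbertModular.volume_fundamentalDomain_pos hF).ne')
    HilbertModular.measurable_mu1 (one_div_pos.2 (pow_pos hc (2 * Module.finrank ℚ K))) hm
    (fun s hs => by
      rw [HilbertModular.restrict_lt_mu1, HilbertModular.restrict_lt_mu1]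
      exact HilbertModular.volume_inter_one_lt_mu1 hF hs)
    (by rw [Measure.restrict_apply_univ, HilbertModular.restrict_lt_mu1]
        exact HilbertModular.mul_volume_le_of_le_mu1 hF hm) ht0 ht1
  have hpow : (1 / HilbertModular.hermiteConstant K ^ (2 * Module.finrank ℚ K)) ^ t =
      1 / HilbertModular.hermiteConstant K ^ (2 * (Module.finrank ℚ K : ℝ) * t) := by
    rw [Real.div_rpow zero_le_one (pow_nonneg hc.le _), Real.one_rpow, ← Real.rpow_natCast,
      ← Real.rpow_mul hc.le]
    push_cast
    rfl
  rwa [Measure.restrict_apply_univ, hpow] at h
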